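/- Let $n\ge 3$. There exist constants $\sigma_n>0$ and $C_n>0$, depending only on $n$, with the following property. Let $\Omega\subset\mathbb{R}^n$ be a bounded domain (open, connected, non-empty) with $0\in\partial\Omega$, put $D=\sup_{x\in\Omega}|x|$, and suppose that $\Omega$ satisfies an exterior ball condition at $0$ with a ball of radius $\rho>0$, i.e. there is an open ball of radius $\rho$ whose boundary sphere contains $0$ and which is contained in $\mathbb{R}^n\setminus\overline{\Omega}$. If $\rho\ge D/\sigma_n$, then \[ \int_\Omega|\nabla u|^2\,dx\;\ge\;\frac{n^2}{4}\int_\Omega\frac{u^2}{|x|^2}\,dx+C_n\left(\int_\Omega X_1^{\frac{2n-2}{n-2}}|u|^{\frac{2n}{n-2}}\,dx\right)^{\frac{n-2}{n}}\qquad\text{for all real-valued }u\in C_c^\infty(\Omega), \] where $X_1=X_1(|x|/3D)$ and $X_1(t)=\dfrac{1}{1-\ln t}$ for $t\in(0,1)$. If in addition $\Omega$ satisfies an interior ball condition at $0$, i.e. there is an open ball of positive radius whose boundary sphere contains $0$ and which is contained in $\Omega$, then the exponent $\frac{2n-2}{n-2}$ of $X_1$ is sharp: for every real $p<\frac{2n-2}{n-2}$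 there is no constant $C>0$ such that \[ \int_\Omega|\nabla u|^2\,dx\;\ge\;\frac{n^2}{4}\int_\Omega\frac{u^2}{|x|^2}\,dx+C\left(\int_\Omega X_1^{p}|u|^{\frac{2n}{n-2}}\,dx\right)^{\frac{n-2}{n}}\qquad\text{for all real-valued }u\in C_c^\infty(\Omega), \] with the same $X_1=X_1(|x|/3D)$. -/

import Mathlib

open MeasureTheory
open scoped ContDiff

/-- The logarithmic weight `X₁(t) = 1 / (1 - ln t)`; it is only used for `0 < t < 1`. -/
noncomputable def logWeight (t : ℝ) : ℝ := 1 / (1 - Real.log t)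

/-- `D = sup_{x ∈ Ω} |x|`. -/
noncomputable def supNorm {n : ℕ} (Ω : Set (EuclideanSpace ℝ (Fin n))) : ℝ :=
  sSup ((fun x => ‖x‖) '' Ω)

/-- Exterior ball condition at the origin, with an exterior ball of radius `ρ`: some open ball of
radius `ρ > 0` whose boundary sphere passes through the origin lies in the complement of the
closure of `Ω`. -/
def HasExteriorBallAtZero {n : ℕ} (Ω : Set (EuclideanSpace ℝ (Fin n))) (ρ : ℝ) : Prop :=
  0 < ρ ∧ ∃ c : EuclideanSpace ℝ (Fin n), ‖c‖ = ρ ∧ Metric.ball c ρ ⊆ (closure Ω)ᶜ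

/-- Interior ball condition at the origin: some open ball of positive radius whose boundary sphere
passes through the origin lies in `Ω`. -/
def HasInteriorBallAtZero {n : ℕ} (Ω : Set (EuclideanSpace ℝ (Fin n))) : Prop :=
  ∃ r : ℝ, 0 < r ∧ ∃ c : EuclideanSpace ℝ (Fin n), ‖c‖ = r ∧ Metric.ball c r ⊆ Ω

/-- The class `C_c^∞(Ω)` of smooth real functions with compact support contained in `Ω`. -/
def IsTestFunctionOn {n : ℕ} (Ω : Set (EuclideanSpace ℝ (Fin n)))
    (u : EuclideanSpace ℝ (Fin n) → ℝ) : Prop :=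
  ContDiff ℝ ∞ u ∧ HasCompactSupport u ∧ tsupport u ⊆ Ω

/-- The Hardy-Sobolev inequality on `Ω` with Hardy constant `n² / 4`, Sobolev constant `C` and
exponent `p` on the weight `X₁ = X₁(|x| / 3D)`, for all test functions on `Ω`:
`∫_Ω |∇u|² ≥ n²/4 ∫_Ω u²/|x|² + C (∫_Ω X₁^p |u|^(2n/(n-2)))^((n-2)/n)`.
If `Ω` is open and does not contain the origin, every integrand is continuous with compact support
in `Ω`, so all the integrals are finite. -/
def HardySobolevInequality {n : ℕ} (Ω : Set (EuclideanSpace ℝ (Fin n))) (p C : ℝ) : Prop :=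
  ∀ u : EuclideanSpace ℝ (Fin n) → ℝ, IsTestFunctionOn Ω u →
    (∫ x in Ω, ‖gradient u x‖ ^ 2) ≥
      (n : ℝ) ^ 2 / 4 * (∫ x in Ω, u x ^ 2 / ‖x‖ ^ 2)
        + C * (∫ x in Ω, logWeight (‖x‖ / (3 * supNorm Ω)) ^ p
            * |u x| ^ (2 * (n : ℝ) / ((n : ℝ) - 2))) ^ (((n : ℝ) - 2) / (n : ℝ))

/-! ### Integration by parts against radial fields -/

section IntegrationByParts

variable {n : ℕ}

/-! Let c be the centre of the exterior ball, p = 2c and d = ⟨x, x - p⟩ = |x - c|² - ρ², which is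
positive on Ω. The function φ = d |x|^(-n/2) |x - p|^(-n/2) satisfies -Δφ = Vφ with V = (n²/4)|p|² /
(|x|²|x - p|²). For H = ∇φ/φ, completing the square gives ∫|∇u|² - ∫Vu² = ∫|∇u - uH|² =: P.
Perturbing H by -γ x/|x|² shows that P dominates ∫u²(x·∇γ - γ²)/|x|² up to a small error
(`setIntegral_mul_le_energy`). The choice γ = X₁/2 yields ∫u²X₁²/|x|² ≤ 8P. Since |p| is much larger
than D, n²/(4|x|²) exceeds V by at most a small multiple of X₁²/|x|², so at least P/2 is left in the
Hardy deficit (`half_energy_le`).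

For the Sobolev term, u is localized to dyadic shells |x| ~ R_k = D/2^k and the Euclidean Sobolev
inequality is applied in each. Let c_k = X₁(R_k/3D) and let b_k be the bound for the Dirichlet
integral on the k-th shell. Then c_k b_k ≲ P for every k, by taking for γ a smoothed step at scale
R_k, and Σ c_k² b_k ≲ P, by the X₁² inequality. With m = n/(n-2), Σ c_k^(m+1) b_k^m = Σ (c_k
b_k)^(m-1) c_k² b_k ≲ P^m, and m + 1 = (2n-2)/(n-2) is the exponent of X₁.

For sharpness, let p and d now belong to the interior ball and put ψ = -d |x|^(-n/2). This is a
ground state for n²/(4|x|²) up to a lower-order potential. It is multiplied by a cutoff f that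
varies on the logarithmic scale e^(-5T) ≤ |x| ≤ e^(-T). The Hardy deficit of fψ is O(1/T), whereas
the integral of X₁^a |fψ|^(2n/(n-2)) is at least of order T^(1-a). An inequality with exponent a ≥ 0
therefore bounds T^((1-a)(n-2)/n + 1) as T → ∞, which excludes a < (2n-2)/(n-2). -/

theorem integral_fderiv_sub_apply {G : EuclideanSpace ℝ (Fin n) → ℝ} (hG : ContDiff ℝ 1 G)
    (hc : HasCompactSupport G) (q : EuclideanSpace ℝ (Fin n)) :
    ∫ x, fderiv ℝ G x (x - q) = -(n : ℝ) * ∫ x, G x := by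
  have hd : Continuous (fderiv ℝ G) := hG.continuous_fderiv (by norm_num)
  have hcd : HasCompactSupport (fderiv ℝ G) := hc.fderiv ℝ
  set b := EuclideanSpace.basisFun (Fin n) ℝ with hb
  have key : ∀ i : Fin n, ∫ x, (x i - q i) * fderiv ℝ G x (b i) = - ∫ x, G x := by
    intro i
    have hint1 : Integrable (fun x : EuclideanSpace ℝ (Fin n) =>
        (x i - q i) * fderiv ℝ G x (b i)) := by
      refine Continuous.integrable_of_hasCompactSupport (by fun_prop) ?_
      exact hcd.mono fun x hx hx' => hx (by simp [hx'])
    have hint2 : Integrable G := hG.continuous.integrable_of_hasCompactSupport hc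
    have hint3 : Integrable (fun x : EuclideanSpace ℝ (Fin n) => (x i - q i) * G x) := by
      have := hG.continuous
      exact Continuous.integrable_of_hasCompactSupport (by fun_prop) hc.mul_left
    have h := integral_bilinear_hasFDerivAt_right_eq_neg_left_of_integrable
      (μ := (volume : Measure (EuclideanSpace ℝ (Fin n))))
      (f := fun x => x i - q i) (f' := fun _ => EuclideanSpace.proj i)
      (g := G) (g' := fderiv ℝ G) (v := b i) (B := ContinuousLinearMap.mul ℝ ℝ)
      (by simpa [hb] using hint2) (by simpa [sub_mul] using hint1) (by simpa [sub_mul] using hint3)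
      (fun x _ => by
        have : HasFDerivAt (fun x : EuclideanSpace ℝ (Fin n) => x i)
          (EuclideanSpace.proj i : EuclideanSpace ℝ (Fin n) →L[ℝ] ℝ) x :=
            (EuclideanSpace.proj i : EuclideanSpace ℝ (Fin n) →L[ℝ] ℝ).hasFDerivAt
        exact this.sub_const (q i))
      (fun x _ => (hG.differentiable (by norm_num) x).hasFDerivAt)
    simpa [hb, sub_mul] using h
  have hsum : ∀ x, fderiv ℝ G x (x - q) = ∑ i, (x i - q i) * fderiv ℝ G x (b i) := by
    intro x
    conv_lhs => rw [← b.sum_repr (x - q)]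
    simp [hb]
  simp_rw [hsum]
  rw [integral_finsetSum]
  · simp [key]
  · intro i _
    refine Continuous.integrable_of_hasCompactSupport (by fun_prop) ?_
    exact hcd.mono fun x hx hx' => hx (by simp [hx'])

/-- The fields below are singular outside Ω; near a point off the support of `u` the product
vanishes identically, so the singularities do no harm. -/
theorem contDiff_mul_of_tsupport_subset {E : Type*} [NormedAddCommGroup E] [NormedSpace ℝ E]
    {k : WithTop ℕ∞} {Ω : Set E} (hΩ : IsOpen Ω) {u f : E → ℝ} (hu : ContDiff ℝ k u)
    (hs : tsupport u ⊆ Ω) (hf : ContDiffOn ℝ k f Ω) : ContDiff ℝ k (fun x => u x * f x) := by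
  rw [contDiff_iff_contDiffAt]
  intro x
  by_cases hx : x ∈ tsupport u
  · exact hu.contDiffAt.mul (hf.contDiffAt (hΩ.mem_nhds (hs hx)))
  · refine (contDiffAt_const (c := (0 : ℝ))).congr_of_eventuallyEq ?_
    have : (tsupport u)ᶜ ∈ nhds x := (isClosed_tsupport u).isOpen_compl.mem_nhds hx
    filter_upwards [this] with y hy
    simp [image_eq_zero_of_notMem_tsupport hy]

theorem gradient_eq_zero_of_notMem_tsupport {u : EuclideanSpace ℝ (Fin n) → ℝ}
    {x : EuclideanSpace ℝ (Fin n)} (hx : x ∉ tsupport u) : gradient u x = 0 := by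
  have : fderiv ℝ u x = 0 := by
    have := support_fderiv_subset ℝ (f := u)
    by_contra h
    exact hx (this h)
  simp [gradient, this]

theorem continuous_gradient {u : EuclideanSpace ℝ (Fin n) → ℝ} (hu : ContDiff ℝ 1 u) :
    Continuous (gradient u) := by
  have := hu.continuous_fderiv (by norm_num)
  unfold gradient
  fun_prop

variable {Ω : Set (EuclideanSpace ℝ (Fin n))} {u : EuclideanSpace ℝ (Fin n) → ℝ}

/-- The integrand is the divergence of u² f (x - q). Integrals run over the compact set `tsupport
u`, where continuity on Ω is enough for integrability. -/
theorem setIntegral_tsupport_divergence (hΩ : IsOpen Ω) (hu : ContDiff ℝ 1 u)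
    (hc : HasCompactSupport u) (hs : tsupport u ⊆ Ω) {f : EuclideanSpace ℝ (Fin n) → ℝ}
    (hf : ContDiffOn ℝ 1 f Ω) (q : EuclideanSpace ℝ (Fin n)) :
    ∫ x in tsupport u, (2 * u x * f x * inner ℝ (gradient u x) (x - q)
      + u x ^ 2 * (n * f x + fderiv ℝ f x (x - q))) = 0 := by
  have hG : ContDiff ℝ 1 (fun x => u x * (u x * f x)) :=
    hu.mul (contDiff_mul_of_tsupport_subset hΩ hu hs hf)
  have hGc : HasCompactSupport (fun x => u x * (u x * f x)) := hc.mul_right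
  have h := integral_fderiv_sub_apply hG hGc q
  have hint : Integrable (fun x => u x * (u x * f x)) :=
    hG.continuous.integrable_of_hasCompactSupport hGc
  have hint2 : Integrable (fun x => fderiv ℝ (fun x => u x * (u x * f x)) x (x - q)) := by
    have hd := hG.continuous_fderiv (by norm_num)
    refine Continuous.integrable_of_hasCompactSupport (by fun_prop) ?_
    have hcd : HasCompactSupport (fderiv ℝ (fun x => u x * (u x * f x))) := hGc.fderiv ℝ
    exact hcd.mono fun x hx hx' => hx (by simp [hx'])
  have h0 : ∫ x, (fderiv ℝ (fun x => u x * (u x * f x)) x (x - q)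
      + n * (u x * (u x * f x))) = 0 := by
    rw [integral_add hint2 (hint.const_mul _), h, integral_const_mul]
    ring
  rw [← h0]
  refine Eq.trans ?_ (setIntegral_eq_integral_of_forall_compl_eq_zero (s := tsupport u) ?_)
  · refine setIntegral_congr_fun (isClosed_tsupport u).measurableSet ?_
    intro x hx
    have hux : HasFDerivAt u (fderiv ℝ u x) x := (hu.differentiable (by norm_num) x).hasFDerivAt
    have hfx : HasFDerivAt f (fderiv ℝ f x) x :=
      ((hf.contDiffAt (hΩ.mem_nhds (hs hx))).differentiableAt (by norm_num)).hasFDerivAt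
    have := (hux.mul (hux.mul hfx)).fderiv
    change fderiv ℝ (fun x => u x * (u x * f x)) x = _ at this
    simp only [this, inner_gradient_left]
    simp
    ring
  · intro x hx
    have hx' : x ∉ tsupport (fun x => u x * (u x * f x)) := fun h' =>
      hx (tsupport_mul_subset_left h')
    have h1 : fderiv ℝ (fun x => u x * (u x * f x)) x = 0 := by
      by_contra h2
      exact hx' (support_fderiv_subset ℝ h2)
    simp [h1, image_eq_zero_of_notMem_tsupport hx]

theorem integrableOn_tsupport (hc : HasCompactSupport u) (hs : tsupport u ⊆ Ω)
    {h : EuclideanSpace ℝ (Fin n) → ℝ} (hh : ContinuousOn h Ω) :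
    IntegrableOn h (tsupport u) :=
  (hh.mono hs).integrableOn_compact hc

/-- Completing the square with the vector field `H = f₁ (x - q₁) + f₂ (x - q₂)`. -/
theorem setIntegral_norm_gradient_sub_smul_sq (hΩ : IsOpen Ω) (hu : ContDiff ℝ 1 u)
    (hc : HasCompactSupport u) (hs : tsupport u ⊆ Ω) {f₁ f₂ : EuclideanSpace ℝ (Fin n) → ℝ}
    (hf₁ : ContDiffOn ℝ 1 f₁ Ω) (hf₂ : ContDiffOn ℝ 1 f₂ Ω)
    (q₁ q₂ : EuclideanSpace ℝ (Fin n)) {W : EuclideanSpace ℝ (Fin n) → ℝ}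
    (hW : ∀ x ∈ Ω, n * f₁ x + fderiv ℝ f₁ x (x - q₁) + (n * f₂ x + fderiv ℝ f₂ x (x - q₂))
      + ‖f₁ x • (x - q₁) + f₂ x • (x - q₂)‖ ^ 2 = - W x) :
    ∫ x in tsupport u, ‖gradient u x - u x • (f₁ x • (x - q₁) + f₂ x • (x - q₂))‖ ^ 2
      = (∫ x in tsupport u, ‖gradient u x‖ ^ 2) - ∫ x in tsupport u, u x ^ 2 * W x := by
  have h1 := setIntegral_tsupport_divergence hΩ hu hc hs hf₁ q₁
  have h2 := setIntegral_tsupport_divergence hΩ hu hc hs hf₂ q₂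
  have cu := hu.continuous.continuousOn (s := Ω)
  have cg := (continuous_gradient hu).continuousOn (s := Ω)
  have c1 := hf₁.continuousOn
  have c2 := hf₂.continuousOn
  have d1 : ContinuousOn (fderiv ℝ f₁) Ω := hf₁.continuousOn_fderiv_of_isOpen hΩ (by norm_num)
  have d2 : ContinuousOn (fderiv ℝ f₂) Ω := hf₂.continuousOn_fderiv_of_isOpen hΩ (by norm_num)
  have i1 := integrableOn_tsupport hc hs (h := fun x => 2 * u x * f₁ x *
    inner ℝ (gradient u x) (x - q₁) + u x ^ 2 * (n * f₁ x + fderiv ℝ f₁ x (x - q₁))) (by fun_prop)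
  have i2 := integrableOn_tsupport hc hs (h := fun x => 2 * u x * f₂ x *
    inner ℝ (gradient u x) (x - q₂) + u x ^ 2 * (n * f₂ x + fderiv ℝ f₂ x (x - q₂))) (by fun_prop)
  have i3 := integrableOn_tsupport hc hs (h := fun x => ‖gradient u x‖ ^ 2) (by fun_prop)
  have i5 := integrableOn_tsupport hc hs
    (h := fun x => ‖gradient u x - u x • (f₁ x • (x - q₁) + f₂ x • (x - q₂))‖ ^ 2) (by fun_prop)
  have cW : ContinuousOn W Ω := by
    have : ContinuousOn (fun x => -(n * f₁ x + fderiv ℝ f₁ x (x - q₁) + (n * f₂ x +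
      fderiv ℝ f₂ x (x - q₂)) + ‖f₁ x • (x - q₁) + f₂ x • (x - q₂)‖ ^ 2)) Ω := by fun_prop
    exact this.congr fun x hx => by simp only [hW x hx, neg_neg]
  have i4 := integrableOn_tsupport hc hs (h := fun x => u x ^ 2 * W x) (by fun_prop)
  have h12 := integral_add i1 i2
  rw [h1, h2, add_zero] at h12
  -- Pointwise |∇u - uH|² = |∇u|² - u²W - div(u²H), because div H + |H|² = -W; the divergence
  -- integrates to zero by `h12`.
  rw [← integral_sub i3 i4, ← sub_zero (∫ x in tsupport u, (‖gradient u x‖ ^ 2 - u x ^ 2 * W x)),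
    ← h12]
  refine Eq.trans ?_ (integral_sub (i3.sub i4) (i1.add i2))
  refine setIntegral_congr_fun (isClosed_tsupport u).measurableSet ?_
  intro x hx
  have := hW x (hs hx)
  have e : W x = -(n * f₁ x + fderiv ℝ f₁ x (x - q₁) + (n * f₂ x + fderiv ℝ f₂ x (x - q₂))
      + ‖f₁ x • (x - q₁) + f₂ x • (x - q₂)‖ ^ 2) := by linarith
  simp only [e]
  rw [norm_sub_sq_real, norm_smul, mul_pow, inner_smul_right, inner_add_right, inner_smul_right,
    inner_smul_right, Real.norm_eq_abs, sq_abs]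
  ring

end IntegrationByParts

/-! ### Logarithmic gradients of ground states and their potentials -/

section GroundState

variable {n : ℕ}

/-- The coefficient of `x` in the logarithmic gradient of the ground state, corrected by the
radial field `γ(x) x / |x|²`. -/
noncomputable def fieldCoeffZero (p : EuclideanSpace ℝ (Fin n)) (γ : EuclideanSpace ℝ (Fin n) → ℝ) (x : EuclideanSpace ℝ (Fin n)) : ℝ :=
  (inner ℝ x (x - p))⁻¹ - (n / 2 + γ x) * (‖x‖ ^ 2)⁻¹

/-- The coefficient of `x - p` in the logarithmic gradient of the ground state. -/
noncomputable def fieldCoeffPole (p : EuclideanSpace ℝ (Fin n)) (κ : ℝ) (x : EuclideanSpace ℝ (Fin n)) : ℝ :=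
  (inner ℝ x (x - p))⁻¹ - κ * (‖x - p‖ ^ 2)⁻¹

/-- The potential generated by the field with coefficients `fieldCoeffZero`, `fieldCoeffPole`. -/
noncomputable def fieldPotential (p : EuclideanSpace ℝ (Fin n)) (κ : ℝ) (γ : EuclideanSpace ℝ (Fin n) → ℝ) (x : EuclideanSpace ℝ (Fin n)) : ℝ :=
  ((n : ℝ) ^ 2 * 4⁻¹ + fderiv ℝ γ x x - γ x ^ 2) * (‖x‖ ^ 2)⁻¹ + (n * κ - κ ^ 2) * (‖x - p‖ ^ 2)⁻¹
    + (2 * κ + 2 * γ x - n) * (inner ℝ x (x - p))⁻¹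
    - (n + 2 * γ x) * κ * inner ℝ x (x - p) * (‖x‖ ^ 2)⁻¹ * (‖x - p‖ ^ 2)⁻¹

theorem hasFDerivAt_normSq (p x : EuclideanSpace ℝ (Fin n)) :
    HasFDerivAt (fun y : EuclideanSpace ℝ (Fin n) => ‖y - p‖ ^ 2) (2 • innerSL ℝ (x - p)) x := by
  have h := ((hasFDerivAt_id (𝕜 := ℝ) x).sub_const p).norm_sq
  exact h

theorem hasFDerivAt_inner_sub (p x : EuclideanSpace ℝ (Fin n)) :
    HasFDerivAt (fun y : EuclideanSpace ℝ (Fin n) => inner ℝ y (y - p)) (innerSL ℝ (x + (x - p))) x := by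
  have h := (hasFDerivAt_id (𝕜 := ℝ) x).inner ℝ ((hasFDerivAt_id (𝕜 := ℝ) x).sub_const p)
  refine h.congr_fderiv ?_
  ext v
  simp [real_inner_comm, inner_sub_right]

theorem HasFDerivAt.inv_real {f : EuclideanSpace ℝ (Fin n) → ℝ} {f' : EuclideanSpace ℝ (Fin n) →L[ℝ] ℝ} {x : EuclideanSpace ℝ (Fin n)}
    (hf : HasFDerivAt f f' x) (hx : f x ≠ 0) :
    HasFDerivAt (fun y => (f y)⁻¹) (-((f x) ^ 2)⁻¹ • f') x :=
  (hasDerivAt_inv hx).comp_hasFDerivAt x hf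

theorem fderiv_fieldCoeffZero {p x : EuclideanSpace ℝ (Fin n)} {γ : EuclideanSpace ℝ (Fin n) → ℝ} (hd : inner ℝ x (x - p) ≠ 0)
    (hA : ‖x‖ ^ 2 ≠ 0) (hγ : DifferentiableAt ℝ γ x) :
    fderiv ℝ (fieldCoeffZero p γ) x x = -(inner ℝ x (x - p) + ‖x‖ ^ 2) *
      ((inner ℝ x (x - p)) ^ 2)⁻¹ + (n + 2 * γ x - fderiv ℝ γ x x) * (‖x‖ ^ 2)⁻¹ := by
  have h1 := (hasFDerivAt_inner_sub p x).inv_real hd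
  have h2 := (hasFDerivAt_normSq 0 x).inv_real (by simpa using hA)
  have h3 := h1.sub ((hγ.hasFDerivAt.const_add ((n : ℝ) / 2)).mul h2)
  have h4 : HasFDerivAt (fieldCoeffZero p γ) _ x := h3.congr_of_eventuallyEq
    (Filter.Eventually.of_forall fun y => by simp [fieldCoeffZero])
  rw [h4.fderiv]
  have e1 : inner ℝ (x + (x - p)) x = inner ℝ x (x - p) + ‖x‖ ^ 2 := by
    rw [inner_add_left, real_inner_self_eq_norm_sq, real_inner_comm]; ring
  have e2 : inner ℝ x x = ‖x‖ ^ 2 := real_inner_self_eq_norm_sq x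
  simp only [sub_apply, add_apply,
    smul_apply, innerSL_apply_apply, sub_zero, e1, e2, smul_eq_mul, nsmul_eq_mul]
  field_simp
  push_cast
  ring

theorem fderiv_fieldCoeffPole {p x : EuclideanSpace ℝ (Fin n)} {κ : ℝ} (hd : inner ℝ x (x - p) ≠ 0)
    (hB : ‖x - p‖ ^ 2 ≠ 0) :
    fderiv ℝ (fieldCoeffPole p κ) x (x - p) = -(inner ℝ x (x - p) + ‖x - p‖ ^ 2) *
      ((inner ℝ x (x - p)) ^ 2)⁻¹ + 2 * κ * (‖x - p‖ ^ 2)⁻¹ := by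
  have h1 := (hasFDerivAt_inner_sub p x).inv_real hd
  have h2 := (hasFDerivAt_normSq p x).inv_real (by simpa using hB)
  have h4 : HasFDerivAt (fieldCoeffPole p κ) _ x := h1.sub (h2.const_mul κ)
  rw [h4.fderiv]
  have e1 : inner ℝ (x + (x - p)) (x - p) = inner ℝ x (x - p) + ‖x - p‖ ^ 2 := by
    rw [inner_add_left, real_inner_self_eq_norm_sq]
  have e2 : inner ℝ (x - p) (x - p) = ‖x - p‖ ^ 2 := real_inner_self_eq_norm_sq _
  simp only [sub_apply, smul_apply, innerSL_apply_apply,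
    e1, e2, smul_eq_mul, nsmul_eq_mul]
  field_simp
  push_cast
  ring

/-- The field is ∇φ/φ - γ x/|x|² for φ = d |x|^(-n/2) |x - p|^(-κ), d = ⟨x, x - p⟩. The d⁻² terms
cancel: the divergence of (2x - p)/d contributes -|2x - p|²/d² and the square of the field +|2x -
p|²/d². -/
theorem divergence_add_normSq_field {p x : EuclideanSpace ℝ (Fin n)} {κ : ℝ} {γ : EuclideanSpace ℝ (Fin n) → ℝ} (hd : inner ℝ x (x - p) ≠ 0)
    (hγ : DifferentiableAt ℝ γ x) :
    n * fieldCoeffZero p γ x + fderiv ℝ (fieldCoeffZero p γ) x (x - 0)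
      + (n * fieldCoeffPole p κ x + fderiv ℝ (fieldCoeffPole p κ) x (x - p))
      + ‖fieldCoeffZero p γ x • (x - 0) + fieldCoeffPole p κ x • (x - p)‖ ^ 2
      = - fieldPotential p κ γ x := by
  have hx : x ≠ 0 := by rintro rfl; simp at hd
  have hxp : x - p ≠ 0 := by intro h; simp [h] at hd
  have hA : ‖x‖ ^ 2 ≠ 0 := by positivity
  have hB : ‖x - p‖ ^ 2 ≠ 0 := by positivity
  rw [sub_zero, fderiv_fieldCoeffZero hd hA hγ, fderiv_fieldCoeffPole hd hB, norm_add_sq_real,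
    norm_smul, norm_smul, inner_smul_left, inner_smul_right, mul_pow, mul_pow,
    Real.norm_eq_abs, Real.norm_eq_abs, sq_abs, sq_abs]
  simp only [fieldCoeffZero, fieldCoeffPole, fieldPotential, conj_trivial]
  generalize inner ℝ x (x - p) = d at *
  generalize ‖x‖ ^ 2 = A at *
  generalize ‖x - p‖ ^ 2 = B at *
  generalize fderiv ℝ γ x x = γ'
  field_simp
  ring

variable {Ω : Set (EuclideanSpace ℝ (Fin n))} {p : EuclideanSpace ℝ (Fin n)} {u : EuclideanSpace ℝ (Fin n) → ℝ}

theorem contDiffOn_fieldCoeffZero {γ : EuclideanSpace ℝ (Fin n) → ℝ} (hd : ∀ x ∈ Ω, inner ℝ x (x - p) ≠ 0)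
    (hγ : ContDiffOn ℝ 1 γ Ω) : ContDiffOn ℝ 1 (fieldCoeffZero p γ) Ω := by
  refine ContDiffOn.sub (ContDiffOn.inv ?_ hd)
    ((contDiffOn_const.add hγ).mul (ContDiffOn.inv ?_ ?_))
  · exact (contDiff_id.inner ℝ (contDiff_id.sub contDiff_const)).contDiffOn
  · exact (contDiff_id.norm_sq ℝ).contDiffOn
  · intro x hx
    have : x ≠ 0 := by rintro rfl; simpa using hd _ hx
    positivity

theorem contDiffOn_fieldCoeffPole {κ : ℝ} (hd : ∀ x ∈ Ω, inner ℝ x (x - p) ≠ 0) :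
    ContDiffOn ℝ 1 (fieldCoeffPole p κ) Ω := by
  refine ContDiffOn.sub (ContDiffOn.inv ?_ hd) (contDiffOn_const.mul (ContDiffOn.inv ?_ ?_))
  · exact (contDiff_id.inner ℝ (contDiff_id.sub contDiff_const)).contDiffOn
  · exact ((contDiff_id.sub contDiff_const).norm_sq ℝ).contDiffOn
  · intro x hx
    have : x - p ≠ 0 := by intro h; simpa [h] using hd _ hx
    positivity

/-- Only d ≠ 0 is required, so that the identity serves both outside a ball (κ = n/2, d > 0) and
inside one (κ = 0, d < 0). -/
theorem setIntegral_norm_gradient_sub_field_sq (hΩ : IsOpen Ω)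
    (hd : ∀ x ∈ Ω, inner ℝ x (x - p) ≠ 0) (hu : ContDiff ℝ 1 u)
    (hc : HasCompactSupport u) (hs : tsupport u ⊆ Ω) (κ : ℝ) {γ : EuclideanSpace ℝ (Fin n) → ℝ}
    (hγ : ContDiffOn ℝ 1 γ Ω) :
    ∫ x in tsupport u, ‖gradient u x
        - u x • (fieldCoeffZero p γ x • x + fieldCoeffPole p κ x • (x - p))‖ ^ 2
      = (∫ x in tsupport u, ‖gradient u x‖ ^ 2)
        - ∫ x in tsupport u, u x ^ 2 * fieldPotential p κ γ x := by
  have h := setIntegral_norm_gradient_sub_smul_sq hΩ hu hc hs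
    (contDiffOn_fieldCoeffZero hd hγ) (contDiffOn_fieldCoeffPole (κ := κ) hd) 0 p
    (W := fieldPotential p κ γ) (fun x hx => divergence_add_normSq_field (hd x hx)
      ((hγ.contDiffAt (hΩ.mem_nhds hx)).differentiableAt (by norm_num)))
  simpa using h

theorem continuousOn_fieldPotential (hΩ : IsOpen Ω) (hd : ∀ x ∈ Ω, inner ℝ x (x - p) ≠ 0)
    (κ : ℝ) {γ : EuclideanSpace ℝ (Fin n) → ℝ} (hγ : ContDiffOn ℝ 1 γ Ω) :
    ContinuousOn (fieldPotential p κ γ) Ω := by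
  have c1 := hγ.continuousOn
  have d1 : ContinuousOn (fderiv ℝ γ) Ω := hγ.continuousOn_fderiv_of_isOpen hΩ (by norm_num)
  have d2 : ContinuousOn (fun x => fderiv ℝ γ x x) Ω := d1.clm_apply continuousOn_id
  have hA : ∀ x ∈ Ω, ‖x‖ ^ 2 ≠ 0 := fun x hx => by
    have : x ≠ 0 := by rintro rfl; simpa using hd _ hx
    positivity
  have hB : ∀ x ∈ Ω, ‖x - p‖ ^ 2 ≠ 0 := fun x hx => by
    have : x - p ≠ 0 := by intro h; simpa [h] using hd _ hx
    positivity
  unfold fieldPotential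
  fun_prop (disch := assumption)

end GroundState

/-! ### Elementary estimates for the logarithmic weight -/

section LogWeight

theorem logWeight_pos {s : ℝ} (h0 : 0 < s) (h1 : s ≤ 1) : 0 < logWeight s := by
  have := Real.log_nonpos h0.le h1
  exact one_div_pos.2 (by linarith)

theorem logWeight_le_one {s : ℝ} (h0 : 0 < s) (h1 : s ≤ 1) : logWeight s ≤ 1 := by
  have := Real.log_nonpos h0.le h1
  rw [logWeight, div_le_one (by linarith)]
  linarith

theorem logWeight_mono {s t : ℝ} (h0 : 0 < s) (hst : s ≤ t) (h1 : t ≤ 1) :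
    logWeight s ≤ logWeight t := by
  have h := Real.log_le_log h0 hst
  have := Real.log_nonpos (h0.trans_le hst).le h1
  exact one_div_le_one_div_of_le (by linarith) (by linarith)

/-- Turns errors of relative size |x|/|p| into X₁² terms. With y = -log s ≥ 0 it comes from 1 + y ≤
2(1 + y/2) ≤ 2 exp(y/2). -/
theorem le_four_mul_logWeight_sq {s : ℝ} (h0 : 0 < s) (h1 : s ≤ 1) : s ≤ 4 * logWeight s ^ 2 := by
  have hl := Real.log_nonpos h0.le h1
  have hx : 0 < 1 - Real.log s := by linarith
  have h := Real.add_one_le_exp (-(Real.log s) / 2)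
  have h2 : (-(Real.log s) / 2 + 1) ^ 2 ≤ Real.exp (-(Real.log s) / 2) ^ 2 :=
    pow_le_pow_left₀ (by linarith) h 2
  rw [← Real.exp_nat_mul] at h2
  have e : ((2 : ℕ) : ℝ) * (-(Real.log s) / 2) = -Real.log s := by push_cast; ring
  rw [e, Real.exp_neg, Real.exp_log h0] at h2
  have h3 : s * (1 - Real.log s) ^ 2 ≤ 4 := by
    have : (1 - Real.log s) ^ 2 ≤ 4 * s⁻¹ := by nlinarith
    calc s * (1 - Real.log s) ^ 2 ≤ s * (4 * s⁻¹) := by gcongr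
      _ = 4 := by field_simp
  rw [logWeight, div_pow, one_pow, mul_one_div, le_div_iff₀ (by positivity)]
  exact h3

/-- X₁(s)/s is decreasing: log(t/s) ≤ t/s - 1 and 1 - log t ≥ 1 give 1 - log s ≤ (1 - log t) t/s. -/
theorem logWeight_mul_div_le {s t : ℝ} (h0 : 0 < s) (hst : s ≤ t) (h1 : t ≤ 1) :
    logWeight t * (s / t) ≤ logWeight s := by
  have ht : 0 < t := h0.trans_le hst
  have hl := Real.log_nonpos ht.le h1
  have hl2 := Real.log_le_log h0 hst
  have h := Real.log_le_sub_one_of_pos (div_pos ht h0)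
  rw [Real.log_div ht.ne' h0.ne'] at h
  rw [logWeight, logWeight, div_mul_div_comm, div_le_div_iff₀ (by nlinarith) (by linarith), one_mul,
    one_mul]
  have e : t = s * (t / s) := by field_simp
  have h4 : 1 - Real.log s ≤ (1 - Real.log t) * (t / s) := by
    have : (1 : ℝ) ≤ t / s := by rwa [one_le_div h0]
    nlinarith
  calc s * (1 - Real.log s) ≤ s * ((1 - Real.log t) * (t / s)) := by gcongr
    _ = (1 - Real.log t) * t := by field_simp

end LogWeight

/-! ### Dyadic radial bumps -/

section RadialCutoff

/-- A dilation-invariant bump at scale `R` in the radial variable `r`. -/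
noncomputable def radialBump (R r : ℝ) : ℝ := r * R / (r ^ 2 + R ^ 2)

theorem radialBump_nonneg {R r : ℝ} (hR : 0 ≤ R) (hr : 0 ≤ r) : 0 ≤ radialBump R r := by
  unfold radialBump; positivity

theorem radialBump_le_one {R r : ℝ} (hR : 0 < R) : radialBump R r ≤ 1 := by
  rw [radialBump, div_le_one (by positivity)]
  nlinarith [sq_nonneg (r - R), sq_nonneg r, sq_nonneg R]

theorem radialBump_le_div {R r : ℝ} (hR : 0 < R) (hr : 0 ≤ r) : radialBump R r ≤ r / R := by
  rw [radialBump, div_le_div_iff₀ (by positivity) hR]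
  nlinarith [pow_nonneg hr 3]

/-- The squared bump is at most 4/3 times the increment of R ↦ R²/(r² + R²) from R/2 to R, so the
sum telescopes. -/
theorem sum_radialBump_sq_le {D r : ℝ} (hD : 0 < D) (hr : 0 < r) (N : ℕ) :
    ∑ k ∈ Finset.range N, radialBump (D * (1 / 2) ^ k) r ^ 2 ≤ 4 / 3 := by
  have key : ∀ R : ℝ, 0 < R → radialBump R r ^ 2 ≤
      4 / 3 * (R ^ 2 / (r ^ 2 + R ^ 2) - (R * (1 / 2)) ^ 2 / (r ^ 2 + (R * (1 / 2)) ^ 2)) := by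
    intro R hR
    have e : 4 / 3 * (R ^ 2 / (r ^ 2 + R ^ 2) - (R * (1 / 2)) ^ 2 / (r ^ 2 + (R * (1 / 2)) ^ 2))
        = (r * R) ^ 2 / ((r ^ 2 + R ^ 2) * (r ^ 2 + (R * (1 / 2)) ^ 2)) := by
      field_simp; ring
    rw [e, radialBump, div_pow]
    refine div_le_div_of_nonneg_left (by positivity) (by positivity) ?_
    rw [sq (r ^ 2 + R ^ 2)]
    gcongr
    linarith
  have tel : ∀ N : ℕ, ∑ k ∈ Finset.range N, radialBump (D * (1 / 2) ^ k) r ^ 2 ≤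
      4 / 3 * (D ^ 2 / (r ^ 2 + D ^ 2)
        - (D * (1 / 2) ^ N) ^ 2 / (r ^ 2 + (D * (1 / 2) ^ N) ^ 2)) := by
    intro N
    induction N with
    | zero => simp
    | succ N ih =>
      rw [Finset.sum_range_succ]
      have := key (D * (1 / 2) ^ N) (by positivity)
      rw [mul_assoc D, ← pow_succ] at this
      linarith
  refine (tel N).trans ?_
  have h1 : D ^ 2 / (r ^ 2 + D ^ 2) ≤ 1 := by
    rw [div_le_one (by positivity)]; nlinarith
  have h2 : 0 ≤ (D * (1 / 2) ^ N) ^ 2 / (r ^ 2 + (D * (1 / 2) ^ N) ^ 2) := by positivity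
  linarith

/-- For R ≤ r the weight is monotone; for R ≥ r the decay r/R of the bump makes up for the larger
weight. -/
theorem logWeight_mul_radialBump_le {D R r : ℝ} (hR : 0 < R) (hRD : R ≤ 3 * D)
    (hr : 0 < r) (hrD : r ≤ 3 * D) :
    logWeight (R / (3 * D)) * radialBump R r ≤ logWeight (r / (3 * D)) := by
  have hD : 0 < 3 * D := hR.trans_le hRD
  have hX := logWeight_pos (div_pos hR hD) ((div_le_one hD).2 hRD)
  rcases le_total R r with h | h
  · calc logWeight (R / (3 * D)) * radialBump R r ≤ logWeight (R / (3 * D)) * 1 := by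
          gcongr; exact radialBump_le_one hR
      _ ≤ _ := by
          rw [mul_one]
          exact logWeight_mono (div_pos hR hD) (by gcongr) ((div_le_one hD).2 hrD)
  · calc logWeight (R / (3 * D)) * radialBump R r
        ≤ logWeight (R / (3 * D)) * ((r / (3 * D)) / (R / (3 * D))) := by
          gcongr
          rw [div_div_div_cancel_right₀ hD.ne']
          exact radialBump_le_div hR hr.le
      _ ≤ _ := logWeight_mul_div_le (div_pos hr hD) (by gcongr) ((div_le_one hD).2 hRD)

theorem logWeight_mul_sq_div_le {D R r : ℝ} (hR : 0 < R) (hRD : R ≤ 3 * D)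
    (hr : 0 < r) (hrD : r ≤ 3 * D) :
    logWeight (R / (3 * D)) * (r ^ 2 * (r ^ 2 + R ^ 2)⁻¹) ≤ logWeight (r / (3 * D)) := by
  have hD : 0 < 3 * D := hR.trans_le hRD
  have hX := logWeight_pos (div_pos hR hD) ((div_le_one hD).2 hRD)
  rcases le_total R r with h | h
  · calc logWeight (R / (3 * D)) * (r ^ 2 * (r ^ 2 + R ^ 2)⁻¹) ≤ logWeight (R / (3 * D)) * 1 := by
          gcongr
          rw [mul_inv_le_iff₀ (by positivity)]
          nlinarith
      _ ≤ _ := by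
          rw [mul_one]
          exact logWeight_mono (div_pos hR hD) (by gcongr) ((div_le_one hD).2 hrD)
  · refine le_trans ?_ (logWeight_mul_radialBump_le hR hRD hr hrD)
    gcongr
    rw [radialBump, div_eq_mul_inv]
    gcongr
    nlinarith

theorem exists_radialBump_ge {D r : ℝ} {N : ℕ} (hrD : r ≤ D) (hN : D * (1 / 2) ^ N < r)
    (hD : 0 < D) :
    ∃ k < N, r ≤ D * (1 / 2) ^ k ∧ 4 / 25 ≤ radialBump (D * (1 / 2) ^ k) r ^ 2 := by
  have hex : ∃ k, D * (1 / 2) ^ k < r := ⟨N, hN⟩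
  classical
  set m := Nat.find hex with hm
  have hm1 : D * (1 / 2) ^ m < r := Nat.find_spec hex
  have hm0 : m ≠ 0 := by
    intro h0
    rw [h0] at hm1
    simp at hm1
    linarith
  obtain ⟨k, hk⟩ := Nat.exists_eq_succ_of_ne_zero hm0
  have hk1 : r ≤ D * (1 / 2) ^ k := not_lt.1 (Nat.find_min hex (by omega : k < m))
  have hk2 : D * (1 / 2) ^ k < 2 * r := by
    rw [hk, Nat.succ_eq_add_one, pow_succ] at hm1
    linarith
  have hmN : m ≤ N := Nat.find_min' hex hN
  refine ⟨k, by omega, hk1, ?_⟩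
  set R := D * (1 / 2) ^ k
  have hR : 0 < R := by positivity
  have hr : 0 < r := by linarith
  -- On r ≤ R ≤ 2r the quotient rR/(r² + R²) is smallest at R = 2r, where it equals 2/5.
  have : 2 / 5 ≤ radialBump R r := by
    rw [radialBump, div_le_div_iff₀ (by norm_num) (by positivity)]
    nlinarith [mul_nonneg (sub_nonneg.2 hk1) (sub_nonneg.2 hk2.le)]
  nlinarith

end RadialCutoff

/-! ### Hardy inequalities outside a large ball -/

section Hardy

variable {n : ℕ}

/-- κ = n/2 is the value that removes the 1/d term when γ = 0; the other terms combine through |p|²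
= |x|² + |x - p|² - 2d. -/
theorem fieldPotential_half (γ : EuclideanSpace ℝ (Fin n) → ℝ) {p x : EuclideanSpace ℝ (Fin n)}
    (hd : inner ℝ x (x - p) ≠ 0) :
    fieldPotential p (n / 2) γ x = (n : ℝ) ^ 2 / 4 * ‖p‖ ^ 2 * (‖x‖ ^ 2)⁻¹ * (‖x - p‖ ^ 2)⁻¹
      + (fderiv ℝ γ x x - γ x ^ 2) * (‖x‖ ^ 2)⁻¹ + 2 * γ x * (inner ℝ x (x - p))⁻¹
      - n * γ x * (inner ℝ x (x - p)) * (‖x‖ ^ 2)⁻¹ * (‖x - p‖ ^ 2)⁻¹ := by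
  have hx : x ≠ 0 := by rintro rfl; simp at hd
  have hxp : x - p ≠ 0 := by intro h; simp [h] at hd
  have hA : ‖x‖ ^ 2 ≠ 0 := by positivity
  have hB : ‖x - p‖ ^ 2 ≠ 0 := by positivity
  have e : ‖p‖ ^ 2 = ‖x‖ ^ 2 + ‖x - p‖ ^ 2 - 2 * inner ℝ x (x - p) := by
    have h := norm_sub_sq_real x (x - p)
    rw [sub_sub_cancel] at h
    linarith
  rw [fieldPotential, e]
  generalize inner ℝ x (x - p) = d at *
  generalize ‖x‖ ^ 2 = A at *
  generalize ‖x - p‖ ^ 2 = B at *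
  field_simp
  ring

/-- The function is a smoothed step in log |x| at |x| = R, so its derivative x·∇ concentrates on the
shell |x| ~ R. -/
theorem fderiv_const_mul_sq_div (c : ℝ) {R : ℝ} (hR : 0 < R) (x : EuclideanSpace ℝ (Fin n)) :
    fderiv ℝ (fun x : EuclideanSpace ℝ (Fin n) => c * (‖x‖ ^ 2 * (‖x‖ ^ 2 + R ^ 2)⁻¹)) x x
      = 2 * c * radialBump R ‖x‖ ^ 2 := by
  have h1 := hasFDerivAt_normSq 0 x
  have h2 : HasFDerivAt (fun y : EuclideanSpace ℝ (Fin n) =>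
      c * (‖y - 0‖ ^ 2 * (‖y - 0‖ ^ 2 + R ^ 2)⁻¹)) _ x :=
    (h1.mul ((h1.add_const (R ^ 2)).inv_real (by positivity))).const_mul c
  simp only [sub_zero] at h2
  rw [h2.fderiv]
  have e2 : inner ℝ x x = ‖x‖ ^ 2 := real_inner_self_eq_norm_sq x
  simp only [smul_apply, add_apply, innerSL_apply_apply, e2, smul_eq_mul, nsmul_eq_mul, radialBump]
  have : ‖x‖ ^ 2 + R ^ 2 ≠ 0 := by positivity
  field_simp
  push_cast
  ring

/-- A domain of size `D` near the origin which lies outside the ball with diameter `[0, p]`, whose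
diameter is much larger than `D`. -/
structure OutsideLargeBall (Ω : Set (EuclideanSpace ℝ (Fin n))) (p : EuclideanSpace ℝ (Fin n))
    (D : ℝ) : Prop where
  isOpen : IsOpen Ω
  inner_pos : ∀ x ∈ Ω, 0 < inner ℝ x (x - p)
  norm_le : ∀ x ∈ Ω, ‖x‖ ≤ D
  pos : 0 < D
  large : 1000 * (n : ℝ) ^ 2 * D ≤ ‖p‖
  one_le : 1 ≤ n

namespace OutsideLargeBall

variable {Ω : Set (EuclideanSpace ℝ (Fin n))} {p : EuclideanSpace ℝ (Fin n)} {D : ℝ}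
  (h : OutsideLargeBall Ω p D) {x : EuclideanSpace ℝ (Fin n)}

include h

theorem inner_ne_zero (x) (hx : x ∈ Ω) : inner ℝ x (x - p) ≠ 0 := (h.inner_pos x hx).ne'

theorem norm_pos (hx : x ∈ Ω) : 0 < ‖x‖ := by
  refine norm_pos_iff.2 ?_
  rintro rfl
  simpa using h.inner_pos 0 hx

theorem norm_sub_ge (hx : x ∈ Ω) : ‖p‖ / 2 ≤ ‖x - p‖ := by
  have h1 := h.norm_le x hx
  have h2 := h.large
  have h3 : (1 : ℝ) ≤ n := by exact_mod_cast h.one_le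
  have h4 := norm_sub_norm_le p x
  rw [norm_sub_rev] at h4
  have : D ≤ (n : ℝ) ^ 2 * D := le_mul_of_one_le_left h.pos.le (by nlinarith)
  have := h.pos
  linarith

theorem norm_center_pos : 0 < ‖p‖ := by
  have h2 := h.large
  have h3 : (1 : ℝ) ≤ n := by exact_mod_cast h.one_le
  have := h.pos
  have : 0 < 1000 * (n : ℝ) ^ 2 * D := by positivity
  linarith

theorem ratio_pos (hx : x ∈ Ω) : 0 < ‖x‖ / (3 * D) :=
  div_pos (h.norm_pos hx) (by linarith [h.pos])

theorem ratio_le_one (hx : x ∈ Ω) : ‖x‖ / (3 * D) ≤ 1 := by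
  rw [div_le_one (by linarith [h.pos])]
  linarith [h.pos, h.norm_le x hx]

theorem norm_le_logWeight_sq (hx : x ∈ Ω) : ‖x‖ ≤ 12 * D * logWeight (‖x‖ / (3 * D)) ^ 2 := by
  have h1 := le_four_mul_logWeight_sq (h.ratio_pos hx) (h.ratio_le_one hx)
  rw [div_le_iff₀ (by linarith [h.pos])] at h1
  linarith

theorem norm_div_norm_center_le (hx : x ∈ Ω) :
    (n : ℝ) ^ 2 * ‖x‖ / ‖p‖ ≤ 12 / 1000 * logWeight (‖x‖ / (3 * D)) ^ 2 := by
  rw [div_le_iff₀ h.norm_center_pos]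
  have h1 := h.norm_le_logWeight_sq hx
  have h2 := h.large
  have h3 : (1 : ℝ) ≤ n := by exact_mod_cast h.one_le
  set X := logWeight (‖x‖ / (3 * D))
  calc (n : ℝ) ^ 2 * ‖x‖ ≤ (n : ℝ) ^ 2 * (12 * D * X ^ 2) := by gcongr
    _ = 12 / 1000 * X ^ 2 * (1000 * (n : ℝ) ^ 2 * D) := by ring
    _ ≤ _ := by gcongr

/-- Bounds the coefficient of the only harmful cross term in `fieldPotential_half`, namely
-nγd/(|x|²|x - p|²). -/
theorem inner_mul_le (hx : x ∈ Ω) :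
    n * (inner ℝ x (x - p) * (‖x - p‖ ^ 2)⁻¹) ≤ logWeight (‖x‖ / (3 * D)) ^ 2 / 40 := by
  have hp := h.norm_center_pos
  have hB := h.norm_sub_ge hx
  have hB0 : 0 < ‖x - p‖ := by linarith
  have h3 : (1 : ℝ) ≤ n := by exact_mod_cast h.one_le
  have h1 := h.norm_div_norm_center_le hx
  calc n * (inner ℝ x (x - p) * (‖x - p‖ ^ 2)⁻¹)
      ≤ n * ((‖x‖ * ‖x - p‖) * (‖x - p‖ ^ 2)⁻¹) := by
        gcongr; exact real_inner_le_norm x (x - p)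
    _ = n * (‖x‖ / ‖x - p‖) := by field_simp
    _ ≤ n * (‖x‖ / (‖p‖ / 2)) := by gcongr
    _ = 2 * (n * ‖x‖ / ‖p‖) := by field_simp
    _ ≤ 2 * ((n : ℝ) ^ 2 * ‖x‖ / ‖p‖) := by gcongr; nlinarith
    _ ≤ _ := by nlinarith [sq_nonneg (logWeight (‖x‖ / (3 * D)))]

/-- Since |x - p| ≥ |p|/2, one has 1 - |p|²/|x - p|² ≤ 12|x|/|p|. The deficit is thus at most
3n²|x|/|p| ≤ (36/1000) X₁² times |x|⁻². -/
theorem hardy_sub_potential_le (hx : x ∈ Ω) :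
    (n : ℝ) ^ 2 / 4 * (‖x‖ ^ 2)⁻¹ - logWeight (‖x‖ / (3 * D)) ^ 2 / 20 * (‖x‖ ^ 2)⁻¹
      ≤ fieldPotential p (n / 2) (fun _ => 0) x := by
  rw [fieldPotential_half _ (h.inner_ne_zero x hx)]
  have hp := h.norm_center_pos
  have hB := h.norm_sub_ge hx
  have hB0 : 0 < ‖x - p‖ := by linarith
  have hx0 := h.norm_pos hx
  have h1 := h.norm_div_norm_center_le hx
  have hxp : ‖x‖ ≤ ‖p‖ := by
    have h2 := h.large
    have h3 : (1 : ℝ) ≤ n := by exact_mod_cast h.one_le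
    have : D ≤ (n : ℝ) ^ 2 * D := le_mul_of_one_le_left h.pos.le (by nlinarith)
    linarith [h.norm_le x hx, h.pos]
  have hB2 : ‖x - p‖ ^ 2 ≤ ‖p‖ ^ 2 + 3 * ‖p‖ * ‖x‖ := by
    have := norm_sub_le x p
    nlinarith
  have key : (n : ℝ) ^ 2 / 4 * (1 - ‖p‖ ^ 2 * (‖x - p‖ ^ 2)⁻¹)
      ≤ logWeight (‖x‖ / (3 * D)) ^ 2 / 20 := by
    have e1 : 1 - ‖p‖ ^ 2 * (‖x - p‖ ^ 2)⁻¹ = (‖x - p‖ ^ 2 - ‖p‖ ^ 2) / ‖x - p‖ ^ 2 := by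
      field_simp
    have e2 : (‖x - p‖ ^ 2 - ‖p‖ ^ 2) / ‖x - p‖ ^ 2 ≤ 3 * ‖p‖ * ‖x‖ / (‖p‖ / 2) ^ 2 := by
      gcongr
      linarith
    calc (n : ℝ) ^ 2 / 4 * (1 - ‖p‖ ^ 2 * (‖x - p‖ ^ 2)⁻¹)
        ≤ (n : ℝ) ^ 2 / 4 * (3 * ‖p‖ * ‖x‖ / (‖p‖ / 2) ^ 2) := by rw [e1]; gcongr
      _ = 3 * ((n : ℝ) ^ 2 * ‖x‖ / ‖p‖) := by field_simp; norm_num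
      _ ≤ _ := by nlinarith [sq_nonneg (logWeight (‖x‖ / (3 * D)))]
  have := mul_le_mul_of_nonneg_right key (by positivity : 0 ≤ (‖x‖ ^ 2)⁻¹)
  simp
  linarith

theorem potential_le (hx : x ∈ Ω) :
    fieldPotential p (n / 2) (fun _ => 0) x ≤ (n : ℝ) ^ 2 * (‖x‖ ^ 2)⁻¹ := by
  rw [fieldPotential_half _ (h.inner_ne_zero x hx)]
  have hp := h.norm_center_pos
  have hB := h.norm_sub_ge hx
  have hB0 : 0 < ‖x - p‖ := by linarith
  have hx0 := h.norm_pos hx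
  have : ‖p‖ ^ 2 * (‖x - p‖ ^ 2)⁻¹ ≤ 4 := by
    rw [mul_inv_le_iff₀ (by positivity)]
    nlinarith
  have := mul_le_mul_of_nonneg_right this (by positivity : 0 ≤ (n : ℝ) ^ 2 / 4 * (‖x‖ ^ 2)⁻¹)
  simp
  linarith

variable {u : EuclideanSpace ℝ (Fin n) → ℝ}

theorem norm_sq_ne_zero (x) (hx : x ∈ Ω) : ‖x‖ ^ 2 ≠ 0 := by
  have := h.norm_pos hx
  positivity

/-- The completed square for γ is nonnegative, so the energy dominates ∫u²(V_γ - V_0). In V_γ - V_0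
the term 2γ/d is nonnegative and is dropped, and the cross term is bounded by `inner_mul_le`. -/
theorem setIntegral_mul_le_energy (hu : ContDiff ℝ 1 u)
    (hc : HasCompactSupport u) (hs : tsupport u ⊆ Ω) {γ g : EuclideanSpace ℝ (Fin n) → ℝ}
    (hγ : ContDiffOn ℝ 1 γ Ω) (hγ0 : ∀ x ∈ Ω, 0 ≤ γ x) (hg : ContinuousOn g Ω)
    (hgγ : ∀ x ∈ Ω, g x ≤ fderiv ℝ γ x x - γ x ^ 2
      - γ x * (logWeight (‖x‖ / (3 * D)) ^ 2 / 40)) :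
    ∫ x in tsupport u, u x ^ 2 * (g x * (‖x‖ ^ 2)⁻¹)
      ≤ (∫ x in tsupport u, ‖gradient u x‖ ^ 2)
        - ∫ x in tsupport u, u x ^ 2 * fieldPotential p (n / 2) (fun _ => 0) x := by
  have e := setIntegral_norm_gradient_sub_field_sq h.isOpen h.inner_ne_zero hu hc hs (n / 2) hγ
  have e0 : 0 ≤ ∫ x in tsupport u, ‖gradient u x
        - u x • (fieldCoeffZero p γ x • x + fieldCoeffPole p (n / 2) x • (x - p))‖ ^ 2 :=
    integral_nonneg fun x => by positivity
  have cu := hu.continuous.continuousOn (s := Ω)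
  have hA := h.norm_sq_ne_zero
  have c0 := continuousOn_fieldPotential h.isOpen h.inner_ne_zero (n / 2)
    (contDiffOn_const (c := (0 : ℝ)))
  have cγ := continuousOn_fieldPotential h.isOpen h.inner_ne_zero (n / 2) hγ
  have i1 := integrableOn_tsupport hc hs (h := fun x => u x ^ 2 * (g x * (‖x‖ ^ 2)⁻¹))
    (by fun_prop (disch := assumption))
  have i2 := integrableOn_tsupport hc hs
    (h := fun x => u x ^ 2 * fieldPotential p (n / 2) (fun _ => 0) x) (by fun_prop)
  have i3 := integrableOn_tsupport hc hs
    (h := fun x => u x ^ 2 * fieldPotential p (n / 2) γ x) (by fun_prop)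
  have hle : (∫ x in tsupport u, u x ^ 2 * (g x * (‖x‖ ^ 2)⁻¹))
      + (∫ x in tsupport u, u x ^ 2 * fieldPotential p (n / 2) (fun _ => 0) x)
      ≤ ∫ x in tsupport u, u x ^ 2 * fieldPotential p (n / 2) γ x := by
    rw [← integral_add i1 i2]
    refine setIntegral_mono_on (i1.add i2) i3 (isClosed_tsupport u).measurableSet ?_
    intro x hx
    have hxΩ := hs hx
    rw [← mul_add]
    refine mul_le_mul_of_nonneg_left ?_ (sq_nonneg _)
    rw [fieldPotential_half _ (h.inner_ne_zero x hxΩ), fieldPotential_half _ (h.inner_ne_zero x hxΩ)]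
    have hA0 : 0 < (‖x‖ ^ 2)⁻¹ := by have := h.norm_pos hxΩ; positivity
    have t1 : 0 ≤ 2 * γ x * (inner ℝ x (x - p))⁻¹ :=
      mul_nonneg (by linarith [hγ0 x hxΩ]) (inv_nonneg.2 (h.inner_pos x hxΩ).le)
    have t2 := mul_le_mul_of_nonneg_left (h.inner_mul_le hxΩ) (hγ0 x hxΩ)
    have t3 : g x ≤ fderiv ℝ γ x x - γ x ^ 2
        - γ x * (n * (inner ℝ x (x - p) * (‖x - p‖ ^ 2)⁻¹)) := by linarith [hgγ x hxΩ]
    have t4 := mul_le_mul_of_nonneg_right t3 hA0.le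
    simp
    linarith
  linarith

theorem contDiffOn_logWeight : ContDiffOn ℝ 1
    (fun x : EuclideanSpace ℝ (Fin n) => logWeight (‖x‖ / (3 * D)) / 2) Ω := by
  intro x hx
  have hx0 := h.norm_pos hx
  have := h.ratio_pos hx
  have hl := Real.log_nonpos this.le (h.ratio_le_one hx)
  refine ContDiffAt.contDiffWithinAt ?_
  unfold logWeight
  refine ContDiffAt.div_const (ContDiffAt.div contDiffAt_const (contDiffAt_const.sub
    (ContDiffAt.log ((contDiffAt_norm ℝ (norm_pos_iff.1 hx0)).div_const _) this.ne')) ?_) 2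
  linarith

theorem fderiv_logWeight (hx : x ∈ Ω) :
    fderiv ℝ (fun x : EuclideanSpace ℝ (Fin n) => logWeight (‖x‖ / (3 * D)) / 2) x x
      = logWeight (‖x‖ / (3 * D)) ^ 2 / 2 := by
  have hx0 := h.norm_pos hx
  have h3D : 0 < 3 * D := by linarith [h.pos]
  have hl := Real.log_nonpos (h.ratio_pos hx).le (h.ratio_le_one hx)
  have e : ∀ y : EuclideanSpace ℝ (Fin n), y ≠ 0 → Real.log (‖y‖ / (3 * D))
      = 1 / 2 * Real.log (‖y - 0‖ ^ 2) - Real.log (3 * D) := by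
    intro y hy
    rw [Real.log_div (norm_ne_zero_iff.2 hy) h3D.ne', Real.log_pow, sub_zero]
    push_cast; ring
  have h0 := (hasFDerivAt_normSq 0 x).log (by rw [sub_zero]; positivity)
  have h1 : HasFDerivAt (fun y : EuclideanSpace ℝ (Fin n) => 1 - (1 / 2 * Real.log (‖y - 0‖ ^ 2)
      - Real.log (3 * D))) _ x :=
    ((h0.const_mul (1 / 2 : ℝ)).sub_const (Real.log (3 * D))).const_sub 1
  have h2 := (h1.inv_real (by rw [← e x (norm_pos_iff.1 hx0)]; linarith)).const_mul (2⁻¹ : ℝ)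
  have heq : (fun x : EuclideanSpace ℝ (Fin n) => logWeight (‖x‖ / (3 * D)) / 2) =ᶠ[nhds x]
      fun y => 2⁻¹ * (1 - (1 / 2 * Real.log (‖y - 0‖ ^ 2) - Real.log (3 * D)))⁻¹ := by
    filter_upwards [isOpen_ne.mem_nhds (norm_pos_iff.1 hx0)] with y hy
    rw [logWeight, e y hy, one_div, div_eq_inv_mul]
  rw [(h2.congr_of_eventuallyEq heq).fderiv, ← e x (norm_pos_iff.1 hx0)]
  have e2 : inner ℝ x x = ‖x‖ ^ 2 := real_inner_self_eq_norm_sq x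
  simp only [smul_apply, neg_apply, innerSL_apply_apply, sub_zero, e2, smul_eq_mul, nsmul_eq_mul,
    logWeight]
  have : 1 - Real.log (‖x‖ / (3 * D)) ≠ 0 := by linarith
  field_simp
  norm_num

theorem continuousOn_logWeight : ContinuousOn
    (fun x : EuclideanSpace ℝ (Fin n) => logWeight (‖x‖ / (3 * D))) Ω := by
  refine (h.contDiffOn_logWeight.continuousOn.mul (continuousOn_const (c := (2 : ℝ)))).congr ?_
  intro x _
  simp

/-- The energy controls the critically weighted `L²` norm. -/
theorem setIntegral_logWeight_sq_le (hu : ContDiff ℝ 1 u)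
    (hc : HasCompactSupport u) (hs : tsupport u ⊆ Ω) :
    ∫ x in tsupport u, u x ^ 2 * (logWeight (‖x‖ / (3 * D)) ^ 2 * (‖x‖ ^ 2)⁻¹)
      ≤ 8 * ((∫ x in tsupport u, ‖gradient u x‖ ^ 2)
        - ∫ x in tsupport u, u x ^ 2 * fieldPotential p (n / 2) (fun _ => 0) x) := by
  have cX := h.continuousOn_logWeight
  -- For γ = X₁/2, x·∇γ = X₁²/2 and γ² = X₁²/4; of the remaining X₁²/4 the cross term takes at most
  -- X₁²/80, since X₁ ≤ 1.
  have := h.setIntegral_mul_le_energy hu hc hs h.contDiffOn_logWeight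
    (fun x hx => by have := logWeight_pos (h.ratio_pos hx) (h.ratio_le_one hx); positivity)
    (g := fun x => 1 / 8 * logWeight (‖x‖ / (3 * D)) ^ 2) (by fun_prop) (fun x hx => by
      rw [h.fderiv_logWeight hx]
      have h1 := logWeight_pos (h.ratio_pos hx) (h.ratio_le_one hx)
      have h2 := logWeight_le_one (h.ratio_pos hx) (h.ratio_le_one hx)
      have h3 : logWeight (‖x‖ / (3 * D)) * logWeight (‖x‖ / (3 * D)) ^ 2
        ≤ 1 * logWeight (‖x‖ / (3 * D)) ^ 2 := by gcongr
      nlinarith)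
  have e : ∀ x : EuclideanSpace ℝ (Fin n), u x ^ 2 * (1 / 8 * logWeight (‖x‖ / (3 * D)) ^ 2
      * (‖x‖ ^ 2)⁻¹) = 1 / 8 * (u x ^ 2 * (logWeight (‖x‖ / (3 * D)) ^ 2 * (‖x‖ ^ 2)⁻¹)) := by
    intro x; ring
  simp_rw [e, integral_const_mul] at this
  linarith

/-- The energy controls the mass in a dyadic shell with the weight of the scale. -/
theorem logWeight_mul_setIntegral_radialBump_sq_le (hu : ContDiff ℝ 1 u)
    (hc : HasCompactSupport u) (hs : tsupport u ⊆ Ω) {R : ℝ} (hR : 0 < R) (hRD : R ≤ D) :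
    logWeight (R / (3 * D)) * ∫ x in tsupport u, u x ^ 2 * (radialBump R ‖x‖ ^ 2 * (‖x‖ ^ 2)⁻¹)
      ≤ 9 * ((∫ x in tsupport u, ‖gradient u x‖ ^ 2)
        - ∫ x in tsupport u, u x ^ 2 * fieldPotential p (n / 2) (fun _ => 0) x) := by
  have hY := h.setIntegral_logWeight_sq_le hu hc hs
  have h3D : 0 < 3 * D := by linarith [h.pos]
  have hRD' : R ≤ 3 * D := by linarith
  have hXR := logWeight_pos (div_pos hR h3D) ((div_le_one h3D).2 hRD')
  set c := logWeight (R / (3 * D)) with hcdef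
  have cX := h.continuousOn_logWeight
  have cu := hu.continuous.continuousOn (s := Ω)
  have hA := h.norm_sq_ne_zero
  have hAR : ∀ x ∈ Ω, ‖x‖ ^ 2 + R ^ 2 ≠ 0 := fun x _ => by positivity
  have cb : ContinuousOn (fun x : EuclideanSpace ℝ (Fin n) => radialBump R ‖x‖) Ω := by
    unfold radialBump
    exact (ContinuousOn.div (by fun_prop) (by fun_prop) hAR)
  have i1 := integrableOn_tsupport hc hs
    (h := fun x => u x ^ 2 * (radialBump R ‖x‖ ^ 2 * (‖x‖ ^ 2)⁻¹))
    (by fun_prop (disch := assumption))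
  have i2 := integrableOn_tsupport hc hs
    (h := fun x => u x ^ 2 * (logWeight (‖x‖ / (3 * D)) ^ 2 * (‖x‖ ^ 2)⁻¹))
    (by fun_prop (disch := assumption))
  have hγ : ContDiffOn ℝ 1 (fun x : EuclideanSpace ℝ (Fin n) =>
      c * (‖x‖ ^ 2 * (‖x‖ ^ 2 + R ^ 2)⁻¹)) Ω := by
    refine contDiffOn_const.mul (ContDiffOn.mul ?_ (ContDiffOn.inv ?_ hAR))
    · exact (contDiff_id.norm_sq ℝ).contDiffOn
    · exact ((contDiff_id.norm_sq ℝ).add contDiff_const).contDiffOn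
  -- Here x·∇γ is 2c times the squared bump. By `logWeight_mul_sq_div_le`, γ ≤ X₁, so γ² and the
  -- cross term together cost at most 2X₁², which is 16 energies by `hY`; (1 + 16)/2 ≤ 9.
  have := h.setIntegral_mul_le_energy hu hc hs hγ
    (fun x hx => by positivity)
    (g := fun x => 2 * c * radialBump R ‖x‖ ^ 2 - 2 * logWeight (‖x‖ / (3 * D)) ^ 2)
    (by fun_prop) (fun x hx => by
      rw [fderiv_const_mul_sq_div c hR x]
      have h1 := logWeight_pos (h.ratio_pos hx) (h.ratio_le_one hx)
      have h2 := logWeight_le_one (h.ratio_pos hx) (h.ratio_le_one hx)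
      have h4 := logWeight_mul_sq_div_le hR hRD' (h.norm_pos hx)
        (by linarith [h.norm_le x hx, h.pos])
      rw [← hcdef] at h4
      set X := logWeight (‖x‖ / (3 * D))
      have h5 : 0 ≤ c * (‖x‖ ^ 2 * (‖x‖ ^ 2 + R ^ 2)⁻¹) := by positivity
      set g := c * (‖x‖ ^ 2 * (‖x‖ ^ 2 + R ^ 2)⁻¹)
      have h6 : g ^ 2 ≤ X ^ 2 := by gcongr
      have h7 : g * (X ^ 2 / 40) ≤ 1 * (X ^ 2 / 40) := by gcongr; linarith
      nlinarith)
  have e : ∀ x : EuclideanSpace ℝ (Fin n), u x ^ 2 * ((2 * c * radialBump R ‖x‖ ^ 2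
      - 2 * logWeight (‖x‖ / (3 * D)) ^ 2) * (‖x‖ ^ 2)⁻¹)
      = 2 * c * (u x ^ 2 * (radialBump R ‖x‖ ^ 2 * (‖x‖ ^ 2)⁻¹))
        - 2 * (u x ^ 2 * (logWeight (‖x‖ / (3 * D)) ^ 2 * (‖x‖ ^ 2)⁻¹)) := by
    intro x; ring
  simp_rw [e] at this
  rw [integral_sub (i1.const_mul _) (i2.const_mul _), integral_const_mul, integral_const_mul] at this
  have hY0 : 0 ≤ ∫ x in tsupport u, u x ^ 2 * (logWeight (‖x‖ / (3 * D)) ^ 2 * (‖x‖ ^ 2)⁻¹) :=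
    integral_nonneg fun x => by positivity
  linarith

end OutsideLargeBall

end Hardy

/-! ### Euclidean Sobolev inequality -/

section Sobolev

variable {n : ℕ}

theorem exists_sobolev_const (hn : 3 ≤ n) : ∃ S : ℝ, 0 < S ∧
    ∀ w : EuclideanSpace ℝ (Fin n) → ℝ, ContDiff ℝ 1 w → HasCompactSupport w →
      (∫ x, |w x| ^ (2 * (n : ℝ) / ((n : ℝ) - 2))) ^ (((n : ℝ) - 2) / n)
        ≤ S * ∫ x, ‖gradient w x‖ ^ 2 := by
  have hn' : (3 : ℝ) ≤ n := by exact_mod_cast hn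
  set q : NNReal := ⟨2 * (n : ℝ) / ((n : ℝ) - 2), by
    apply div_nonneg <;> linarith⟩ with hq
  have hqr : (q : ℝ) = 2 * (n : ℝ) / ((n : ℝ) - 2) := rfl
  have hq0 : 0 < (q : ℝ) := by rw [hqr]; apply div_pos <;> linarith
  set C := eLpNormLESNormFDerivOfEqInnerConst
    (volume : Measure (EuclideanSpace ℝ (Fin n))) ((2 : NNReal) : ℝ) with hC
  -- The summand 1 secures a positive constant.
  refine ⟨(C : ℝ) ^ 2 + 1, by positivity, fun w hw hc => ?_⟩
  have h := eLpNorm_le_eLpNorm_fderiv_of_eq_inner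
    (μ := (volume : Measure (EuclideanSpace ℝ (Fin n)))) (p := 2) (p' := q) hw hc (by norm_num)
    (by simp; omega) (by
      rw [hqr]; simp
      have : (n : ℝ) - 2 ≠ 0 := by linarith
      have : (n : ℝ) ≠ 0 := by linarith
      field_simp)
  have hmw : MemLp w q volume := hw.continuous.memLp_of_hasCompactSupport hc
  have hmd : MemLp (fderiv ℝ w) 2 volume :=
    (hw.continuous_fderiv (by norm_num)).memLp_of_hasCompactSupport (hc.fderiv ℝ)
  rw [hmw.eLpNorm_eq_integral_rpow_norm (by simpa using hq0.ne') (by simp),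
    show ((2 : NNReal) : ENNReal) = 2 by norm_num,
    hmd.eLpNorm_eq_integral_rpow_norm (by norm_num) (by norm_num),
    ← hC, ← ENNReal.ofReal_coe_nnreal (p := C), ← ENNReal.ofReal_mul (by positivity)] at h
  rw [ENNReal.ofReal_le_ofReal_iff (by positivity)] at h
  have h2 := pow_le_pow_left₀ (by positivity) h 2
  have hI : 0 ≤ ∫ x, ‖gradient w x‖ ^ 2 := integral_nonneg fun x => by positivity
  have hg : ∀ x, ‖gradient w x‖ = ‖fderiv ℝ w x‖ := fun x => by simp [gradient]
  have e1 : ((∫ x, ‖w x‖ ^ (q : ENNReal).toReal) ^ ((q : ENNReal).toReal)⁻¹) ^ 2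
      = (∫ x, |w x| ^ (2 * (n : ℝ) / ((n : ℝ) - 2))) ^ (((n : ℝ) - 2) / n) := by
    rw [← Real.rpow_natCast, ← Real.rpow_mul (integral_nonneg fun x => by positivity)]
    simp only [ENNReal.coe_toReal, hqr, Real.norm_eq_abs]
    congr 1
    have : (n : ℝ) - 2 ≠ 0 := by linarith
    have : (n : ℝ) ≠ 0 := by linarith
    push_cast
    field_simp
  have e2 : ((∫ x, ‖fderiv ℝ w x‖ ^ (2 : ENNReal).toReal) ^ ((2 : ENNReal).toReal)⁻¹) ^ 2
      = ∫ x, ‖gradient w x‖ ^ 2 := by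
    rw [← Real.rpow_natCast, ← Real.rpow_mul (integral_nonneg fun x => by positivity)]
    simp [hg]
  rw [e1, mul_pow, e2] at h2
  refine h2.trans ?_
  gcongr
  linarith

end Sobolev

/-! ### Localization of the energy to dyadic shells -/

section Localization

variable {n : ℕ}

theorem gradient_mul {f g : EuclideanSpace ℝ (Fin n) → ℝ} {x : EuclideanSpace ℝ (Fin n)}
    (hf : DifferentiableAt ℝ f x) (hg : DifferentiableAt ℝ g x) :
    gradient (fun y => f y * g y) x = f x • gradient g x + g x • gradient f x := by
  simp only [gradient, fderiv_fun_mul hf hg, map_add, map_smul]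

theorem contDiff_radialBump_sq {R : ℝ} (hR : 0 < R) {k : WithTop ℕ∞} :
    ContDiff ℝ k (fun x : EuclideanSpace ℝ (Fin n) => radialBump R ‖x‖ ^ 2) := by
  have e : (fun x : EuclideanSpace ℝ (Fin n) => radialBump R ‖x‖ ^ 2)
      = fun x => ‖x‖ ^ 2 * R ^ 2 / (‖x‖ ^ 2 + R ^ 2) ^ 2 := by
    funext x; rw [radialBump, div_pow, mul_pow]
  rw [e]
  have h1 : ContDiff ℝ k (fun x : EuclideanSpace ℝ (Fin n) => ‖x‖ ^ 2) := contDiff_id.norm_sq ℝ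
  exact (h1.mul contDiff_const).div ((h1.add contDiff_const).pow 2) fun x => by positivity

/-- With b the bump and r = |x|, r∂_r(b²) = 2b²(R² - r²)/(R² + r²), which is at most 2b² in absolute
value. -/
theorem norm_gradient_radialBump_sq_le {R : ℝ} (hR : 0 < R) (x : EuclideanSpace ℝ (Fin n))
    (hx : x ≠ 0) :
    ‖gradient (fun x : EuclideanSpace ℝ (Fin n) => radialBump R ‖x‖ ^ 2) x‖ ^ 2
      ≤ 4 * (radialBump R ‖x‖ ^ 2) ^ 2 * (‖x‖ ^ 2)⁻¹ := by
  have h1 := hasFDerivAt_normSq 0 x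
  have h2 : HasFDerivAt (fun y : EuclideanSpace ℝ (Fin n) =>
      R ^ 2 * (‖y - 0‖ ^ 2 * ((‖y - 0‖ ^ 2 + R ^ 2) ^ 2)⁻¹)) _ x :=
    (h1.mul (((h1.add_const (R ^ 2)).pow 2).inv_real (by positivity))).const_mul (R ^ 2)
  have e : (fun x : EuclideanSpace ℝ (Fin n) => radialBump R ‖x‖ ^ 2)
      = fun y => R ^ 2 * (‖y - 0‖ ^ 2 * ((‖y - 0‖ ^ 2 + R ^ 2) ^ 2)⁻¹) := by
    funext x; rw [radialBump, div_pow, mul_pow, sub_zero]; field_simp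
  have h3 : fderiv ℝ (fun x : EuclideanSpace ℝ (Fin n) => radialBump R ‖x‖ ^ 2) x
      = (2 * R ^ 2 * (R ^ 2 - ‖x‖ ^ 2) / (‖x‖ ^ 2 + R ^ 2) ^ 3) • innerSL ℝ x := by
    rw [e, h2.fderiv]
    ext v
    simp only [smul_apply, add_apply, innerSL_apply_apply, smul_eq_mul, nsmul_eq_mul, sub_zero]
    have : ‖x‖ ^ 2 + R ^ 2 ≠ 0 := by positivity
    field_simp
    push_cast
    ring
  have h4 : ‖gradient (fun x : EuclideanSpace ℝ (Fin n) => radialBump R ‖x‖ ^ 2) x‖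
      = |2 * R ^ 2 * (R ^ 2 - ‖x‖ ^ 2) / (‖x‖ ^ 2 + R ^ 2) ^ 3| * ‖x‖ := by
    rw [gradient, LinearIsometryEquiv.norm_map, h3, norm_smul, innerSL_apply_norm,
      Real.norm_eq_abs]
  rw [h4, mul_pow, sq_abs, radialBump]
  have hA : 0 < ‖x‖ ^ 2 := by have := norm_pos_iff.2 hx; positivity
  simp only [div_pow, mul_pow]
  generalize ‖x‖ ^ 2 = A at *
  have e5 : (R ^ 2 - A) ^ 2 ≤ (A + R ^ 2) ^ 2 := by nlinarith [sq_nonneg R]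
  calc 2 ^ 2 * (R ^ 2) ^ 2 * (R ^ 2 - A) ^ 2 / ((A + R ^ 2) ^ 3) ^ 2 * A
      ≤ 2 ^ 2 * (R ^ 2) ^ 2 * (A + R ^ 2) ^ 2 / ((A + R ^ 2) ^ 3) ^ 2 * A := by gcongr
    _ = _ := by field_simp; norm_num

/-- The logarithmic gradient of the ground state of the exterior domain. -/
noncomputable def groundField (p x : EuclideanSpace ℝ (Fin n)) : EuclideanSpace ℝ (Fin n) :=
  fieldCoeffZero p (fun _ => 0) x • x + fieldCoeffPole p (n / 2) x • (x - p)

variable {Ω : Set (EuclideanSpace ℝ (Fin n))} {p : EuclideanSpace ℝ (Fin n)} {D : ℝ}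
  {u : EuclideanSpace ℝ (Fin n) → ℝ}

theorem continuous_radialBump {R : ℝ} (hR : 0 < R) :
    Continuous (fun x : EuclideanSpace ℝ (Fin n) => radialBump R ‖x‖) := by
  have hAR: ∀ x : EuclideanSpace ℝ (Fin n), ‖x‖ ^ 2 + R ^ 2 ≠ 0 := fun x => by positivity
  unfold radialBump
  exact Continuous.div (by fun_prop) (by fun_prop) hAR

namespace OutsideLargeBall

variable (h : OutsideLargeBall Ω p D)

include h

theorem continuousOn_groundField : ContinuousOn (groundField p) Ω := by
  have c1 : ContinuousOn (fieldCoeffZero p (fun _ => 0)) Ω :=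
    (contDiffOn_fieldCoeffZero h.inner_ne_zero contDiffOn_const).continuousOn
  have c2 : ContinuousOn (fieldCoeffPole p (n / 2)) Ω :=
    (contDiffOn_fieldCoeffPole h.inner_ne_zero).continuousOn
  unfold groundField
  fun_prop

theorem setIntegral_groundField (hu : ContDiff ℝ 1 u)
    (hc : HasCompactSupport u) (hs : tsupport u ⊆ Ω) :
    (∫ x in tsupport u, ‖gradient u x - u x • groundField p x‖ ^ 2)
      = (∫ x in tsupport u, ‖gradient u x‖ ^ 2)
        - ∫ x in tsupport u, u x ^ 2 * fieldPotential p (n / 2) (fun _ => 0) x :=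
  setIntegral_norm_gradient_sub_field_sq h.isOpen h.inner_ne_zero hu hc hs (n / 2)
    contDiffOn_const

/-- The Dirichlet integral of a function localized to a dyadic shell. -/
theorem integral_norm_gradient_radialBump_mul_le (hu : ContDiff ℝ 1 u)
    (hc : HasCompactSupport u) (hs : tsupport u ⊆ Ω) {R : ℝ} (hR : 0 < R) :
    ∫ x, ‖gradient (fun x => u x * radialBump R ‖x‖ ^ 2) x‖ ^ 2
      ≤ 2 * (∫ x in tsupport u, radialBump R ‖x‖ ^ 2 * ‖gradient u x - u x • groundField p x‖ ^ 2)
        + (8 + (n : ℝ) ^ 2) *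
          ∫ x in tsupport u, u x ^ 2 * ((radialBump R ‖x‖ ^ 2) ^ 2 * (‖x‖ ^ 2)⁻¹) := by
  set w : EuclideanSpace ℝ (Fin n) → ℝ := fun x => u x * radialBump R ‖x‖ ^ 2 with hw
  have hη : ContDiff ℝ 1 (fun x : EuclideanSpace ℝ (Fin n) => radialBump R ‖x‖ ^ 2) :=
    contDiff_radialBump_sq hR
  have hwd : ContDiff ℝ 1 w := hu.mul hη
  have hwc : HasCompactSupport w := hc.mul_right
  have hwu : tsupport w ⊆ tsupport u := tsupport_mul_subset_left
  have hws : tsupport w ⊆ Ω := hwu.trans hs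
  have hw0 : ∀ x ∉ tsupport w, w x = 0 := fun x hx => image_eq_zero_of_notMem_tsupport hx
  have hgw0 : ∀ x ∉ tsupport w, gradient w x = 0 :=
    fun x hx => gradient_eq_zero_of_notMem_tsupport hx
  have hext : ∀ f : EuclideanSpace ℝ (Fin n) → ℝ, (∀ x ∉ tsupport w, f x = 0) →
      ∫ x in tsupport w, f x = ∫ x in tsupport u, f x := by
    intro f hf
    rw [setIntegral_eq_integral_of_forall_compl_eq_zero hf,
      setIntegral_eq_integral_of_forall_compl_eq_zero fun x hx => hf x fun hx' => hx (hwu hx')]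
  have hE := h.setIntegral_groundField hwd hwc hws
  rw [setIntegral_eq_integral_of_forall_compl_eq_zero (f := fun x => ‖gradient w x‖ ^ 2)
      fun x hx => by simp [hgw0 x hx],
    hext _ fun x hx => by simp [hgw0 x hx, hw0 x hx],
    hext _ fun x hx => by simp [hw0 x hx]] at hE
  have e : ∫ x, ‖gradient w x‖ ^ 2 =
      (∫ x in tsupport u, ‖gradient w x - w x • groundField p x‖ ^ 2)
      + ∫ x in tsupport u, w x ^ 2 * fieldPotential p (n / 2) (fun _ => 0) x := by linarith
  have cu := hu.continuous.continuousOn (s := Ω)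
  have cg := (continuous_gradient hu).continuousOn (s := Ω)
  have cw := hwd.continuous.continuousOn (s := Ω)
  have cgw := (continuous_gradient hwd).continuousOn (s := Ω)
  have cE := h.continuousOn_groundField
  have cb := (continuous_radialBump (n := n) hR).continuousOn (s := Ω)
  have hA := h.norm_sq_ne_zero
  have cV := continuousOn_fieldPotential h.isOpen h.inner_ne_zero (n / 2)
    (contDiffOn_const (c := (0 : ℝ)))
  have i1 := integrableOn_tsupport hc hs (h := fun x => radialBump R ‖x‖ ^ 2 *
    ‖gradient u x - u x • groundField p x‖ ^ 2) (by fun_prop)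
  have i2 := integrableOn_tsupport hc hs
    (h := fun x => u x ^ 2 * ((radialBump R ‖x‖ ^ 2) ^ 2 * (‖x‖ ^ 2)⁻¹))
    (by fun_prop (disch := assumption))
  have i3 := integrableOn_tsupport hc hs
    (h := fun x => ‖gradient w x - w x • groundField p x‖ ^ 2) (by fun_prop)
  have i4 := integrableOn_tsupport hc hs
    (h := fun x => w x ^ 2 * fieldPotential p (n / 2) (fun _ => 0) x) (by fun_prop)
  rw [e, ← integral_add i3 i4, ← integral_const_mul, ← integral_const_mul,
    ← integral_add (i1.const_mul _) (i2.const_mul _)]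
  refine setIntegral_mono_on (i3.add i4) ((i1.const_mul _).add (i2.const_mul _))
    (isClosed_tsupport u).measurableSet ?_
  intro x hx
  have hxΩ := hs hx
  have hx0 := h.norm_pos hxΩ
  -- With η the squared bump, ∇(ηu) - ηuH = η(∇u - uH) + u∇η: the completed square localizes up to
  -- the commutator u∇η, and the potential term of `e` is bounded by V ≤ n²/|x|².
  have hgw : gradient w x - w x • groundField p x
      = radialBump R ‖x‖ ^ 2 • (gradient u x - u x • groundField p x)
        + u x • gradient (fun x : EuclideanSpace ℝ (Fin n) => radialBump R ‖x‖ ^ 2) x := by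
    rw [hw, gradient_mul (hu.differentiable (by norm_num) x) (hη.differentiable (by norm_num) x)]
    module
  have hb0 := radialBump_nonneg hR.le hx0.le
  have hb1 := radialBump_le_one (r := ‖x‖) hR
  have hV := h.potential_le hxΩ
  have hgη := norm_gradient_radialBump_sq_le hR x (norm_pos_iff.1 hx0)
  rw [hgw]
  set b := radialBump R ‖x‖
  set G := gradient u x - u x • groundField p x
  set Y := gradient (fun x : EuclideanSpace ℝ (Fin n) => radialBump R ‖x‖ ^ 2) x
  have hb2 : (b ^ 2) ^ 2 ≤ b ^ 2 := by
    have : b ^ 2 ≤ 1 := by nlinarith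
    nlinarith [sq_nonneg b]
  have s1 : ‖b ^ 2 • G + u x • Y‖ ^ 2 ≤
      2 * (b ^ 2 * ‖G‖ ^ 2) + 8 * (u x ^ 2 * ((b ^ 2) ^ 2 * (‖x‖ ^ 2)⁻¹)) := by
    have t1 : ‖b ^ 2 • G + u x • Y‖ ^ 2 ≤ 2 * ‖b ^ 2 • G‖ ^ 2 + 2 * ‖u x • Y‖ ^ 2 := by
      have := parallelogram_law_with_norm ℝ (b ^ 2 • G) (u x • Y)
      nlinarith [sq_nonneg ‖b ^ 2 • G - u x • Y‖]
    rw [norm_smul, norm_smul, mul_pow, mul_pow, Real.norm_eq_abs, Real.norm_eq_abs, sq_abs,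
      sq_abs] at t1
    have t2 : u x ^ 2 * ‖Y‖ ^ 2 ≤ u x ^ 2 * (4 * (b ^ 2) ^ 2 * (‖x‖ ^ 2)⁻¹) := by gcongr
    have t3 : (b ^ 2) ^ 2 * ‖G‖ ^ 2 ≤ b ^ 2 * ‖G‖ ^ 2 := by gcongr
    linarith
  have s2 : w x ^ 2 * fieldPotential p (n / 2) (fun _ => 0) x
      ≤ (n : ℝ) ^ 2 * (u x ^ 2 * ((b ^ 2) ^ 2 * (‖x‖ ^ 2)⁻¹)) := by
    have : w x = u x * b ^ 2 := rfl
    rw [this, mul_pow]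
    calc u x ^ 2 * (b ^ 2) ^ 2 * fieldPotential p (n / 2) (fun _ => 0) x
        ≤ u x ^ 2 * (b ^ 2) ^ 2 * ((n : ℝ) ^ 2 * (‖x‖ ^ 2)⁻¹) := by gcongr
      _ = _ := by ring
  linarith

end OutsideLargeBall

end Localization

/-! ### Interpolation between a uniform and a summed bound -/

section Summation

/-- c^(m+1) b^m = (cb)^(m-1) · c²b: the uniform bound controls the first factor and the summed bound
the second. This is where the critical exponent of the weight originates. -/
theorem sum_rpow_mul_rpow_le {ι : Type*} {s : Finset ι} {c b : ι → ℝ} {m M₁ M₂ : ℝ} (hm : 1 < m)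
    (hc : ∀ k ∈ s, 0 < c k) (hb : ∀ k ∈ s, 0 ≤ b k) (h1 : ∀ k ∈ s, c k * b k ≤ M₁)
    (h2 : ∑ k ∈ s, c k ^ 2 * b k ≤ M₂) (hM : 0 ≤ M₁) :
    ∑ k ∈ s, c k ^ (m + 1) * b k ^ m ≤ M₁ ^ (m - 1) * M₂ := by
  have key : ∀ k ∈ s, c k ^ (m + 1) * b k ^ m ≤ M₁ ^ (m - 1) * (c k ^ 2 * b k) := by
    intro k hk
    have hck := hc k hk
    have hbk := hb k hk
    have e : c k ^ (m + 1) * b k ^ m = (c k * b k) ^ (m - 1) * (c k ^ 2 * b k) := by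
      rw [Real.mul_rpow hck.le hbk, show m + 1 = (m - 1) + (2 : ℕ) by push_cast; ring,
        Real.rpow_add hck, Real.rpow_natCast]
      have : b k ^ m = b k ^ (m - 1) * b k := by
        conv_lhs => rw [show m = (m - 1) + 1 by ring]
        rw [Real.rpow_add_one' hbk (by linarith)]
      rw [this]
      ring
    rw [e]
    gcongr
    exact h1 k hk
  calc ∑ k ∈ s, c k ^ (m + 1) * b k ^ m ≤ ∑ k ∈ s, M₁ ^ (m - 1) * (c k ^ 2 * b k) :=
        Finset.sum_le_sum key
    _ = M₁ ^ (m - 1) * ∑ k ∈ s, c k ^ 2 * b k := by rw [Finset.mul_sum]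
    _ ≤ _ := by gcongr

end Summation

/-! ### Summation over dyadic scales -/

section HardySobolev

variable {n : ℕ} {Ω : Set (EuclideanSpace ℝ (Fin n))} {p : EuclideanSpace ℝ (Fin n)} {D : ℝ}
  {u : EuclideanSpace ℝ (Fin n) → ℝ}

namespace OutsideLargeBall

variable (h : OutsideLargeBall Ω p D)

include h

theorem scale_pos (k : ℕ) : 0 < D * (1 / 2) ^ k := by have := h.pos; positivity

theorem scale_le (k : ℕ) : D * (1 / 2) ^ k ≤ D :=
  mul_le_of_le_one_right h.pos.le (pow_le_one₀ (by norm_num) (by norm_num))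

theorem logWeight_scale_pos (k : ℕ) : 0 < logWeight (D * (1 / 2) ^ k / (3 * D)) :=
  logWeight_pos (div_pos (h.scale_pos k) (by linarith [h.pos]))
    ((div_le_one (by linarith [h.pos])).2 (by linarith [h.pos, h.scale_le k]))

theorem logWeight_scale_le_one (k : ℕ) : logWeight (D * (1 / 2) ^ k / (3 * D)) ≤ 1 :=
  logWeight_le_one (div_pos (h.scale_pos k) (by linarith [h.pos]))
    ((div_le_one (by linarith [h.pos])).2 (by linarith [h.pos, h.scale_le k]))

/-- The weighted Lebesgue norm is controlled by its localizations to dyadic shells. -/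
theorem setIntegral_logWeight_rpow_le (hu : ContDiff ℝ 1 u) (hc : HasCompactSupport u)
    (hs : tsupport u ⊆ Ω) {N : ℕ} (hN : ∀ x ∈ tsupport u, D * (1 / 2) ^ N < ‖x‖)
    {a q : ℝ} (ha : 0 ≤ a) (hq : 0 < q) :
    ∫ x in tsupport u, logWeight (‖x‖ / (3 * D)) ^ a * |u x| ^ q
      ≤ (25 / 4) ^ q * ∑ k ∈ Finset.range N, logWeight (D * (1 / 2) ^ k / (3 * D)) ^ a
        * ∫ x, |u x * radialBump (D * (1 / 2) ^ k) ‖x‖ ^ 2| ^ q := by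
  have cu := hu.continuous.continuousOn (s := Ω)
  have cX := h.continuousOn_logWeight
  have cb : ∀ k : ℕ, ContinuousOn
      (fun x : EuclideanSpace ℝ (Fin n) => radialBump (D * (1 / 2) ^ k) ‖x‖) Ω :=
    fun k => (continuous_radialBump (h.scale_pos k)).continuousOn
  have i1 := integrableOn_tsupport hc hs
    (h := fun x => logWeight (‖x‖ / (3 * D)) ^ a * |u x| ^ q)
    ((cX.rpow_const fun x _ => Or.inr ha).mul (cu.abs.rpow_const fun x _ => Or.inr hq.le))
  have i2 : ∀ k, IntegrableOn (fun x => |u x * radialBump (D * (1 / 2) ^ k) ‖x‖ ^ 2| ^ q)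
      (tsupport u) := fun k => integrableOn_tsupport hc hs
    (((cu.mul ((cb k).pow 2)).abs).rpow_const fun x _ => Or.inr hq.le)
  have e : ∀ k, ∫ x, |u x * radialBump (D * (1 / 2) ^ k) ‖x‖ ^ 2| ^ q
      = ∫ x in tsupport u, |u x * radialBump (D * (1 / 2) ^ k) ‖x‖ ^ 2| ^ q := by
    intro k
    rw [setIntegral_eq_integral_of_forall_compl_eq_zero]
    intro x hx
    rw [image_eq_zero_of_notMem_tsupport hx, zero_mul, abs_zero, Real.zero_rpow hq.ne']
  simp_rw [e, ← integral_const_mul]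
  rw [← integral_finsetSum _ fun k _ => (i2 k).const_mul _, ← integral_const_mul]
  refine setIntegral_mono_on i1 ((integrable_finsetSum _ fun k _ => (i2 k).const_mul _).const_mul _)
    (isClosed_tsupport u).measurableSet ?_
  intro x hx
  have hxΩ := hs hx
  have hX := logWeight_pos (h.ratio_pos hxΩ) (h.ratio_le_one hxΩ)
  -- At each point a single term dominates: on its own shell the squared bump is at least 4/25 and
  -- the weight of the scale is no smaller than the weight at the point.
  obtain ⟨k, hk, hk1, hk2⟩ := exists_radialBump_ge (h.norm_le x hxΩ) (hN x hx) h.pos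
  have h3D : 0 < 3 * D := by linarith [h.pos]
  have hXk : logWeight (‖x‖ / (3 * D)) ≤ logWeight (D * (1 / 2) ^ k / (3 * D)) :=
    logWeight_mono (h.ratio_pos hxΩ) (by gcongr)
      ((div_le_one h3D).2 (by linarith [h.scale_le k, h.pos]))
  have hterm : ∀ k ∈ Finset.range N, 0 ≤ logWeight (D * (1 / 2) ^ k / (3 * D)) ^ a *
      |u x * radialBump (D * (1 / 2) ^ k) ‖x‖ ^ 2| ^ q := fun k _ =>
    mul_nonneg (Real.rpow_nonneg (h.logWeight_scale_pos k).le _) (by positivity)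
  calc logWeight (‖x‖ / (3 * D)) ^ a * |u x| ^ q
      ≤ logWeight (D * (1 / 2) ^ k / (3 * D)) ^ a *
        (25 / 4 * |u x * radialBump (D * (1 / 2) ^ k) ‖x‖ ^ 2|) ^ q := by
        gcongr
        · exact Real.rpow_nonneg (h.logWeight_scale_pos k).le _
        · rw [abs_mul, abs_of_nonneg (sq_nonneg (radialBump _ _))]
          nlinarith [abs_nonneg (u x)]
    _ = (25 / 4) ^ q * (logWeight (D * (1 / 2) ^ k / (3 * D)) ^ a *
        |u x * radialBump (D * (1 / 2) ^ k) ‖x‖ ^ 2| ^ q) := by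
        rw [Real.mul_rpow (by norm_num) (abs_nonneg _)]; ring
    _ ≤ _ := by
        gcongr
        exact Finset.single_le_sum hterm (Finset.mem_range.2 hk)

/-- The mass term is `logWeight_mul_setIntegral_radialBump_sq_le`; for the gradient term it suffices
that the weight and the bump are at most 1. -/
theorem logWeight_mul_localized_energy_le (hu : ContDiff ℝ 1 u) (hc : HasCompactSupport u)
    (hs : tsupport u ⊆ Ω) (k : ℕ) :
    logWeight (D * (1 / 2) ^ k / (3 * D)) *
      (2 * (∫ x in tsupport u, radialBump (D * (1 / 2) ^ k) ‖x‖ ^ 2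
          * ‖gradient u x - u x • groundField p x‖ ^ 2)
        + (8 + (n : ℝ) ^ 2) * ∫ x in tsupport u,
          u x ^ 2 * ((radialBump (D * (1 / 2) ^ k) ‖x‖ ^ 2) ^ 2 * (‖x‖ ^ 2)⁻¹))
      ≤ (2 + 9 * (8 + (n : ℝ) ^ 2)) *
        ∫ x in tsupport u, ‖gradient u x - u x • groundField p x‖ ^ 2 := by
  have cu := hu.continuous.continuousOn (s := Ω)
  have cg := (continuous_gradient hu).continuousOn (s := Ω)
  have hA := h.norm_sq_ne_zero
  have cE := h.continuousOn_groundField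
  have cb := (continuous_radialBump (n := n) (h.scale_pos k)).continuousOn (s := Ω)
  have h1 := h.logWeight_mul_setIntegral_radialBump_sq_le hu hc hs (h.scale_pos k) (h.scale_le k)
  rw [← h.setIntegral_groundField hu hc hs] at h1
  have hX0 := h.logWeight_scale_pos k
  have hX1 := h.logWeight_scale_le_one k
  have h2 : ∫ x in tsupport u, radialBump (D * (1 / 2) ^ k) ‖x‖ ^ 2
          * ‖gradient u x - u x • groundField p x‖ ^ 2
      ≤ ∫ x in tsupport u, ‖gradient u x - u x • groundField p x‖ ^ 2 := by
    refine setIntegral_mono_on (integrableOn_tsupport hc hs (by fun_prop))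
      (integrableOn_tsupport hc hs (by fun_prop)) (isClosed_tsupport u).measurableSet ?_
    intro x hx
    have hb0 := radialBump_nonneg (h.scale_pos k).le (norm_nonneg x)
    have hb1 := radialBump_le_one (r := ‖x‖) (h.scale_pos k)
    refine mul_le_of_le_one_left (sq_nonneg _) (pow_le_one₀ hb0 hb1)
  have h3 : 0 ≤ ∫ x in tsupport u, radialBump (D * (1 / 2) ^ k) ‖x‖ ^ 2
          * ‖gradient u x - u x • groundField p x‖ ^ 2 :=
    integral_nonneg fun x => by positivity
  have h6 : ∫ x in tsupport u, u x ^ 2 * ((radialBump (D * (1 / 2) ^ k) ‖x‖ ^ 2) ^ 2 * (‖x‖ ^ 2)⁻¹)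
      ≤ ∫ x in tsupport u, u x ^ 2 * (radialBump (D * (1 / 2) ^ k) ‖x‖ ^ 2 * (‖x‖ ^ 2)⁻¹) := by
    refine setIntegral_mono_on (integrableOn_tsupport hc hs (by fun_prop (disch := assumption)))
      (integrableOn_tsupport hc hs (by fun_prop (disch := assumption)))
      (isClosed_tsupport u).measurableSet ?_
    intro x hx
    have hb0 := radialBump_nonneg (h.scale_pos k).le (norm_nonneg x)
    have hb1 := radialBump_le_one (r := ‖x‖) (h.scale_pos k)
    gcongr
    exact pow_le_of_le_one hb0 hb1 two_ne_zero
  replace h1 := (mul_le_mul_of_nonneg_left h6 hX0.le).trans h1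
  have h4 := mul_le_mul hX1 h2 h3 zero_le_one
  have h5 := mul_le_mul_of_nonneg_left h1 (by positivity : 0 ≤ 8 + (n : ℝ) ^ 2)
  linarith

/-- In the mass term, two of the four bump factors turn the weight of the scale into X₁(|x|/3D), by
`logWeight_mul_radialBump_le`; the other two are summable over k, and the X₁² Hardy inequality
concludes. -/
theorem sum_logWeight_sq_mul_localized_energy_le (hu : ContDiff ℝ 1 u) (hc : HasCompactSupport u)
    (hs : tsupport u ⊆ Ω) (N : ℕ) :
    ∑ k ∈ Finset.range N, logWeight (D * (1 / 2) ^ k / (3 * D)) ^ 2 *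
      (2 * (∫ x in tsupport u, radialBump (D * (1 / 2) ^ k) ‖x‖ ^ 2
          * ‖gradient u x - u x • groundField p x‖ ^ 2)
        + (8 + (n : ℝ) ^ 2) * ∫ x in tsupport u,
          u x ^ 2 * ((radialBump (D * (1 / 2) ^ k) ‖x‖ ^ 2) ^ 2 * (‖x‖ ^ 2)⁻¹))
      ≤ (3 + 11 * (8 + (n : ℝ) ^ 2)) *
        ∫ x in tsupport u, ‖gradient u x - u x • groundField p x‖ ^ 2 := by
  have cu := hu.continuous.continuousOn (s := Ω)
  have cg := (continuous_gradient hu).continuousOn (s := Ω)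
  have cE := h.continuousOn_groundField
  have cX := h.continuousOn_logWeight
  have hA := h.norm_sq_ne_zero
  have cb : ∀ k : ℕ, ContinuousOn
      (fun x : EuclideanSpace ℝ (Fin n) => radialBump (D * (1 / 2) ^ k) ‖x‖) Ω :=
    fun k => (continuous_radialBump (h.scale_pos k)).continuousOn
  have hY := h.setIntegral_logWeight_sq_le hu hc hs
  rw [← h.setIntegral_groundField hu hc hs] at hY
  set P := ∫ x in tsupport u, ‖gradient u x - u x • groundField p x‖ ^ 2 with hP
  have hP0 : 0 ≤ P := integral_nonneg fun x => by positivity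
  set c : ℕ → ℝ := fun k => logWeight (D * (1 / 2) ^ k / (3 * D)) with hcdef
  have hc0 : ∀ k, 0 < c k := h.logWeight_scale_pos
  have hc1 : ∀ k, c k ≤ 1 := h.logWeight_scale_le_one
  have i1 : ∀ k : ℕ, IntegrableOn (fun x => radialBump (D * (1 / 2) ^ k) ‖x‖ ^ 2
      * ‖gradient u x - u x • groundField p x‖ ^ 2) (tsupport u) := fun k =>
    have := cb k
    integrableOn_tsupport hc hs (by fun_prop)
  have i2 : ∀ k : ℕ, IntegrableOn (fun x => u x ^ 2 *
      ((radialBump (D * (1 / 2) ^ k) ‖x‖ ^ 2) ^ 2 * (‖x‖ ^ 2)⁻¹)) (tsupport u) := fun k =>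
    have := cb k
    integrableOn_tsupport hc hs (by fun_prop (disch := assumption))
  have h1 : ∑ k ∈ Finset.range N, c k ^ 2 * ∫ x in tsupport u,
      radialBump (D * (1 / 2) ^ k) ‖x‖ ^ 2 * ‖gradient u x - u x • groundField p x‖ ^ 2
      ≤ 4 / 3 * P := by
    simp_rw [← integral_const_mul]
    rw [← integral_finsetSum _ fun k _ => (i1 k).const_mul _, hP, ← integral_const_mul]
    refine setIntegral_mono_on (integrable_finsetSum _ fun k _ => (i1 k).const_mul _)
      (integrableOn_tsupport hc hs (by fun_prop)) (isClosed_tsupport u).measurableSet ?_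
    intro x hx
    simp_rw [← mul_assoc]
    rw [← Finset.sum_mul]
    gcongr
    refine le_trans (Finset.sum_le_sum fun k _ => ?_)
      (sum_radialBump_sq_le h.pos (h.norm_pos (hs hx)) N)
    exact mul_le_of_le_one_left (sq_nonneg _) (pow_le_one₀ (hc0 k).le (hc1 k))
  have h2 : ∑ k ∈ Finset.range N, c k ^ 2 * ∫ x in tsupport u,
      u x ^ 2 * ((radialBump (D * (1 / 2) ^ k) ‖x‖ ^ 2) ^ 2 * (‖x‖ ^ 2)⁻¹)
      ≤ 4 / 3 * ∫ x in tsupport u, u x ^ 2 * (logWeight (‖x‖ / (3 * D)) ^ 2 * (‖x‖ ^ 2)⁻¹) := by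
    simp_rw [← integral_const_mul]
    rw [← integral_finsetSum _ fun k _ => (i2 k).const_mul _]
    refine setIntegral_mono_on (integrable_finsetSum _ fun k _ => (i2 k).const_mul _)
      (integrableOn_tsupport hc hs (by fun_prop (disch := assumption)))
      (isClosed_tsupport u).measurableSet ?_
    intro x hx
    have hxΩ := hs hx
    have hx0 := h.norm_pos hxΩ
    set X := logWeight (‖x‖ / (3 * D))
    have hk : ∀ k ∈ Finset.range N, c k ^ 2 * (u x ^ 2 *
        ((radialBump (D * (1 / 2) ^ k) ‖x‖ ^ 2) ^ 2 * (‖x‖ ^ 2)⁻¹))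
        ≤ u x ^ 2 * (X ^ 2 * (‖x‖ ^ 2)⁻¹) * radialBump (D * (1 / 2) ^ k) ‖x‖ ^ 2 := by
      intro k _
      have hb0 := radialBump_nonneg (h.scale_pos k).le (norm_nonneg x)
      have hle := logWeight_mul_radialBump_le (D := D) (h.scale_pos k)
        (by linarith [h.scale_le k, h.pos]) hx0 (by linarith [h.norm_le x hxΩ, h.pos])
      have hsq := pow_le_pow_left₀ (mul_nonneg (hc0 k).le hb0) hle 2
      calc c k ^ 2 * (u x ^ 2 * ((radialBump (D * (1 / 2) ^ k) ‖x‖ ^ 2) ^ 2 * (‖x‖ ^ 2)⁻¹))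
          = (c k * radialBump (D * (1 / 2) ^ k) ‖x‖) ^ 2 *
            (u x ^ 2 * (‖x‖ ^ 2)⁻¹ * radialBump (D * (1 / 2) ^ k) ‖x‖ ^ 2) := by ring
        _ ≤ X ^ 2 * (u x ^ 2 * (‖x‖ ^ 2)⁻¹ * radialBump (D * (1 / 2) ^ k) ‖x‖ ^ 2) := by gcongr
        _ = _ := by ring
    refine (Finset.sum_le_sum hk).trans ?_
    rw [← Finset.mul_sum, mul_comm]
    gcongr
    exact sum_radialBump_sq_le h.pos hx0 N
  simp_rw [mul_add, mul_left_comm _ (2 : ℝ), mul_left_comm _ (8 + (n : ℝ) ^ 2)]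
  rw [Finset.sum_add_distrib, ← Finset.mul_sum, ← Finset.mul_sum]
  have h3 := mul_le_mul_of_nonneg_left (h2.trans (mul_le_mul_of_nonneg_left hY (by norm_num)))
    (by positivity : 0 ≤ 8 + (n : ℝ) ^ 2)
  have h4 : 0 ≤ (8 + (n : ℝ) ^ 2) * P := by positivity
  linarith

end OutsideLargeBall

end HardySobolev

/-! ### The Hardy-Sobolev inequality -/

section MainInequality

variable {n : ℕ}

/-- Replacing V by n²/(4|x|²) costs at most (1/20)∫u²X₁²/|x|² ≤ (8/20)P, which is less than P/2. -/
theorem OutsideLargeBall.half_energy_le {Ω : Set (EuclideanSpace ℝ (Fin n))}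
    {p : EuclideanSpace ℝ (Fin n)} {D : ℝ} {u : EuclideanSpace ℝ (Fin n) → ℝ}
    (h : OutsideLargeBall Ω p D) (hu : ContDiff ℝ 1 u) (hc : HasCompactSupport u)
    (hs : tsupport u ⊆ Ω) :
    1 / 2 * (∫ x in tsupport u, ‖gradient u x - u x • groundField p x‖ ^ 2)
      ≤ (∫ x in tsupport u, ‖gradient u x‖ ^ 2)
        - (n : ℝ) ^ 2 / 4 * ∫ x in tsupport u, u x ^ 2 / ‖x‖ ^ 2 := by
  have hY := h.setIntegral_logWeight_sq_le hu hc hs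
  have hE := h.setIntegral_groundField hu hc hs
  rw [← hE] at hY
  have cu := hu.continuous.continuousOn (s := Ω)
  have cX := h.continuousOn_logWeight
  have hA := h.norm_sq_ne_zero
  have cV := continuousOn_fieldPotential h.isOpen h.inner_ne_zero (n / 2)
    (contDiffOn_const (c := (0 : ℝ)))
  have i1 := integrableOn_tsupport hc hs (h := fun x => u x ^ 2 * (‖x‖ ^ 2)⁻¹)
    (by fun_prop (disch := assumption))
  have i2 := integrableOn_tsupport hc hs
    (h := fun x => u x ^ 2 * (logWeight (‖x‖ / (3 * D)) ^ 2 * (‖x‖ ^ 2)⁻¹))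
    (by fun_prop (disch := assumption))
  have i3 := integrableOn_tsupport hc hs
    (h := fun x => u x ^ 2 * fieldPotential p (n / 2) (fun _ => 0) x) (by fun_prop)
  have key : (n : ℝ) ^ 2 / 4 * (∫ x in tsupport u, u x ^ 2 * (‖x‖ ^ 2)⁻¹)
      - 1 / 20 * (∫ x in tsupport u, u x ^ 2 * (logWeight (‖x‖ / (3 * D)) ^ 2 * (‖x‖ ^ 2)⁻¹))
      ≤ ∫ x in tsupport u, u x ^ 2 * fieldPotential p (n / 2) (fun _ => 0) x := by
    rw [← integral_const_mul, ← integral_const_mul,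
      ← integral_sub (i1.const_mul _) (i2.const_mul _)]
    refine setIntegral_mono_on ((i1.const_mul _).sub (i2.const_mul _)) i3
      (isClosed_tsupport u).measurableSet ?_
    intro x hx
    have := mul_le_mul_of_nonneg_left (h.hardy_sub_potential_le (hs hx)) (sq_nonneg (u x))
    refine le_trans (le_of_eq ?_) this
    ring
  simp_rw [div_eq_mul_inv (u _ ^ 2)]
  have hP0 : 0 ≤ ∫ x in tsupport u, ‖gradient u x - u x • groundField p x‖ ^ 2 :=
    integral_nonneg fun x => by positivity
  linarith

/-- The support of a test function stays away from the origin, so finitely many dyadic scales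
suffice. -/
theorem exists_pow_half_lt_norm {K : Set (EuclideanSpace ℝ (Fin n))} (hK : IsClosed K)
    (h0 : (0 : EuclideanSpace ℝ (Fin n)) ∉ K) (D : ℝ) :
    ∃ N : ℕ, ∀ x ∈ K, D * (1 / 2) ^ N < ‖x‖ := by
  obtain ⟨ε, hε, hball⟩ := Metric.isOpen_iff.1 hK.isOpen_compl 0 h0
  have ht : Filter.Tendsto (fun N : ℕ => D * (1 / 2 : ℝ) ^ N) Filter.atTop (nhds (D * 0)) :=
    (tendsto_pow_atTop_nhds_zero_of_lt_one (by norm_num) (by norm_num)).const_mul D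
  rw [mul_zero] at ht
  obtain ⟨N, hN⟩ := (ht.eventually (gt_mem_nhds hε)).exists
  refine ⟨N, fun x hx => ?_⟩
  by_contra hcon
  refine hball (a := x) ?_ hx
  rw [mem_ball_zero_iff]
  exact (not_lt.1 hcon).trans_lt hN

theorem exists_hardySobolev_const (hn : 3 ≤ n) : ∃ C : ℝ, 0 < C ∧
    ∀ (Ω : Set (EuclideanSpace ℝ (Fin n))) (p : EuclideanSpace ℝ (Fin n)) (D : ℝ)
      (u : EuclideanSpace ℝ (Fin n) → ℝ), OutsideLargeBall Ω p D → ContDiff ℝ 1 u →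
      HasCompactSupport u → tsupport u ⊆ Ω →
      (n : ℝ) ^ 2 / 4 * (∫ x in tsupport u, u x ^ 2 / ‖x‖ ^ 2)
        + C * (∫ x in tsupport u, logWeight (‖x‖ / (3 * D)) ^ ((2 * (n : ℝ) - 2) / ((n : ℝ) - 2))
          * |u x| ^ (2 * (n : ℝ) / ((n : ℝ) - 2))) ^ (((n : ℝ) - 2) / n)
      ≤ ∫ x in tsupport u, ‖gradient u x‖ ^ 2 := by
  have hn' : (3 : ℝ) ≤ n := by exact_mod_cast hn
  have hn2 : 0 < (n : ℝ) - 2 := by linarith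
  obtain ⟨S, hS, hsob⟩ := exists_sobolev_const hn
  set m : ℝ := n / (n - 2) with hm
  set q : ℝ := 2 * (n : ℝ) / ((n : ℝ) - 2) with hq
  have hm1 : 1 < m := by rw [hm, one_lt_div hn2]; linarith
  have hm0 : 0 < m := by linarith
  have hq0 : 0 < q := div_pos (by linarith) hn2
  have hme : (2 * (n : ℝ) - 2) / ((n : ℝ) - 2) = m + 1 := by rw [hm]; field_simp; ring
  have hmi : ((n : ℝ) - 2) / n = m⁻¹ := by rw [hm, inv_div]
  rw [hme, hmi]
  rw [hmi] at hsob
  set M₁ : ℝ := S * (2 + 9 * (8 + (n : ℝ) ^ 2)) with hM₁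
  set M₂ : ℝ := S * (3 + 11 * (8 + (n : ℝ) ^ 2)) with hM₂
  have hM₁0 : 0 < M₁ := by positivity
  have hM₂0 : 0 < M₂ := by positivity
  set K : ℝ := (25 / 4) ^ q * (M₁ ^ (m - 1) * M₂) with hK
  have hK0 : 0 < K := by positivity
  -- The Sobolev term is at most K^(1/m) P, and only P/2 is available.
  refine ⟨(2 * K ^ m⁻¹)⁻¹, by positivity, fun Ω p D u h hu hc hs => ?_⟩
  have hhalf := h.half_energy_le hu hc hs
  set P := ∫ x in tsupport u, ‖gradient u x - u x • groundField p x‖ ^ 2 with hP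
  have hP0 : 0 ≤ P := integral_nonneg fun x => by positivity
  have h0 : (0 : EuclideanSpace ℝ (Fin n)) ∉ tsupport u := fun h0 => by
    simpa using h.norm_pos (hs h0)
  obtain ⟨N, hN⟩ := exists_pow_half_lt_norm (isClosed_tsupport u) h0 D
  have hsum := h.setIntegral_logWeight_rpow_le hu hc hs hN (a := m + 1) (q := q) (by linarith) hq0
  set b : ℕ → ℝ := fun k => S * (2 * (∫ x in tsupport u, radialBump (D * (1 / 2) ^ k) ‖x‖ ^ 2
          * ‖gradient u x - u x • groundField p x‖ ^ 2)
        + (8 + (n : ℝ) ^ 2) * ∫ x in tsupport u,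
          u x ^ 2 * ((radialBump (D * (1 / 2) ^ k) ‖x‖ ^ 2) ^ 2 * (‖x‖ ^ 2)⁻¹)) with hb
  have hb0 : ∀ k, 0 ≤ b k := fun k => by
    have t1 : 0 ≤ ∫ x in tsupport u, radialBump (D * (1 / 2) ^ k) ‖x‖ ^ 2
          * ‖gradient u x - u x • groundField p x‖ ^ 2 := integral_nonneg fun x => by positivity
    have t2 : 0 ≤ ∫ x in tsupport u, u x ^ 2 *
        ((radialBump (D * (1 / 2) ^ k) ‖x‖ ^ 2) ^ 2 * (‖x‖ ^ 2)⁻¹) :=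
      integral_nonneg fun x => by positivity
    positivity
  have hloc : ∀ k, ∫ x, |u x * radialBump (D * (1 / 2) ^ k) ‖x‖ ^ 2| ^ q ≤ b k ^ m := by
    intro k
    have hw := hsob (fun x => u x * radialBump (D * (1 / 2) ^ k) ‖x‖ ^ 2)
      (hu.mul (contDiff_radialBump_sq (h.scale_pos k))) hc.mul_right
    have hw2 := hw.trans (mul_le_mul_of_nonneg_left
      (h.integral_norm_gradient_radialBump_mul_le hu hc hs (h.scale_pos k)) hS.le)
    have hI : 0 ≤ ∫ x, |u x * radialBump (D * (1 / 2) ^ k) ‖x‖ ^ 2| ^ q :=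
      integral_nonneg fun x => by positivity
    have := Real.rpow_le_rpow (by positivity) hw2 hm0.le
    rwa [← Real.rpow_mul hI, inv_mul_cancel₀ hm0.ne', Real.rpow_one] at this
  have h1 : ∀ k ∈ Finset.range N, logWeight (D * (1 / 2) ^ k / (3 * D)) * b k ≤ M₁ * P := by
    intro k _
    have := mul_le_mul_of_nonneg_left (h.logWeight_mul_localized_energy_le hu hc hs k) hS.le
    rw [hb, hM₁]
    linarith
  have h2 : ∑ k ∈ Finset.range N, logWeight (D * (1 / 2) ^ k / (3 * D)) ^ 2 * b k ≤ M₂ * P := by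
    have := mul_le_mul_of_nonneg_left (h.sum_logWeight_sq_mul_localized_energy_le hu hc hs N) hS.le
    rw [Finset.mul_sum] at this
    simp_rw [hb, mul_left_comm _ S]
    rw [hM₂]
    linarith
  have h3 := sum_rpow_mul_rpow_le hm1 (fun k _ => h.logWeight_scale_pos k) (fun k _ => hb0 k) h1 h2
    (by positivity)
  have h4 : (∫ x in tsupport u, logWeight (‖x‖ / (3 * D)) ^ (m + 1) * |u x| ^ q) ≤ K * P ^ m := by
    refine hsum.trans ?_
    have e : K * P ^ m = (25 / 4) ^ q * ((M₁ * P) ^ (m - 1) * (M₂ * P)) := by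
      rw [hK, Real.mul_rpow hM₁0.le hP0]
      have : P ^ m = P ^ (m - 1) * P := by
        conv_lhs => rw [show m = (m - 1) + 1 by ring]
        rw [Real.rpow_add_one' hP0 (by linarith)]
      rw [this]
      ring
    rw [e]
    refine mul_le_mul_of_nonneg_left (le_trans (Finset.sum_le_sum fun k _ => ?_) h3) (by positivity)
    exact mul_le_mul_of_nonneg_left (hloc k) (Real.rpow_nonneg (h.logWeight_scale_pos k).le _)
  have h5 : (∫ x in tsupport u, logWeight (‖x‖ / (3 * D)) ^ (m + 1) * |u x| ^ q) ^ m⁻¹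
      ≤ K ^ m⁻¹ * P := by
    have hI : 0 ≤ ∫ x in tsupport u, logWeight (‖x‖ / (3 * D)) ^ (m + 1) * |u x| ^ q := by
      refine setIntegral_nonneg (isClosed_tsupport u).measurableSet fun x hx => ?_
      have := logWeight_pos (h.ratio_pos (hs hx)) (h.ratio_le_one (hs hx))
      positivity
    refine (Real.rpow_le_rpow hI h4 (by positivity)).trans (le_of_eq ?_)
    rw [Real.mul_rpow hK0.le (by positivity), ← Real.rpow_mul hP0, mul_inv_cancel₀ hm0.ne',
      Real.rpow_one]
  have h6 := mul_le_mul_of_nonneg_left h5 (by positivity : 0 ≤ (2 * K ^ m⁻¹)⁻¹)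
  have h7 : (2 * K ^ m⁻¹)⁻¹ * (K ^ m⁻¹ * P) = 1 / 2 * P := by
    have : K ^ m⁻¹ ≠ 0 := by positivity
    field_simp
  linarith

theorem norm_le_supNorm {Ω : Set (EuclideanSpace ℝ (Fin n))} (hb : Bornology.IsBounded Ω)
    {x : EuclideanSpace ℝ (Fin n)} (hx : x ∈ Ω) : ‖x‖ ≤ supNorm Ω := by
  obtain ⟨R, hR⟩ := hb.exists_norm_le
  exact le_csSup ⟨R, by rintro _ ⟨y, hy, rfl⟩; exact hR y hy⟩ ⟨x, hx, rfl⟩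

theorem zero_notMem_of_mem_frontier {Ω : Set (EuclideanSpace ℝ (Fin n))} (ho : IsOpen Ω)
    (h0 : 0 ∈ frontier Ω) : (0 : EuclideanSpace ℝ (Fin n)) ∉ Ω := fun h => by
  rw [ho.frontier_eq] at h0
  exact h0.2 h

theorem supNorm_pos {Ω : Set (EuclideanSpace ℝ (Fin n))} (ho : IsOpen Ω)
    (hb : Bornology.IsBounded Ω) (h0 : 0 ∈ frontier Ω) : 0 < supNorm Ω := by
  obtain ⟨x, hx⟩ : Ω.Nonempty := closure_nonempty_iff.1 ⟨0, frontier_subset_closure h0⟩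
  have hx0 : x ≠ 0 := fun h => zero_notMem_of_mem_frontier ho h0 (h ▸ hx)
  exact (norm_pos_iff.2 hx0).trans_le (norm_le_supNorm hb hx)

theorem outsideLargeBall_of_exteriorBall (hn : 1 ≤ n) {Ω : Set (EuclideanSpace ℝ (Fin n))} {ρ : ℝ}
    (ho : IsOpen Ω) (hb : Bornology.IsBounded Ω) (h0 : 0 ∈ frontier Ω)
    (hext : HasExteriorBallAtZero Ω ρ) (hρ : supNorm Ω / (1 / (500 * (n : ℝ) ^ 2)) ≤ ρ) :
    ∃ p, OutsideLargeBall Ω p (supNorm Ω) := by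
  obtain ⟨hρ0, c, hc, hball⟩ := hext
  -- For p = 2c, ⟨x, x - p⟩ = |x - c|² - ρ² and |p| = 2ρ; σ = 1/(500n²) is chosen so that 2ρ ≥
  -- 1000n²D.
  refine ⟨(2 : ℝ) • c, ho, fun x hx => ?_, fun x hx => norm_le_supNorm hb hx,
    supNorm_pos ho hb h0, ?_, hn⟩
  · have hxc : ρ < ‖x - c‖ := by
      by_contra hcon
      -- An open set that misses the open ball also misses its closure, whence the strict
      -- inequality.
      have hmem : x ∈ closure (Metric.ball c ρ) := by
        rw [closure_ball c hρ0.ne', Metric.mem_closedBall, dist_eq_norm]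
        exact not_lt.1 hcon
      obtain ⟨y, hy1, hy2⟩ := mem_closure_iff.1 hmem Ω ho hx
      exact hball hy2 (subset_closure hy1)
    have h1 := norm_sub_sq_real x c
    rw [inner_sub_right, inner_smul_right, real_inner_self_eq_norm_sq]
    rw [hc] at h1
    nlinarith
  · rw [norm_smul, hc, Real.norm_eq_abs, abs_two]
    rw [div_div_eq_mul_div, div_one] at hρ
    linarith

theorem hardySobolevInequality_of_setIntegral_tsupport {Ω : Set (EuclideanSpace ℝ (Fin n))}
    {a C : ℝ} (hn : 3 ≤ n)
    (h : ∀ u : EuclideanSpace ℝ (Fin n) → ℝ, IsTestFunctionOn Ω u →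
      (n : ℝ) ^ 2 / 4 * (∫ x in tsupport u, u x ^ 2 / ‖x‖ ^ 2)
        + C * (∫ x in tsupport u, logWeight (‖x‖ / (3 * supNorm Ω)) ^ a
          * |u x| ^ (2 * (n : ℝ) / ((n : ℝ) - 2))) ^ (((n : ℝ) - 2) / n)
      ≤ ∫ x in tsupport u, ‖gradient u x‖ ^ 2) :
    HardySobolevInequality Ω a C := by
  intro u hu
  have hn' : (3 : ℝ) ≤ n := by exact_mod_cast hn
  have hq : 2 * (n : ℝ) / ((n : ℝ) - 2) ≠ 0 := (div_pos (by linarith) (by linarith)).ne'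
  have hext : ∀ f : EuclideanSpace ℝ (Fin n) → ℝ, (∀ x ∉ tsupport u, f x = 0) →
      ∫ x in Ω, f x = ∫ x in tsupport u, f x := by
    intro f hf
    rw [setIntegral_eq_integral_of_forall_compl_eq_zero hf,
      setIntegral_eq_integral_of_forall_compl_eq_zero fun x hx => hf x fun hx' => hx (hu.2.2 hx')]
  rw [hext _ fun x hx => by simp [gradient_eq_zero_of_notMem_tsupport hx],
    hext _ fun x hx => by simp [image_eq_zero_of_notMem_tsupport hx],
    hext _ fun x hx => by simp [image_eq_zero_of_notMem_tsupport hx, Real.zero_rpow hq]]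
  exact h u hu

end MainInequality

/-! ### Ground state of an interior ball -/

section InteriorGroundState

variable {n : ℕ}

theorem setIntegral_eq_setIntegral_of_forall_notMem {α : Type*} [MeasurableSpace α] {μ : Measure α}
    {f : α → ℝ} {K s t : Set α} (hs : K ⊆ s) (ht : K ⊆ t) (hf : ∀ x ∉ K, f x = 0) :
    ∫ x in s, f x ∂μ = ∫ x in t, f x ∂μ := by
  rw [setIntegral_eq_integral_of_forall_compl_eq_zero fun x hx => hf x fun hx' => hx (hs hx'),
    setIntegral_eq_integral_of_forall_compl_eq_zero fun x hx => hf x fun hx' => hx (ht hx')]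

/-- The ground state of the ball with diameter `[0, p]`. -/
noncomputable def ballGroundState (p x : EuclideanSpace ℝ (Fin n)) : ℝ :=
  -inner ℝ x (x - p) * (‖x‖ ^ 2) ^ (-(n : ℝ) / 4)

theorem contDiffOn_ballGroundState (p : EuclideanSpace ℝ (Fin n)) {k : WithTop ℕ∞} :
    ContDiffOn ℝ k (ballGroundState p) {0}ᶜ := by
  refine ContDiffOn.mul ?_ (ContDiffOn.rpow_const_of_ne ?_ ?_)
  · exact (contDiff_id.inner ℝ (contDiff_id.sub contDiff_const)).neg.contDiffOn
  · exact (contDiff_id.norm_sq ℝ).contDiffOn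
  · intro x hx
    have : x ≠ 0 := hx
    positivity

theorem gradient_ballGroundState {p x : EuclideanSpace ℝ (Fin n)} (hd : inner ℝ x (x - p) ≠ 0) :
    gradient (ballGroundState p) x = ballGroundState p x •
      (fieldCoeffZero p (fun _ => 0) x • x + fieldCoeffPole p 0 x • (x - p)) := by
  have hx : x ≠ 0 := by rintro rfl; simp at hd
  have hA : 0 < ‖x‖ ^ 2 := by positivity
  have h1 := (hasFDerivAt_inner_sub p x).neg
  have h2 := (hasFDerivAt_normSq 0 x).rpow_const (p := -(n : ℝ) / 4)
    (Or.inl (by rw [sub_zero]; exact hA.ne'))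
  have h3 := h1.mul h2
  have e : ballGroundState p = (-fun y => inner ℝ y (y - p)) *
      fun y : EuclideanSpace ℝ (Fin n) => (‖y - 0‖ ^ 2) ^ (-(n : ℝ) / 4) := by
    funext y; simp [ballGroundState]
  refine ext_inner_right ℝ fun v => ?_
  rw [inner_gradient_left, e, h3.fderiv, ← e]
  simp only [sub_zero, add_apply, smul_apply, neg_apply, Pi.neg_apply, innerSL_apply_apply, smul_eq_mul,
    nsmul_eq_mul, ballGroundState, inner_smul_left, inner_add_left, fieldCoeffZero, fieldCoeffPole,
    conj_trivial]
  rw [Real.rpow_sub_one hA.ne']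
  generalize inner ℝ x (x - p) = d at *
  generalize (‖x‖ ^ 2) ^ (-(n : ℝ) / 4) = Y
  generalize ‖x‖ ^ 2 = A at *
  have := hA.ne'
  push_cast
  field_simp
  ring

theorem inner_sub_neg_of_mem_ball {c x : EuclideanSpace ℝ (Fin n)} {r : ℝ} (hc : ‖c‖ = r)
    (hx : x ∈ Metric.ball c r) : inner ℝ x (x - (2 : ℝ) • c) < 0 := by
  rw [Metric.mem_ball, dist_eq_norm] at hx
  have h1 := norm_sub_sq_real x c
  rw [inner_sub_right, inner_smul_right, real_inner_self_eq_norm_sq]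
  rw [hc] at h1
  nlinarith [norm_nonneg (x - c)]

theorem zero_notMem_ball {c : EuclideanSpace ℝ (Fin n)} {r : ℝ} (hc : ‖c‖ = r) :
    (0 : EuclideanSpace ℝ (Fin n)) ∉ Metric.ball c r := by
  simp [hc]

/-- The Hardy-Sobolev inequality in terms of the quotient by the ground state of a ball. -/
theorem HardySobolevInequality.le_of_isTestFunctionOn_ball (hn : 3 ≤ n)
    {Ω : Set (EuclideanSpace ℝ (Fin n))} {a C r : ℝ} {c : EuclideanSpace ℝ (Fin n)}
    (h : HardySobolevInequality Ω a C) (hc : ‖c‖ = r) (hB : Metric.ball c r ⊆ Ω)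
    {w : EuclideanSpace ℝ (Fin n) → ℝ} (hw : IsTestFunctionOn (Metric.ball c r) w) :
    C * (∫ x in Metric.ball c r, logWeight (‖x‖ / (3 * supNorm Ω)) ^ a
        * |w x * ballGroundState ((2 : ℝ) • c) x| ^ (2 * (n : ℝ) / ((n : ℝ) - 2)))
          ^ (((n : ℝ) - 2) / n)
      ≤ (∫ x in Metric.ball c r, ballGroundState ((2 : ℝ) • c) x ^ 2 * ‖gradient w x‖ ^ 2)
        + ∫ x in Metric.ball c r, (w x * ballGroundState ((2 : ℝ) • c) x) ^ 2
          * (-n * (inner ℝ x (x - (2 : ℝ) • c))⁻¹) := by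
  obtain ⟨hw1, hwc, hws⟩ := hw
  set B := Metric.ball c r with hBdef
  set p := (2 : ℝ) • c with hp
  set φ := ballGroundState p with hφ
  have hn' : (3 : ℝ) ≤ n := by exact_mod_cast hn
  have hq : 2 * (n : ℝ) / ((n : ℝ) - 2) ≠ 0 := (div_pos (by linarith) (by linarith)).ne'
  have hBo : IsOpen B := Metric.isOpen_ball
  have hB0 : B ⊆ {0}ᶜ := fun x hx h0 => zero_notMem_ball hc (by rwa [← Set.mem_singleton_iff.1 h0])
  have hd : ∀ x ∈ B, inner ℝ x (x - p) ≠ 0 := fun x hx => (inner_sub_neg_of_mem_ball hc hx).ne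
  have hA : ∀ x ∈ B, ‖x‖ ^ 2 ≠ 0 := fun x hx => by
    have : x ≠ 0 := hB0 hx
    positivity
  set u : EuclideanSpace ℝ (Fin n) → ℝ := fun x => w x * φ x with hu
  have hu1 : ContDiff ℝ ∞ u :=
    contDiff_mul_of_tsupport_subset hBo hw1 hws ((contDiffOn_ballGroundState p).mono hB0)
  have huc : HasCompactSupport u := hwc.mul_right
  have huw : tsupport u ⊆ tsupport w := tsupport_mul_subset_left
  have hus : tsupport u ⊆ B := huw.trans hws
  have hu2 : ContDiff ℝ 1 u := hu1.of_le (by exact_mod_cast le_top)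
  have hw2 : ContDiff ℝ 1 w := hw1.of_le (by exact_mod_cast le_top)
  have hineq := h u ⟨hu1, huc, hus.trans hB⟩
  have hu0 : ∀ x ∉ tsupport u, u x = 0 := fun x hx => image_eq_zero_of_notMem_tsupport hx
  have hg0 : ∀ x ∉ tsupport u, gradient u x = 0 :=
    fun x hx => gradient_eq_zero_of_notMem_tsupport hx
  have hΩB : ∀ f : EuclideanSpace ℝ (Fin n) → ℝ, (∀ x ∉ tsupport u, f x = 0) →
      ∫ x in Ω, f x = ∫ x in B, f x := fun f hf =>
    setIntegral_eq_setIntegral_of_forall_notMem (hus.trans hB) hus hf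
  have huB : ∀ f : EuclideanSpace ℝ (Fin n) → ℝ, (∀ x ∉ tsupport u, f x = 0) →
      ∫ x in tsupport u, f x = ∫ x in B, f x := fun f hf =>
    setIntegral_eq_setIntegral_of_forall_notMem subset_rfl hus hf
  rw [hΩB _ fun x hx => by simp [hg0 x hx], hΩB _ fun x hx => by simp [hu0 x hx],
    hΩB _ fun x hx => by simp [hu0 x hx, Real.zero_rpow hq]] at hineq
  have hE := setIntegral_norm_gradient_sub_field_sq hBo hd hu2 huc hus 0
    (contDiffOn_const (c := (0 : ℝ)))
  rw [huB _ fun x hx => by simp [hg0 x hx, hu0 x hx], huB _ fun x hx => by simp [hg0 x hx]] at hE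
  have cu := hu2.continuous.continuousOn (s := B)
  have cd : ContinuousOn (fun x : EuclideanSpace ℝ (Fin n) => inner ℝ x (x - p)) B := by fun_prop
  have i1 := integrableOn_tsupport huc hus (h := fun x => u x ^ 2 / ‖x‖ ^ 2)
    (by fun_prop (disch := assumption))
  have i2 := integrableOn_tsupport huc hus (h := fun x => u x ^ 2 * (-n * (inner ℝ x (x - p))⁻¹))
    (by fun_prop (disch := assumption))
  -- For κ = 0 and γ = 0 the potential is n²/(4|x|²) - n/d. Since d < 0 in the ball, the second term
  -- is positive and enters the upper bound as an error.
  have hV : ∫ x in tsupport u, u x ^ 2 * fieldPotential p 0 (fun _ => 0) x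
      = (n : ℝ) ^ 2 / 4 * (∫ x in B, u x ^ 2 / ‖x‖ ^ 2)
        + ∫ x in B, u x ^ 2 * (-n * (inner ℝ x (x - p))⁻¹) := by
    rw [← huB _ fun x hx => by simp [hu0 x hx], ← huB _ fun x hx => by simp [hu0 x hx],
      ← integral_const_mul, ← integral_add (i1.const_mul _) i2]
    refine integral_congr_ae (Filter.Eventually.of_forall fun x => ?_)
    simp [fieldPotential]
    ring
  have hφw : ∫ x in B, ‖gradient u x - u x •
      (fieldCoeffZero p (fun _ => 0) x • x + fieldCoeffPole p 0 x • (x - p))‖ ^ 2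
      = ∫ x in B, φ x ^ 2 * ‖gradient w x‖ ^ 2 := by
    refine setIntegral_congr_fun hBo.measurableSet fun x hx => ?_
    have hφx : DifferentiableAt ℝ φ x :=
      (((contDiffOn_ballGroundState p (k := 1)).mono hB0).contDiffAt
        (hBo.mem_nhds hx)).differentiableAt (by norm_num)
    have : gradient u x - u x •
      (fieldCoeffZero p (fun _ => 0) x • x + fieldCoeffPole p 0 x • (x - p))
        = φ x • gradient w x := by
      rw [hu, gradient_mul (hw2.differentiable (by norm_num) x) hφx,
        gradient_ballGroundState (hd x hx)]
      module
    simp only [this, norm_smul, mul_pow, Real.norm_eq_abs, sq_abs]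
  rw [hφw, hV] at hE
  linarith

/-- The weight lies in (0, 1] on Ω, so a larger exponent makes the inequality weaker. This reduces
sharpness to nonnegative exponents. -/
theorem HardySobolevInequality.mono_exponent {Ω : Set (EuclideanSpace ℝ (Fin n))} {a b C : ℝ}
    (h : HardySobolevInequality Ω a C) (hn : 3 ≤ n) (hC : 0 ≤ C) (ho : IsOpen Ω)
    (hb : Bornology.IsBounded Ω) (h0 : 0 ∈ frontier Ω) (hab : a ≤ b) :
    HardySobolevInequality Ω b C := by
  intro u hu
  have hn' : (3 : ℝ) ≤ n := by exact_mod_cast hn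
  have hq : 0 < 2 * (n : ℝ) / ((n : ℝ) - 2) := div_pos (by linarith) (by linarith)
  have hD := supNorm_pos ho hb h0
  have hx0 : ∀ x ∈ Ω, 0 < ‖x‖ := fun x hx => norm_pos_iff.2 fun h' =>
    zero_notMem_of_mem_frontier ho h0 (h' ▸ hx)
  have hs0 : ∀ x ∈ Ω, 0 < ‖x‖ / (3 * supNorm Ω) := fun x hx => div_pos (hx0 x hx) (by linarith)
  have hs1 : ∀ x ∈ Ω, ‖x‖ / (3 * supNorm Ω) ≤ 1 := fun x hx => by
    rw [div_le_one (by linarith)]; linarith [norm_le_supNorm hb hx]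
  have cX : ContinuousOn (fun x => logWeight (‖x‖ / (3 * supNorm Ω))) Ω := by
    unfold logWeight
    refine continuousOn_const.div (continuousOn_const.sub (ContinuousOn.log (by fun_prop)
      fun x hx => (hs0 x hx).ne')) fun x hx => ?_
    linarith [Real.log_nonpos (hs0 x hx).le (hs1 x hx)]
  have cu := hu.1.continuous.continuousOn (s := Ω)
  have int : ∀ t : ℝ, IntegrableOn (fun x => logWeight (‖x‖ / (3 * supNorm Ω)) ^ t
      * |u x| ^ (2 * (n : ℝ) / ((n : ℝ) - 2))) (tsupport u) := fun t =>
    integrableOn_tsupport hu.2.1 hu.2.2 ((cX.rpow_const fun x hx =>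
      Or.inl (logWeight_pos (hs0 x hx) (hs1 x hx)).ne').mul
      (cu.abs.rpow_const fun x _ => Or.inr hq.le))
  have hΩ : ∀ t : ℝ, ∫ x in Ω, logWeight (‖x‖ / (3 * supNorm Ω)) ^ t
      * |u x| ^ (2 * (n : ℝ) / ((n : ℝ) - 2)) = ∫ x in tsupport u,
      logWeight (‖x‖ / (3 * supNorm Ω)) ^ t * |u x| ^ (2 * (n : ℝ) / ((n : ℝ) - 2)) := fun t =>
    setIntegral_eq_setIntegral_of_forall_notMem hu.2.2 subset_rfl fun x hx => by
      simp [image_eq_zero_of_notMem_tsupport hx, Real.zero_rpow hq.ne']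
  have h1 := h u hu
  rw [hΩ] at h1 ⊢
  have hle : ∫ x in tsupport u, logWeight (‖x‖ / (3 * supNorm Ω)) ^ b
      * |u x| ^ (2 * (n : ℝ) / ((n : ℝ) - 2)) ≤ ∫ x in tsupport u,
      logWeight (‖x‖ / (3 * supNorm Ω)) ^ a * |u x| ^ (2 * (n : ℝ) / ((n : ℝ) - 2)) := by
    refine setIntegral_mono_on (int b) (int a) (isClosed_tsupport u).measurableSet fun x hx => ?_
    have hxΩ := hu.2.2 hx
    refine mul_le_mul_of_nonneg_right ?_ (by positivity)
    exact Real.rpow_le_rpow_of_exponent_ge (logWeight_pos (hs0 x hxΩ) (hs1 x hxΩ))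
      (logWeight_le_one (hs0 x hxΩ) (hs1 x hxΩ)) hab
  have hI : 0 ≤ ∫ x in tsupport u, logWeight (‖x‖ / (3 * supNorm Ω)) ^ b
      * |u x| ^ (2 * (n : ℝ) / ((n : ℝ) - 2)) := by
    refine setIntegral_nonneg (isClosed_tsupport u).measurableSet fun x hx => ?_
    have := logWeight_pos (hs0 x (hu.2.2 hx)) (hs1 x (hu.2.2 hx))
    positivity
  have := mul_le_mul_of_nonneg_left (Real.rpow_le_rpow hI hle
    (div_nonneg (by linarith) (by linarith) : 0 ≤ ((n : ℝ) - 2) / n)) hC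
  linarith

end InteriorGroundState

/-! ### Removing the cutoff at the boundary sphere -/

section BoundaryCutoff

variable {n : ℕ}

theorem integrable_of_continuousOn_compl_zero {K : Set (EuclideanSpace ℝ (Fin n))}
    (hK : IsCompact K) (h0 : (0 : EuclideanSpace ℝ (Fin n)) ∉ K)
    {h : EuclideanSpace ℝ (Fin n) → ℝ} (hc : ContinuousOn h {0}ᶜ) (hz : ∀ x ∉ K, h x = 0) :
    Integrable h := by
  have h1 : IntegrableOn h K :=
    (hc.mono fun x hx h' => h0 (by rwa [← Set.mem_singleton_iff.1 h'])).integrableOn_compact hK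
  refine (integrableOn_iff_integrable_of_support_subset ?_).1 h1
  intro x hx
  by_contra hcon
  exact hx (hz x hcon)

theorem deriv_smoothTransition_eq_zero {s : ℝ} (hs : s < 0 ∨ 1 < s) :
    deriv Real.smoothTransition s = 0 := by
  rcases hs with hs | hs
  · have : Real.smoothTransition =ᶠ[nhds s] fun _ => 0 := by
      filter_upwards [Iio_mem_nhds hs] with y hy
      exact Real.smoothTransition.zero_of_nonpos (le_of_lt hy)
    rw [this.deriv_eq]; simp
  · have : Real.smoothTransition =ᶠ[nhds s] fun _ => 1 := by
      filter_upwards [Ioi_mem_nhds hs] with y hy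
      exact Real.smoothTransition.one_of_one_le (le_of_lt hy)
    rw [this.deriv_eq]; simp

theorem contDiff_smoothTransition : ContDiff ℝ ∞ Real.smoothTransition :=
  Real.smoothTransition.contDiff

/-- The factor s = tδ combines the first-order vanishing of the ground state in δ = -⟨x, x - p⟩ with
the slope t of the cutoff; the derivative lives on 1 ≤ s ≤ 2. -/
theorem exists_bound_mul_deriv_smoothTransition :
    ∃ M : ℝ, ∀ s : ℝ, |s * deriv Real.smoothTransition (s - 1)| ≤ M := by
  have hc : Continuous (deriv Real.smoothTransition) :=
    contDiff_smoothTransition.continuous_deriv (by exact_mod_cast le_top)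
  have hc2 : ContinuousOn (fun s => s * deriv Real.smoothTransition (s - 1)) (Set.Icc 1 2) := by
    fun_prop
  obtain ⟨M, hM⟩ := isCompact_Icc.exists_bound_of_continuousOn hc2
  refine ⟨max M 0, fun s => ?_⟩
  by_cases hs : s ∈ Set.Icc (1 : ℝ) 2
  · exact (hM s hs).trans (le_max_left _ _)
  · rw [deriv_smoothTransition_eq_zero, mul_zero, abs_zero]
    · exact le_max_right _ _
    · rw [Set.mem_Icc, not_and_or, not_le, not_le] at hs
      rcases hs with hs | hs
      · left; linarith
      · right; linarith

/-- Cutoff equal to `0` outside the ball with diameter `[0, p]` and to `1` away from its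
boundary. -/
noncomputable def ballCutoff (p : EuclideanSpace ℝ (Fin n)) (t : ℝ)
    (x : EuclideanSpace ℝ (Fin n)) : ℝ :=
  Real.smoothTransition (t * -inner ℝ x (x - p) - 1)

theorem contDiff_ballCutoff (p : EuclideanSpace ℝ (Fin n)) (t : ℝ) :
    ContDiff ℝ ∞ (ballCutoff p t) := by
  refine contDiff_smoothTransition.comp ?_
  exact (contDiff_const.mul (contDiff_id.inner ℝ (contDiff_id.sub contDiff_const)).neg).sub
    contDiff_const

theorem norm_gradient_ballCutoff (p x : EuclideanSpace ℝ (Fin n)) (t : ℝ) :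
    ‖gradient (ballCutoff p t) x‖
      = |t * deriv Real.smoothTransition (t * -inner ℝ x (x - p) - 1)| * ‖x + (x - p)‖ := by
  have h1 := (((hasFDerivAt_inner_sub p x).neg).const_mul t).sub_const 1
  have h2 : HasDerivAt Real.smoothTransition
      (deriv Real.smoothTransition (t * -inner ℝ x (x - p) - 1)) (t * -inner ℝ x (x - p) - 1) :=
    ((contDiff_smoothTransition.differentiable (by simp)) _).hasDerivAt
  have h3 : HasFDerivAt (ballCutoff p t) _ x := h2.comp_hasFDerivAt x h1
  rw [gradient, LinearIsometryEquiv.norm_map, h3.fderiv, norm_smul, norm_smul, norm_neg,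
    innerSL_apply_norm, Real.norm_eq_abs, Real.norm_eq_abs, ← mul_assoc, ← abs_mul,
    mul_comm (deriv _ _) t]

theorem isTestFunctionOn_mul_ballCutoff {c : EuclideanSpace ℝ (Fin n)} {r t : ℝ} (hc : ‖c‖ = r)
    (hr : 0 < r) (ht : 0 < t) {f : EuclideanSpace ℝ (Fin n) → ℝ} (hf : ContDiff ℝ ∞ f)
    (hfc : HasCompactSupport f) :
    IsTestFunctionOn (Metric.ball c r) (fun x => f x * ballCutoff ((2 : ℝ) • c) t x) := by
  refine ⟨hf.mul (contDiff_ballCutoff _ _), hfc.mul_right, tsupport_mul_subset_right.trans ?_⟩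
  have hcl : IsClosed {x : EuclideanSpace ℝ (Fin n) | 1 ≤ t * -inner ℝ x (x - (2 : ℝ) • c)} :=
    isClosed_le continuous_const (by fun_prop)
  have hsub : tsupport (ballCutoff ((2 : ℝ) • c) t) ⊆ {x : EuclideanSpace ℝ (Fin n) |
      1 ≤ t * -inner ℝ x (x - (2 : ℝ) • c)} := by
    refine closure_minimal (fun x hx => ?_) hcl
    by_contra hcon
    rw [Set.mem_ofPred_eq, not_le] at hcon
    exact hx (Real.smoothTransition.zero_of_nonpos (by linarith))
  refine hsub.trans fun x hx => ?_
  have h2 : 0 < -inner ℝ x (x - (2 : ℝ) • c) := by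
    by_contra hcon
    have := mul_nonpos_of_nonneg_of_nonpos ht.le (not_lt.1 hcon)
    have hx' : 1 ≤ t * -inner ℝ x (x - (2 : ℝ) • c) := hx
    linarith
  have h1 := norm_sub_sq_real x c
  rw [inner_sub_right, inner_smul_right, real_inner_self_eq_norm_sq] at h2
  rw [hc] at h1
  rw [Metric.mem_ball, dist_eq_norm]
  nlinarith [norm_nonneg (x - c)]

theorem tendsto_natCast_add_one_mul {δ : ℝ} (hδ : 0 < δ) :
    ∀ᶠ j : ℕ in Filter.atTop, 2 < ((j : ℝ) + 1) * δ := by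
  have h : Filter.Tendsto (fun j : ℕ => ((j : ℝ) + 1) * δ) Filter.atTop Filter.atTop :=
    (Filter.tendsto_atTop_add_const_right _ _ tendsto_natCast_atTop_atTop).atTop_mul_const hδ
  exact h.eventually_gt_atTop 2

variable {Ω : Set (EuclideanSpace ℝ (Fin n))} {c : EuclideanSpace ℝ (Fin n)} {r a C : ℝ}

/-- The sphere is negligible for the weight ψ²: the integrand is bounded independently of j and
vanishes at each interior point once (j + 1)δ > 2, so dominated convergence applies. -/
theorem tendsto_setIntegral_cutoff_gradient (hc : ‖c‖ = r)
    {f : EuclideanSpace ℝ (Fin n) → ℝ} (hf : Continuous f) (hfc : HasCompactSupport f)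
    (hf0 : (0 : EuclideanSpace ℝ (Fin n)) ∉ tsupport f) :
    Filter.Tendsto (fun j : ℕ => ∫ x in Metric.ball c r, ballGroundState ((2 : ℝ) • c) x ^ 2
      * (f x ^ 2 * ‖gradient (ballCutoff ((2 : ℝ) • c) (j + 1)) x‖ ^ 2))
      Filter.atTop (nhds 0) := by
  obtain ⟨M, hM⟩ := exists_bound_mul_deriv_smoothTransition
  set p := (2 : ℝ) • c
  have hcontA : ContinuousOn (fun x : EuclideanSpace ℝ (Fin n) =>
      (‖x‖ ^ 2) ^ (-(n : ℝ) / 4)) {0}ᶜ := by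
    refine ContinuousOn.rpow_const (by fun_prop) fun x hx => Or.inl ?_
    have : x ≠ 0 := hx
    positivity
  have e : ∀ (j : ℕ) (x : EuclideanSpace ℝ (Fin n)), ballGroundState p x ^ 2
      * (f x ^ 2 * ‖gradient (ballCutoff p (j + 1)) x‖ ^ 2)
      = f x ^ 2 * ((‖x‖ ^ 2) ^ (-(n : ℝ) / 4)) ^ 2 * ‖x + (x - p)‖ ^ 2 *
        |(((j : ℝ) + 1) * -inner ℝ x (x - p)) *
          deriv Real.smoothTransition (((j : ℝ) + 1) * -inner ℝ x (x - p) - 1)| ^ 2 := by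
    intro j x
    rw [norm_gradient_ballCutoff, ballGroundState, mul_pow, mul_pow, sq_abs, sq_abs]
    ring
  have hz : ∫ x in Metric.ball c r, (0 : ℝ) = 0 := by simp
  rw [← hz]
  refine tendsto_integral_of_dominated_convergence
    (fun x => f x ^ 2 * ((‖x‖ ^ 2) ^ (-(n : ℝ) / 4)) ^ 2 * ‖x + (x - p)‖ ^ 2 * M ^ 2) ?_ ?_ ?_ ?_
  · intro j
    refine (integrable_of_continuousOn_compl_zero hfc hf0 ?_ fun x hx => ?_).aestronglyMeasurable.restrict
    · have h1 := (contDiffOn_ballGroundState p (k := 1)).continuousOn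
      have h2 := continuous_gradient ((contDiff_ballCutoff p (j + 1)).of_le
        (by exact_mod_cast le_top))
      fun_prop
    · simp [image_eq_zero_of_notMem_tsupport hx]
  · refine (integrable_of_continuousOn_compl_zero hfc hf0 ?_ fun x hx => ?_).restrict
    · fun_prop
    · simp [image_eq_zero_of_notMem_tsupport hx]
  · intro j
    refine Filter.Eventually.of_forall fun x => ?_
    rw [e, Real.norm_eq_abs, abs_of_nonneg (by positivity)]
    gcongr
    exact hM _
  · refine (ae_restrict_iff' Metric.isOpen_ball.measurableSet).2
      (Filter.Eventually.of_forall fun x hx => ?_)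
    refine tendsto_const_nhds.congr' ?_
    have hδ : 0 < -inner ℝ x (x - p) := neg_pos.2 (inner_sub_neg_of_mem_ball hc hx)
    filter_upwards [tendsto_natCast_add_one_mul hδ] with j hj
    rw [e, deriv_smoothTransition_eq_zero (Or.inr (by linarith))]
    simp

theorem ballCutoff_nonneg (p x : EuclideanSpace ℝ (Fin n)) (t : ℝ) : 0 ≤ ballCutoff p t x :=
  Real.smoothTransition.nonneg _

theorem ballCutoff_le_one (p x : EuclideanSpace ℝ (Fin n)) (t : ℝ) : ballCutoff p t x ≤ 1 :=
  Real.smoothTransition.le_one _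

theorem measurable_ballGroundState (p : EuclideanSpace ℝ (Fin n)) :
    Measurable (ballGroundState p) := by
  unfold ballGroundState
  have h1 : Measurable (fun x : EuclideanSpace ℝ (Fin n) => inner ℝ x (x - p)) :=
    Continuous.measurable (by fun_prop)
  fun_prop

theorem measurable_logWeight_norm (D : ℝ) :
    Measurable (fun x : EuclideanSpace ℝ (Fin n) => logWeight (‖x‖ / D)) := by
  unfold logWeight
  fun_prop

theorem integrable_abs_mul_ballGroundState_rpow {q : ℝ} (hq : 0 < q)
    (p : EuclideanSpace ℝ (Fin n)) {f : EuclideanSpace ℝ (Fin n) → ℝ} (hf : Continuous f)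
    (hfc : HasCompactSupport f) (hf0 : (0 : EuclideanSpace ℝ (Fin n)) ∉ tsupport f) :
    Integrable (fun x => |f x * ballGroundState p x| ^ q) := by
  refine integrable_of_continuousOn_compl_zero hfc hf0 ?_ fun x hx => ?_
  · exact ((hf.continuousOn.mul (contDiffOn_ballGroundState p (k := 1)).continuousOn).abs).rpow_const
      fun x _ => Or.inr hq.le
  · simp [image_eq_zero_of_notMem_tsupport hx, Real.zero_rpow hq.ne']

theorem integrableOn_logWeight_rpow_mul (ha : 0 ≤ a) {D : ℝ} {B : Set (EuclideanSpace ℝ (Fin n))}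
    (hB : MeasurableSet B) (hX0 : ∀ x ∈ B, 0 < logWeight (‖x‖ / D))
    (hX1 : ∀ x ∈ B, logWeight (‖x‖ / D) ≤ 1) {g : EuclideanSpace ℝ (Fin n) → ℝ}
    (hg : Integrable g) (hg0 : ∀ x, 0 ≤ g x) :
    IntegrableOn (fun x => logWeight (‖x‖ / D) ^ a * g x) B := by
  have hmX := (measurable_logWeight_norm (n := n) D).pow_const a
  refine Integrable.mono' hg.restrict (hmX.aestronglyMeasurable.mul
    hg.aestronglyMeasurable.restrict) ?_
  refine (ae_restrict_iff' hB).2 (Filter.Eventually.of_forall fun x hx => ?_)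
  have h0 := hX0 x hx
  rw [Real.norm_eq_abs, abs_of_nonneg (mul_nonneg (by positivity) (hg0 x))]
  exact mul_le_of_le_one_left (hg0 x) (Real.rpow_le_one h0.le (hX1 x hx) ha)

theorem tendsto_setIntegral_cutoff_rpow (hc : ‖c‖ = r) (ha : 0 ≤ a) {q D : ℝ} (hq : 0 < q)
    (hX0 : ∀ x ∈ Metric.ball c r, 0 < logWeight (‖x‖ / D))
    (hX1 : ∀ x ∈ Metric.ball c r, logWeight (‖x‖ / D) ≤ 1)
    {f : EuclideanSpace ℝ (Fin n) → ℝ} (hf : Continuous f) (hfc : HasCompactSupport f)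
    (hf0 : (0 : EuclideanSpace ℝ (Fin n)) ∉ tsupport f) :
    Filter.Tendsto (fun j : ℕ => ∫ x in Metric.ball c r, logWeight (‖x‖ / D) ^ a
      * |f x * ballCutoff ((2 : ℝ) • c) (j + 1) x * ballGroundState ((2 : ℝ) • c) x| ^ q)
      Filter.atTop (nhds (∫ x in Metric.ball c r, logWeight (‖x‖ / D) ^ a
      * |f x * ballGroundState ((2 : ℝ) • c) x| ^ q)) := by
  set p := (2 : ℝ) • c
  have hg := integrable_abs_mul_ballGroundState_rpow hq p hf hfc hf0
  refine tendsto_integral_of_dominated_convergence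
    (fun x => |f x * ballGroundState p x| ^ q) ?_ hg.restrict ?_ ?_
  · intro j
    have h1 := (measurable_logWeight_norm (n := n) D).pow_const a
    have h2 := hf.measurable
    have h3 := (contDiff_ballCutoff p (j + 1)).continuous.measurable
    have h4 := measurable_ballGroundState p
    exact (h1.mul (((h2.mul h3).mul h4).abs.pow_const q)).aestronglyMeasurable
  · intro j
    refine (ae_restrict_iff' Metric.isOpen_ball.measurableSet).2
      (Filter.Eventually.of_forall fun x hx => ?_)
    have h0 := hX0 x hx
    rw [Real.norm_eq_abs, abs_of_nonneg (by positivity)]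
    refine (mul_le_of_le_one_left (by positivity)
      (Real.rpow_le_one h0.le (hX1 x hx) ha)).trans ?_
    gcongr 1
    rw [mul_right_comm, abs_mul, abs_of_nonneg (ballCutoff_nonneg _ _ _)]
    exact mul_le_of_le_one_right (abs_nonneg _) (ballCutoff_le_one _ _ _)
  · refine (ae_restrict_iff' Metric.isOpen_ball.measurableSet).2
      (Filter.Eventually.of_forall fun x hx => ?_)
    refine tendsto_const_nhds.congr' ?_
    have hδ : 0 < -inner ℝ x (x - p) := neg_pos.2 (inner_sub_neg_of_mem_ball hc hx)
    filter_upwards [tendsto_natCast_add_one_mul hδ] with j hj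
    rw [ballCutoff, Real.smoothTransition.one_of_one_le (by linarith), mul_one]

/-- The Hardy-Sobolev inequality tested with ground states that do not vanish near the boundary. -/
theorem HardySobolevInequality.le_of_hasCompactSupport (hn : 3 ≤ n)
    (h : HardySobolevInequality Ω a C) (hc : ‖c‖ = r) (hr : 0 < r) (hB : Metric.ball c r ⊆ Ω)
    (ha : 0 ≤ a) (hX0 : ∀ x ∈ Metric.ball c r, 0 < logWeight (‖x‖ / (3 * supNorm Ω)))
    (hX1 : ∀ x ∈ Metric.ball c r, logWeight (‖x‖ / (3 * supNorm Ω)) ≤ 1)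
    {f : EuclideanSpace ℝ (Fin n) → ℝ} (hf : ContDiff ℝ ∞ f) (hfc : HasCompactSupport f)
    (hf0 : (0 : EuclideanSpace ℝ (Fin n)) ∉ tsupport f) :
    C * (∫ x in Metric.ball c r, logWeight (‖x‖ / (3 * supNorm Ω)) ^ a
        * |f x * ballGroundState ((2 : ℝ) • c) x| ^ (2 * (n : ℝ) / ((n : ℝ) - 2)))
          ^ (((n : ℝ) - 2) / n)
      ≤ 2 * (∫ x in Metric.ball c r, ballGroundState ((2 : ℝ) • c) x ^ 2 * ‖gradient f x‖ ^ 2)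
        + n * ∫ x in Metric.ball c r, f x ^ 2 * (-inner ℝ x (x - (2 : ℝ) • c)
          * ((‖x‖ ^ 2) ^ (-(n : ℝ) / 4)) ^ 2) := by
  have hn' : (3 : ℝ) ≤ n := by exact_mod_cast hn
  have hq : 0 < 2 * (n : ℝ) / ((n : ℝ) - 2) := div_pos (by linarith) (by linarith)
  have hBm : MeasurableSet (Metric.ball c r) := Metric.isOpen_ball.measurableSet
  -- The function f times the boundary cutoff is an admissible quotient for each j; the claim is the
  -- limit j → ∞.
  have t1 := ((tendsto_setIntegral_cutoff_rpow hc ha hq hX0 hX1 hf.continuous hfc hf0).rpow_const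
    (p := ((n : ℝ) - 2) / n) (Or.inr (div_nonneg (by linarith) (by linarith)))).const_mul C
  have t2 := ((tendsto_setIntegral_cutoff_gradient hc hf.continuous hfc hf0).const_mul 2).const_add
    (2 * (∫ x in Metric.ball c r, ballGroundState ((2 : ℝ) • c) x ^ 2 * ‖gradient f x‖ ^ 2)
        + n * ∫ x in Metric.ball c r, f x ^ 2 * (-inner ℝ x (x - (2 : ℝ) • c)
          * ((‖x‖ ^ 2) ^ (-(n : ℝ) / 4)) ^ 2))
  rw [mul_zero, add_zero] at t2
  refine le_of_tendsto_of_tendsto' t1 t2 fun j => ?_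
  have ht : (0 : ℝ) < (j : ℝ) + 1 := by positivity
  refine (h.le_of_isTestFunctionOn_ball hn hc hB
    (isTestFunctionOn_mul_ballCutoff hc hr ht hf hfc)).trans ?_
  set p := (2 : ℝ) • c with hp
  set χ := ballCutoff p ((j : ℝ) + 1) with hχ
  have hχs := contDiff_ballCutoff p ((j : ℝ) + 1)
  have hf1 : ContDiff ℝ 1 f := hf.of_le (by exact_mod_cast le_top)
  have hχ1 : ContDiff ℝ 1 χ := hχs.of_le (by exact_mod_cast le_top)
  have cf := hf.continuous
  have cgf := continuous_gradient hf1
  have cgχ := continuous_gradient hχ1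
  have cχ := hχ1.continuous
  have cgw := continuous_gradient (hf1.mul hχ1)
  have cφ := (contDiffOn_ballGroundState p (k := 1)).continuousOn
  have hcontA : ContinuousOn (fun x : EuclideanSpace ℝ (Fin n) =>
      (‖x‖ ^ 2) ^ (-(n : ℝ) / 4)) {0}ᶜ := by
    refine ContinuousOn.rpow_const (by fun_prop) fun x hx => Or.inl ?_
    have : x ≠ 0 := hx
    positivity
  have hfz : ∀ x ∉ tsupport f, f x = 0 := fun x hx => image_eq_zero_of_notMem_tsupport hx
  have hgz : ∀ x ∉ tsupport f, gradient f x = 0 :=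
    fun x hx => gradient_eq_zero_of_notMem_tsupport hx
  have hgwz : ∀ x ∉ tsupport f, gradient (fun x => f x * χ x) x = 0 := fun x hx =>
    gradient_eq_zero_of_notMem_tsupport fun hx' => hx (tsupport_mul_subset_left hx')
  have i1 : IntegrableOn (fun x => ballGroundState p x ^ 2 * ‖gradient f x‖ ^ 2)
      (Metric.ball c r) :=
    (integrable_of_continuousOn_compl_zero hfc hf0 (by fun_prop)
      fun x hx => by simp [hgz x hx]).integrableOn
  have i2 : IntegrableOn (fun x => ballGroundState p x ^ 2 * (f x ^ 2 * ‖gradient χ x‖ ^ 2))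
      (Metric.ball c r) :=
    (integrable_of_continuousOn_compl_zero hfc hf0 (by fun_prop)
      fun x hx => by simp [hfz x hx]).integrableOn
  have i3 : IntegrableOn (fun x => ballGroundState p x ^ 2 *
      ‖gradient (fun x => f x * χ x) x‖ ^ 2) (Metric.ball c r) := by
    refine (integrable_of_continuousOn_compl_zero hfc hf0 ?_
      fun x hx => by simp [hgwz x hx]).integrableOn
    exact (cφ.pow 2).mul (cgw.norm.pow 2).continuousOn
  have i4 : IntegrableOn (fun x => f x ^ 2 * (-inner ℝ x (x - p)
      * ((‖x‖ ^ 2) ^ (-(n : ℝ) / 4)) ^ 2)) (Metric.ball c r) :=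
    (integrable_of_continuousOn_compl_zero hfc hf0 (by fun_prop)
      fun x hx => by simp [hfz x hx]).integrableOn
  have i5 : IntegrableOn (fun x => χ x ^ 2 * (f x ^ 2 * (-inner ℝ x (x - p)
      * ((‖x‖ ^ 2) ^ (-(n : ℝ) / 4)) ^ 2))) (Metric.ball c r) :=
    (integrable_of_continuousOn_compl_zero hfc hf0 (by fun_prop)
      fun x hx => by simp [hfz x hx]).integrableOn
  have hχb : ∀ x, χ x ^ 2 ≤ 1 := fun x =>
    pow_le_one₀ (ballCutoff_nonneg _ _ _) (ballCutoff_le_one _ _ _)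
  have s1 : ∫ x in Metric.ball c r, ballGroundState p x ^ 2 *
      ‖gradient (fun x => f x * χ x) x‖ ^ 2
      ≤ 2 * (∫ x in Metric.ball c r, ballGroundState p x ^ 2 * ‖gradient f x‖ ^ 2)
      + 2 * ∫ x in Metric.ball c r, ballGroundState p x ^ 2 * (f x ^ 2 * ‖gradient χ x‖ ^ 2) := by
    rw [← integral_const_mul, ← integral_const_mul,
      ← integral_add (i1.const_mul _) (i2.const_mul _)]
    refine setIntegral_mono_on i3 ((i1.const_mul _).add (i2.const_mul _)) hBm fun x _ => ?_
    rw [gradient_mul (hf1.differentiable (by norm_num) x) (hχ1.differentiable (by norm_num) x)]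
    have p1 : ‖f x • gradient χ x + χ x • gradient f x‖ ^ 2
        ≤ 2 * (f x ^ 2 * ‖gradient χ x‖ ^ 2) + 2 * (χ x ^ 2 * ‖gradient f x‖ ^ 2) := by
      have := parallelogram_law_with_norm ℝ (f x • gradient χ x) (χ x • gradient f x)
      have e1 : ‖f x • gradient χ x‖ ^ 2 = f x ^ 2 * ‖gradient χ x‖ ^ 2 := by
        rw [norm_smul, mul_pow, Real.norm_eq_abs, sq_abs]
      have e2 : ‖χ x • gradient f x‖ ^ 2 = χ x ^ 2 * ‖gradient f x‖ ^ 2 := by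
        rw [norm_smul, mul_pow, Real.norm_eq_abs, sq_abs]
      nlinarith [sq_nonneg ‖f x • gradient χ x - χ x • gradient f x‖]
    have p2 : χ x ^ 2 * ‖gradient f x‖ ^ 2 ≤ 1 * ‖gradient f x‖ ^ 2 := by
      gcongr; exact hχb x
    have p3 := mul_le_mul_of_nonneg_left (p1.trans (by linarith :
      _ ≤ 2 * (f x ^ 2 * ‖gradient χ x‖ ^ 2) + 2 * ‖gradient f x‖ ^ 2))
      (sq_nonneg (ballGroundState p x))
    linarith
  have s2 : ∫ x in Metric.ball c r, (f x * χ x * ballGroundState p x) ^ 2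
      * (-n * (inner ℝ x (x - p))⁻¹) ≤ n * ∫ x in Metric.ball c r, f x ^ 2 * (-inner ℝ x (x - p)
          * ((‖x‖ ^ 2) ^ (-(n : ℝ) / 4)) ^ 2) := by
    -- The factor d² in ψ² cancels the singularity of the potential -n/d at the sphere.
    have e : ∫ x in Metric.ball c r, (f x * χ x * ballGroundState p x) ^ 2
      * (-n * (inner ℝ x (x - p))⁻¹) = ∫ x in Metric.ball c r, n * (χ x ^ 2 * (f x ^ 2 *
        (-inner ℝ x (x - p) * ((‖x‖ ^ 2) ^ (-(n : ℝ) / 4)) ^ 2))) := by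
      refine setIntegral_congr_fun hBm fun x hx => ?_
      have hd := (inner_sub_neg_of_mem_ball hc hx).ne
      simp only [ballGroundState]
      field_simp
    rw [e, integral_const_mul]
    refine mul_le_mul_of_nonneg_left ?_ (by positivity)
    refine setIntegral_mono_on i5 i4 hBm fun x hx => ?_
    have hd := inner_sub_neg_of_mem_ball hc hx
    refine mul_le_of_le_one_left ?_ (hχb x)
    have : 0 ≤ -inner ℝ x (x - p) := by linarith
    positivity
  linarith

end BoundaryCutoff

/-! ### Cutoffs on the logarithmic scale -/

section LogarithmicCutoff

variable {n : ℕ}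

/-- The closed shell `exp (-5 T) ≤ |x| ≤ exp (-T)`. -/
def logShell (n : ℕ) (T : ℝ) : Set (EuclideanSpace ℝ (Fin n)) :=
  {x | Real.exp (-(5 * T)) ≤ ‖x‖ ∧ ‖x‖ ≤ Real.exp (-T)}

theorem isClosed_logShell (T : ℝ) : IsClosed (logShell n T) :=
  (isClosed_le continuous_const continuous_norm).inter
    (isClosed_le continuous_norm continuous_const)

theorem isCompact_logShell (T : ℝ) : IsCompact (logShell n T) := by
  refine (isCompact_closedBall (0 : EuclideanSpace ℝ (Fin n)) (Real.exp (-T))).of_isClosed_subset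
    (isClosed_logShell T) fun x hx => ?_
  rw [mem_closedBall_zero_iff]
  exact hx.2

theorem zero_notMem_logShell (T : ℝ) : (0 : EuclideanSpace ℝ (Fin n)) ∉ logShell n T := by
  intro h
  have h1 := h.1
  rw [norm_zero] at h1
  exact absurd h1 (not_le.2 (Real.exp_pos _))

/-- Cutoffs in the logarithmic scale: the gradient decays with the length of the scale. -/
theorem exists_logarithmic_cutoff (n : ℕ) : ∃ M : ℝ, ∀ T : ℝ, 1 ≤ T →
    ∃ f : EuclideanSpace ℝ (Fin n) → ℝ, ContDiff ℝ ∞ f ∧ tsupport f ⊆ logShell n T ∧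
      (∀ x, 0 ≤ f x) ∧ (∀ x, f x ≤ 1) ∧
      (∀ x, Real.exp (-(4 * T)) ≤ ‖x‖ → ‖x‖ ≤ Real.exp (-(2 * T)) → f x = 1) ∧
      ∀ x, x ≠ 0 → ‖gradient f x‖ ≤ M / (T * ‖x‖) := by
  -- In the variable -log|x|/T, ζ equals 1 on [2, 4] and vanishes outside (1, 5).
  let ζ : ContDiffBump (3 : ℝ) := ⟨1, 2, by norm_num, by norm_num⟩
  have hζs : ContDiff ℝ ∞ ζ := ζ.contDiff
  have hζc : Continuous (deriv ζ) := hζs.continuous_deriv (by exact_mod_cast le_top)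
  obtain ⟨M, hM⟩ : ∃ M, ∀ s, ‖deriv ζ s‖ ≤ M := by
    have : HasCompactSupport (deriv ζ) := ζ.hasCompactSupport.deriv
    exact hζc.bounded_above_of_compact_support this
  have hζ0 : ∀ s, s ≤ 1 ∨ 5 ≤ s → ζ s = 0 := by
    intro s hs
    by_contra h
    have h1 : s ∈ Function.support ζ := h
    rw [ζ.support_eq, Metric.mem_ball, Real.dist_eq, abs_lt] at h1
    have h2 : ζ.rOut = 2 := rfl
    rw [h2] at h1
    rcases hs with hs | hs <;> linarith [h1.1, h1.2]
  refine ⟨M, fun T hT => ?_⟩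
  have hT0 : 0 < T := by linarith
  set f : EuclideanSpace ℝ (Fin n) → ℝ := fun x => ζ (-Real.log ‖x‖ / T) with hf
  have hsupp : tsupport f ⊆ logShell n T := by
    refine closure_minimal (fun x hx => ?_) (isClosed_logShell T)
    have h1 : ¬ (-Real.log ‖x‖ / T ≤ 1 ∨ 5 ≤ -Real.log ‖x‖ / T) := fun h => hx (hζ0 _ h)
    rw [not_or, not_le, not_le, lt_div_iff₀ hT0, div_lt_iff₀ hT0] at h1
    have hx0 : 0 < ‖x‖ := by
      refine norm_pos_iff.2 fun h0 => ?_
      -- The convention log 0 = 0 sends the origin to 0, where ζ vanishes.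
      rw [h0, norm_zero, Real.log_zero] at h1
      linarith [h1.1]
    constructor
    · rw [← Real.le_log_iff_exp_le hx0]; linarith [h1.2]
    · rw [← Real.log_le_iff_le_exp hx0]; linarith [h1.1]
  refine ⟨f, ?_, hsupp, fun x => ζ.nonneg, fun x => ζ.le_one, ?_, ?_⟩
  · rw [contDiff_iff_contDiffAt]
    intro x
    by_cases hx : x = 0
    · subst hx
      refine (contDiffAt_const (c := (0 : ℝ))).congr_of_eventuallyEq ?_
      have h0 : (0 : EuclideanSpace ℝ (Fin n)) ∉ tsupport f :=
        fun h => zero_notMem_logShell T (hsupp h)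
      filter_upwards [(isClosed_tsupport f).isOpen_compl.mem_nhds h0] with y hy
      exact image_eq_zero_of_notMem_tsupport hy
    · exact hζs.contDiffAt.comp x
        (((contDiffAt_norm ℝ hx).log (norm_ne_zero_iff.2 hx)).neg.div_const T)
  · intro x h1 h2
    have hx0 : 0 < ‖x‖ := (Real.exp_pos _).trans_le h1
    rw [← Real.le_log_iff_exp_le hx0] at h1
    rw [← Real.log_le_iff_le_exp hx0] at h2
    refine ζ.one_of_mem_closedBall ?_
    rw [Metric.mem_closedBall, Real.dist_eq, abs_le]
    have h3 : ζ.rIn = 1 := rfl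
    have h4 : 2 ≤ -Real.log ‖x‖ / T := by rw [le_div_iff₀ hT0]; linarith
    have h5 : -Real.log ‖x‖ / T ≤ 4 := by rw [div_le_iff₀ hT0]; linarith
    rw [h3]
    constructor <;> linarith
  · intro x hx
    have hx0 : 0 < ‖x‖ := norm_pos_iff.2 hx
    have h1 := ((hasFDerivAt_normSq 0 x).log (by rw [sub_zero]; positivity)).const_mul
      (-(2 * T)⁻¹)
    have e : f = fun y => ζ (-(2 * T)⁻¹ * Real.log (‖y - 0‖ ^ 2)) := by
      funext y
      rw [hf, sub_zero, Real.log_pow]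
      push_cast
      field_simp
    have h2 : HasDerivAt ζ (deriv ζ (-(2 * T)⁻¹ * Real.log (‖x - 0‖ ^ 2)))
        (-(2 * T)⁻¹ * Real.log (‖x - 0‖ ^ 2)) :=
      ((hζs.differentiable (by simp)) _).hasDerivAt
    have h3 := (h2.comp_hasFDerivAt x h1).fderiv
    change fderiv ℝ (fun y => ζ (-(2 * T)⁻¹ * Real.log (‖y - 0‖ ^ 2))) x = _ at h3
    rw [← e] at h3
    have h5 := hM (-(2 * T)⁻¹ * Real.log (‖x - 0‖ ^ 2))
    rw [gradient, LinearIsometryEquiv.norm_map, h3, norm_smul]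
    have h6 : ‖(-(2 * T)⁻¹) • (‖x - 0‖ ^ 2)⁻¹ • 2 • innerSL ℝ (x - 0)‖ = 1 / (T * ‖x‖) := by
      rw [sub_zero, ← Nat.cast_smul_eq_nsmul ℝ, norm_smul, norm_smul, norm_smul,
        innerSL_apply_norm, norm_neg, Real.norm_eq_abs, Real.norm_eq_abs, Real.norm_eq_abs,
        abs_of_pos (by positivity), abs_of_pos (by positivity), abs_of_pos (by norm_num)]
      push_cast
      field_simp
    rw [h6, div_eq_mul_one_div M]
    gcongr

/-- In polar coordinates the density becomes dy/y, and the shell has logarithmic length 4T. -/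
theorem setIntegral_logShell_inv_norm_pow (hn : 1 ≤ n) {T : ℝ} (hT : 0 < T) :
    ∫ x in logShell n T, (‖x‖ ^ n)⁻¹
      = n * volume.real (Metric.ball (0 : EuclideanSpace ℝ (Fin n)) 1) * (4 * T) := by
  have : Nontrivial (EuclideanSpace ℝ (Fin n)) := by
    have : Nonempty (Fin n) := ⟨⟨0, hn⟩⟩
    infer_instance
  set A := Set.Icc (Real.exp (-(5 * T))) (Real.exp (-T)) with hA
  have e1 : ∫ x in logShell n T, (‖x‖ ^ n)⁻¹
      = ∫ x : EuclideanSpace ℝ (Fin n), A.indicator (fun y : ℝ => (y ^ n)⁻¹) ‖x‖ := by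
    rw [← integral_indicator (isClosed_logShell T).measurableSet]
    refine integral_congr_ae (Filter.Eventually.of_forall fun x => ?_)
    by_cases hx : x ∈ logShell n T
    · have hx' : ‖x‖ ∈ A := hx
      simp [Set.indicator_of_mem hx, Set.indicator_of_mem hx']
    · have hx' : ‖x‖ ∉ A := hx
      simp [Set.indicator_of_notMem hx, Set.indicator_of_notMem hx']
  have hle : Real.exp (-(5 * T)) ≤ Real.exp (-T) := Real.exp_le_exp.2 (by linarith)
  have hAs : A ⊆ Set.Ioi 0 := fun y hy => (Real.exp_pos _).trans_le hy.1
  rw [e1, integral_fun_norm_addHaar]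
  have e2 : ∫ y in Set.Ioi (0 : ℝ), y ^ (Module.finrank ℝ (EuclideanSpace ℝ (Fin n)) - 1) •
      A.indicator (fun y : ℝ => (y ^ n)⁻¹) y = 4 * T := by
    have e3 : ∀ y : ℝ, y ^ (Module.finrank ℝ (EuclideanSpace ℝ (Fin n)) - 1) •
        A.indicator (fun y : ℝ => (y ^ n)⁻¹) y = A.indicator (fun y => y⁻¹) y := by
      intro y
      by_cases hy : y ∈ A
      · have hy0 : 0 < y := hAs hy
        rw [Set.indicator_of_mem hy, Set.indicator_of_mem hy, finrank_euclideanSpace_fin,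
          smul_eq_mul]
        obtain ⟨k, rfl⟩ := Nat.exists_eq_add_of_le hn
        rw [Nat.add_sub_cancel_left, add_comm 1 k, pow_succ]
        field_simp
      · simp [Set.indicator_of_notMem hy]
    simp_rw [e3]
    rw [setIntegral_indicator measurableSet_Icc, Set.inter_eq_right.2 hAs,
      integral_Icc_eq_integral_Ioc, ← intervalIntegral.integral_of_le hle,
      integral_inv_of_pos (Real.exp_pos _) (Real.exp_pos _), ← Real.exp_sub, Real.log_exp]
    ring
  rw [e2, finrank_euclideanSpace_fin]
  simp
  ring

end LogarithmicCutoff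

/-! ### Sharpness of the exponent -/

section Sharpness

variable {n : ℕ} {c : EuclideanSpace ℝ (Fin n)} {r : ℝ}

theorem neg_inner_sub_le (hc : ‖c‖ = r) (x : EuclideanSpace ℝ (Fin n)) :
    -inner ℝ x (x - (2 : ℝ) • c) ≤ 2 * r * ‖x‖ := by
  rw [inner_sub_right, inner_smul_right, real_inner_self_eq_norm_sq]
  have h := real_inner_le_norm x c
  rw [hc] at h
  nlinarith [sq_nonneg ‖x‖]

theorem normSq_rpow_sq {x : EuclideanSpace ℝ (Fin n)} :
    ((‖x‖ ^ 2) ^ (-(n : ℝ) / 4)) ^ 2 = (‖x‖ ^ n)⁻¹ := by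
  rw [← Real.rpow_natCast, ← Real.rpow_mul (by positivity), ← Real.rpow_natCast ‖x‖ 2,
    ← Real.rpow_mul (norm_nonneg x), ← Real.rpow_natCast ‖x‖ n, ← Real.rpow_neg (norm_nonneg x)]
  congr 1
  push_cast
  ring

/-- Brings the potential term, smaller by a factor |x| ≤ e^(-T), into the same form T⁻²|x|^(-n) as
the gradient term. -/
theorem exp_neg_le_two_div_sq {T : ℝ} (hT : 0 < T) : Real.exp (-T) ≤ 2 / T ^ 2 := by
  have h := Real.quadratic_le_exp_of_nonneg hT.le
  rw [Real.exp_neg, inv_le_comm₀ (Real.exp_pos _) (by positivity), inv_div]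
  linarith

theorem setIntegral_ball_le_of_le_logShell {g : EuclideanSpace ℝ (Fin n) → ℝ} (hn : 1 ≤ n)
    {T K : ℝ} (hT : 0 < T) (hK : 0 ≤ K) (hg0 : ∀ x ∈ Metric.ball c r, 0 ≤ g x)
    (hg1 : ∀ x ∉ logShell n T, g x = 0)
    (hg2 : ∀ x ∈ Metric.ball c r, x ∈ logShell n T → g x ≤ K / T ^ 2 * (‖x‖ ^ n)⁻¹) :
    ∫ x in Metric.ball c r, g x
      ≤ 4 * K * n * volume.real (Metric.ball (0 : EuclideanSpace ℝ (Fin n)) 1) / T := by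
  set S := logShell n T
  set G : EuclideanSpace ℝ (Fin n) → ℝ := S.indicator fun x => K / T ^ 2 * (‖x‖ ^ n)⁻¹
  have hBm : MeasurableSet (Metric.ball c r) := Metric.isOpen_ball.measurableSet
  have hSm : MeasurableSet S := (isClosed_logShell T).measurableSet
  have hi : IntegrableOn (fun x : EuclideanSpace ℝ (Fin n) => K / T ^ 2 * (‖x‖ ^ n)⁻¹) S := by
    refine ContinuousOn.integrableOn_compact (isCompact_logShell T) ?_
    refine continuousOn_const.mul (ContinuousOn.inv₀ (by fun_prop) fun x hx => ?_)
    have : 0 < ‖x‖ := (Real.exp_pos _).trans_le hx.1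
    positivity
  have hG : Integrable G := (integrable_indicator_iff hSm).2 hi
  have hG0 : ∀ x, 0 ≤ G x := fun x => Set.indicator_nonneg (fun x _ => by positivity) x
  have h1 : ∫ x in Metric.ball c r, g x ≤ ∫ x in Metric.ball c r, G x := by
    refine integral_mono_of_nonneg ((ae_restrict_iff' hBm).2 (Filter.Eventually.of_forall hg0))
      hG.restrict ((ae_restrict_iff' hBm).2 (Filter.Eventually.of_forall fun x hx => ?_))
    by_cases hxS : x ∈ S
    · refine (hg2 x hx hxS).trans (le_of_eq ?_)
      simp only [G, Set.indicator_of_mem hxS]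
    · rw [hg1 x hxS]; exact hG0 x
  have h2 : ∫ x in Metric.ball c r, G x ≤ ∫ x, G x :=
    setIntegral_le_integral hG (Filter.Eventually.of_forall hG0)
  refine h1.trans (h2.trans (le_of_eq ?_))
  rw [integral_indicator hSm, integral_const_mul, setIntegral_logShell_inv_norm_pow hn hT]
  field_simp

theorem setIntegral_gradient_logCutoff_le (hn : 1 ≤ n) (hc : ‖c‖ = r) {T M : ℝ} (hT : 0 < T)
    {f : EuclideanSpace ℝ (Fin n) → ℝ} (hs : tsupport f ⊆ logShell n T)
    (hM : ∀ x, x ≠ 0 → ‖gradient f x‖ ≤ M / (T * ‖x‖)) :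
    ∫ x in Metric.ball c r, ballGroundState ((2 : ℝ) • c) x ^ 2 * ‖gradient f x‖ ^ 2
      ≤ 4 * (4 * r ^ 2 * M ^ 2) * n *
        volume.real (Metric.ball (0 : EuclideanSpace ℝ (Fin n)) 1) / T := by
  refine setIntegral_ball_le_of_le_logShell hn hT (by positivity) (fun x _ => by positivity)
    (fun x hx => by
      simp [gradient_eq_zero_of_notMem_tsupport (u := f) fun hx' => hx (hs hx')])
    fun x hx hxS => ?_
  have hx0 : 0 < ‖x‖ := (Real.exp_pos _).trans_le hxS.1
  have hδ := inner_sub_neg_of_mem_ball hc hx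
  have h1 := neg_inner_sub_le hc x
  -- ψ² ≤ 4r²|x|^(2-n), and the squared gradient bound M²/(T²|x|²) restores the scale-invariant
  -- density |x|^(-n).
  have h2 : ballGroundState ((2 : ℝ) • c) x ^ 2 ≤ (2 * r * ‖x‖) ^ 2 * (‖x‖ ^ n)⁻¹ := by
    rw [ballGroundState, mul_pow, normSq_rpow_sq]
    gcongr
    linarith
  calc ballGroundState ((2 : ℝ) • c) x ^ 2 * ‖gradient f x‖ ^ 2
      ≤ ((2 * r * ‖x‖) ^ 2 * (‖x‖ ^ n)⁻¹) * (M / (T * ‖x‖)) ^ 2 := by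
        gcongr
        exact hM x (norm_pos_iff.1 hx0)
    _ = _ := by field_simp; ring

theorem setIntegral_potential_logCutoff_le (hn : 1 ≤ n) (hc : ‖c‖ = r) (hr : 0 < r) {T : ℝ}
    (hT : 0 < T) {f : EuclideanSpace ℝ (Fin n) → ℝ} (hs : tsupport f ⊆ logShell n T)
    (hf0 : ∀ x, 0 ≤ f x) (hf1 : ∀ x, f x ≤ 1) :
    ∫ x in Metric.ball c r, f x ^ 2 * (-inner ℝ x (x - (2 : ℝ) • c)
        * ((‖x‖ ^ 2) ^ (-(n : ℝ) / 4)) ^ 2)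
      ≤ 4 * (4 * r) * n * volume.real (Metric.ball (0 : EuclideanSpace ℝ (Fin n)) 1) / T := by
  refine setIntegral_ball_le_of_le_logShell hn hT (by positivity) (fun x hx => ?_)
    (fun x hx => by simp [image_eq_zero_of_notMem_tsupport fun hx' => hx (hs hx')])
    fun x hx hxS => ?_
  · have := inner_sub_neg_of_mem_ball hc hx
    have : 0 ≤ -inner ℝ x (x - (2 : ℝ) • c) := by linarith
    positivity
  · have hx0 : 0 < ‖x‖ := (Real.exp_pos _).trans_le hxS.1
    have hδ := inner_sub_neg_of_mem_ball hc hx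
    have h1 := neg_inner_sub_le hc x
    have hx2 : ‖x‖ ≤ 2 / T ^ 2 := hxS.2.trans (exp_neg_le_two_div_sq hT)
    rw [normSq_rpow_sq]
    have hfx : f x ^ 2 ≤ 1 := pow_le_one₀ (hf0 x) (hf1 x)
    have hδ0 : 0 ≤ -inner ℝ x (x - (2 : ℝ) • c) := by linarith
    calc f x ^ 2 * (-inner ℝ x (x - (2 : ℝ) • c) * (‖x‖ ^ n)⁻¹)
        ≤ 1 * (-inner ℝ x (x - (2 : ℝ) • c) * (‖x‖ ^ n)⁻¹) := by gcongr
      _ ≤ 1 * (2 * r * (2 / T ^ 2) * (‖x‖ ^ n)⁻¹) := by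
          gcongr
          exact h1.trans (by gcongr)
      _ = _ := by ring

/-- Balls of radius comparable to their distance `s` from the origin, centered on the inner normal. -/
theorem mem_normalBall (hc : ‖c‖ = r) (hr : 0 < r) {s : ℝ} (hs : 0 < s) (hsr : 4 * s ≤ r)
    {x : EuclideanSpace ℝ (Fin n)} (hx : x ∈ Metric.ball ((s / r) • c) (s / 4)) :
    3 / 4 * s ≤ ‖x‖ ∧ ‖x‖ ≤ 5 / 4 * s ∧ s * r ≤ -inner ℝ x (x - (2 : ℝ) • c) := by
  rw [Metric.mem_ball, dist_eq_norm] at hx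
  have hcs : ‖(s / r) • c‖ = s := by
    rw [norm_smul, hc, Real.norm_eq_abs, abs_of_pos (by positivity)]
    field_simp
  have h1 := norm_sub_norm_le ((s / r) • c) x
  rw [norm_sub_rev, hcs] at h1
  have h2 := norm_sub_norm_le x ((s / r) • c)
  rw [hcs] at h2
  have h3 : ‖x‖ ≤ 5 / 4 * s := by linarith
  refine ⟨by linarith, h3, ?_⟩
  have h4 : 3 / 4 * s * r ≤ inner ℝ x c := by
    have e : inner ℝ x c = inner ℝ (x - (s / r) • c) c + s * r := by
      rw [inner_sub_left, inner_smul_left, real_inner_self_eq_norm_sq, hc]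
      simp only [conj_trivial]
      field_simp
      ring
    have h5 := abs_real_inner_le_norm (x - (s / r) • c) c
    rw [hc] at h5
    have h6 := (abs_le.1 h5).1
    have h7 : ‖x - (s / r) • c‖ * r ≤ s / 4 * r := by gcongr
    rw [e]
    linarith
  rw [inner_sub_right, inner_smul_right, real_inner_self_eq_norm_sq]
  -- 2⟨x, c⟩ - |x|² ≥ (3/2)sr - (25/16)s² ≥ sr, because s ≤ r/4.
  have h8 : ‖x‖ ^ 2 ≤ (5 / 4 * s) ^ 2 := by gcongr
  nlinarith

theorem normalBall_subset_ball (hc : ‖c‖ = r) (hr : 0 < r) {s : ℝ} (hs : 0 < s)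
    (hsr : 4 * s ≤ r) : Metric.ball ((s / r) • c) (s / 4) ⊆ Metric.ball c r := by
  intro x hx
  obtain ⟨-, -, h⟩ := mem_normalBall hc hr hs hsr hx
  have h1 := norm_sub_sq_real x c
  rw [inner_sub_right, inner_smul_right, real_inner_self_eq_norm_sq] at h
  rw [hc] at h1
  rw [Metric.mem_ball, dist_eq_norm]
  have : 0 < s * r := by positivity
  nlinarith [norm_nonneg (x - c)]

/-- -d ≥ sr and |x|² ≤ 2s² give ψ ≥ r 2^(-n/4) s^(1-n/2), and (n/2 - 1) · 2n/(n-2) = n. -/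
theorem ballGroundState_rpow_ge (hn : 3 ≤ n) (hc : ‖c‖ = r) (hr : 0 < r) {s : ℝ} (hs : 0 < s)
    (hsr : 4 * s ≤ r) {x : EuclideanSpace ℝ (Fin n)}
    (hx : x ∈ Metric.ball ((s / r) • c) (s / 4)) :
    (r * 2 ^ (-(n : ℝ) / 4)) ^ (2 * (n : ℝ) / ((n : ℝ) - 2)) * (s ^ n)⁻¹
      ≤ |ballGroundState ((2 : ℝ) • c) x| ^ (2 * (n : ℝ) / ((n : ℝ) - 2)) := by
  have hn' : (3 : ℝ) ≤ n := by exact_mod_cast hn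
  have hn2 : (0 : ℝ) < n - 2 := by linarith
  obtain ⟨h1, h2, h3⟩ := mem_normalBall hc hr hs hsr hx
  have hx0 : 0 < ‖x‖ := by linarith
  have hA : ‖x‖ ^ 2 ≤ 2 * s ^ 2 := by nlinarith
  have h4 : (2 * s ^ 2) ^ (-(n : ℝ) / 4) ≤ (‖x‖ ^ 2) ^ (-(n : ℝ) / 4) :=
    Real.rpow_le_rpow_of_nonpos (by positivity) hA (by linarith)
  have h5 : s * r * (2 * s ^ 2) ^ (-(n : ℝ) / 4) ≤ |ballGroundState ((2 : ℝ) • c) x| := by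
    refine le_trans ?_ (le_abs_self _)
    rw [ballGroundState]
    have : 0 < s * r := by positivity
    exact mul_le_mul h3 h4 (by positivity) (by linarith)
  have h6 : s * r * (2 * s ^ 2) ^ (-(n : ℝ) / 4)
      = (r * 2 ^ (-(n : ℝ) / 4)) * s ^ (-((n : ℝ) - 2) / 2) := by
    rw [Real.mul_rpow (by norm_num) (by positivity), ← Real.rpow_natCast s 2,
      ← Real.rpow_mul hs.le]
    have : s ^ (-((n : ℝ) - 2) / 2) = s * s ^ (((2 : ℕ) : ℝ) * (-(n : ℝ) / 4)) := by
      rw [← Real.rpow_one_add' hs.le]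
      · congr 1; push_cast; ring
      · push_cast; linarith
    rw [this]
    ring
  have h7 : (s ^ n)⁻¹ = (s ^ (-((n : ℝ) - 2) / 2)) ^ (2 * (n : ℝ) / ((n : ℝ) - 2)) := by
    rw [← Real.rpow_mul hs.le, ← Real.rpow_natCast, ← Real.rpow_neg hs.le]
    congr 1
    field_simp
  rw [h7, ← Real.mul_rpow (by positivity) (by positivity), ← h6]
  gcongr

theorem disjoint_normalBalls (hc : ‖c‖ = r) (hr : 0 < r) {s t : ℝ} (ht : 0 < t)
    (hst : 2 * t ≤ s) (hsr : 4 * s ≤ r) :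
    Disjoint (Metric.ball ((s / r) • c) (s / 4)) (Metric.ball ((t / r) • c) (t / 4)) := by
  rw [Set.disjoint_left]
  intro x hx hx'
  obtain ⟨h1, -, -⟩ := mem_normalBall hc hr (by linarith) hsr hx
  obtain ⟨-, h2, -⟩ := mem_normalBall hc hr ht (by linarith) hx'
  linarith

/-- Lower bound for integrals over a ball in terms of disjoint subballs at exponential scales. -/
theorem card_mul_le_setIntegral_ball (hn : 1 ≤ n) (hc : ‖c‖ = r) (hr : 0 < r)
    {g : EuclideanSpace ℝ (Fin n) → ℝ} (hg : IntegrableOn g (Metric.ball c r))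
    (hg0 : ∀ x ∈ Metric.ball c r, 0 ≤ g x) {J : Finset ℕ} {κ : ℝ}
    (hJ : ∀ j ∈ J, 4 * Real.exp (-(j : ℝ)) ≤ r)
    (hκ : ∀ j ∈ J, ∀ x ∈ Metric.ball ((Real.exp (-(j : ℝ)) / r) • c) (Real.exp (-(j : ℝ)) / 4),
      κ * (Real.exp (-(j : ℝ)) ^ n)⁻¹ ≤ g x) :
    J.card * (κ * (4 ^ n)⁻¹ * volume.real (Metric.ball (0 : EuclideanSpace ℝ (Fin n)) 1))
      ≤ ∫ x in Metric.ball c r, g x := by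
  have : Nontrivial (EuclideanSpace ℝ (Fin n)) := by
    have : Nonempty (Fin n) := ⟨⟨0, hn⟩⟩
    infer_instance
  set U : ℕ → Set (EuclideanSpace ℝ (Fin n)) := fun j =>
    Metric.ball ((Real.exp (-(j : ℝ)) / r) • c) (Real.exp (-(j : ℝ)) / 4) with hU
  have hUB : ∀ j ∈ J, U j ⊆ Metric.ball c r := fun j hj =>
    normalBall_subset_ball hc hr (Real.exp_pos _) (hJ j hj)
  have hlt : ∀ i j : ℕ, i < j → 2 * Real.exp (-(j : ℝ)) ≤ Real.exp (-(i : ℝ)) := by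
    intro i j hij
    have h1 : (i : ℝ) + 1 ≤ j := by exact_mod_cast hij
    have h2 : Real.exp (-(i : ℝ)) = Real.exp ((j : ℝ) - i) * Real.exp (-(j : ℝ)) := by
      rw [← Real.exp_add]; congr 1; ring
    rw [h2]
    gcongr
    linarith [Real.add_one_le_exp ((j : ℝ) - i)]
  have hdis : (J : Set ℕ).Pairwise (Function.onFun Disjoint U) := by
    intro i hi j hj hij
    rcases lt_or_gt_of_ne hij with h | h
    · exact disjoint_normalBalls hc hr (Real.exp_pos _) (hlt i j h) (hJ i hi)
    · exact (disjoint_normalBalls hc hr (Real.exp_pos _) (hlt j i h) (hJ j hj)).symm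
  have hUm : ∀ j ∈ J, MeasurableSet (U j) := fun j _ => Metric.isOpen_ball.measurableSet
  have hUi : ∀ j ∈ J, IntegrableOn g (U j) := fun j hj => hg.mono_set (hUB j hj)
  have h1 : ∫ x in ⋃ j ∈ J, U j, g x ≤ ∫ x in Metric.ball c r, g x := by
    refine setIntegral_mono_set hg ((ae_restrict_iff' Metric.isOpen_ball.measurableSet).2
      (Filter.Eventually.of_forall hg0)) (Filter.Eventually.of_forall ?_)
    exact Set.iUnion₂_subset hUB
  rw [integral_biUnion_finset J hUm hdis hUi] at h1
  refine le_trans ?_ h1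
  rw [← nsmul_eq_mul]
  refine Finset.card_nsmul_le_sum _ _ _ fun j hj => ?_
  -- The volume is proportional to the n-th power of the scale and cancels the density, so every
  -- scale contributes the same amount.
  have hvol : volume.real (U j) = (Real.exp (-(j : ℝ)) / 4) ^ n *
      volume.real (Metric.ball (0 : EuclideanSpace ℝ (Fin n)) 1) := by
    rw [measureReal_def, hU, Measure.addHaar_ball _ _ (by positivity), ENNReal.toReal_mul,
      ENNReal.toReal_ofReal (by positivity), finrank_euclideanSpace_fin, measureReal_def]
  refine le_trans (le_of_eq ?_) (setIntegral_ge_of_const_le_real (hUm j hj)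
    measure_ball_lt_top.ne (hκ j hj) (hUi j hj))
  rw [hvol, div_pow]
  field_simp

theorem not_hardySobolevInequality_of_interiorBall (hn : 3 ≤ n)
    {Ω : Set (EuclideanSpace ℝ (Fin n))} (ho : IsOpen Ω) (hb : Bornology.IsBounded Ω)
    (h0 : 0 ∈ frontier Ω) (hint : HasInteriorBallAtZero Ω) {a C : ℝ} (ha : 0 ≤ a)
    (haq : a < (2 * (n : ℝ) - 2) / ((n : ℝ) - 2)) (hC : 0 < C) :
    ¬ HardySobolevInequality Ω a C := by
  intro h
  obtain ⟨r, hr, c, hc, hB⟩ := hint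
  have hn' : (3 : ℝ) ≤ n := by exact_mod_cast hn
  have hn1 : 1 ≤ n := by omega
  have hn2 : (0 : ℝ) < n - 2 := by linarith
  have hD := supNorm_pos ho hb h0
  set D := supNorm Ω with hDdef
  have hs0 : ∀ x ∈ Metric.ball c r, 0 < ‖x‖ / (3 * D) := fun x hx => by
    have : x ≠ 0 := fun h' => zero_notMem_ball hc (h' ▸ hx)
    have := norm_pos_iff.2 this
    positivity
  have hs1 : ∀ x ∈ Metric.ball c r, ‖x‖ / (3 * D) ≤ 1 := fun x hx => by
    rw [div_le_one (by linarith)]; linarith [norm_le_supNorm hb (hB hx)]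
  have hX0 : ∀ x ∈ Metric.ball c r, 0 < logWeight (‖x‖ / (3 * D)) :=
    fun x hx => logWeight_pos (hs0 x hx) (hs1 x hx)
  have hX1 : ∀ x ∈ Metric.ball c r, logWeight (‖x‖ / (3 * D)) ≤ 1 :=
    fun x hx => logWeight_le_one (hs0 x hx) (hs1 x hx)
  obtain ⟨M, hM⟩ := exists_logarithmic_cutoff n
  set q : ℝ := 2 * (n : ℝ) / ((n : ℝ) - 2) with hq
  have hq0 : 0 < q := div_pos (by linarith) hn2
  set θ : ℝ := ((n : ℝ) - 2) / n with hθ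
  have hθ0 : 0 < θ := div_pos hn2 (by linarith)
  set vb := volume.real (Metric.ball (0 : EuclideanSpace ℝ (Fin n)) 1) with hvb
  have hvb0 : 0 < vb := by
    rw [hvb, measureReal_def]
    exact ENNReal.toReal_pos (Metric.measure_ball_pos _ _ one_pos).ne' measure_ball_lt_top.ne
  set κ : ℝ := (r * 2 ^ (-(n : ℝ) / 4)) ^ q with hκ
  have hκ0 : 0 < κ := by positivity
  set K : ℝ := 2 * (4 * (4 * r ^ 2 * M ^ 2) * n * vb) + n * (4 * (4 * r) * n * vb) with hK
  set L : ℝ := 5 ^ (-a) * κ * (4 ^ n)⁻¹ * vb with hL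
  have hL0 : 0 < L := by positivity
  -- 1 + log(3D) ≤ N gives 1 - log(|x|/3D) ≤ 5N where |x| ≥ e^(-4N); 4/r ≤ N makes the subballs of
  -- scale e^(-j) with j ≥ N fit into the interior ball.
  have hmain : ∀ N : ℕ, 1 ≤ N → 1 + Real.log (3 * D) ≤ N → 4 / r ≤ N →
      C * L ^ θ * (N : ℝ) ^ ((1 - a) * θ + 1) ≤ K := by
    intro N hN1 hN2 hN3
    have hN1' : (1 : ℝ) ≤ N := by exact_mod_cast hN1
    have hN0 : (0 : ℝ) < N := by linarith
    obtain ⟨f, hf, hfs, hf0, hf1, hfe, hfg⟩ := hM N hN1'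
    have hfc : HasCompactSupport f :=
      (isCompact_logShell (N : ℝ)).of_isClosed_subset (isClosed_tsupport f) hfs
    have hfz : (0 : EuclideanSpace ℝ (Fin n)) ∉ tsupport f :=
      fun h' => zero_notMem_logShell _ (hfs h')
    have hineq := h.le_of_hasCompactSupport hn hc hr hB ha hX0 hX1 hf hfc hfz
    have hu1 := setIntegral_gradient_logCutoff_le hn1 hc hN0 hfs hfg
    have hu2 := setIntegral_potential_logCutoff_le hn1 hc hr hN0 hfs hf0 hf1
    have hup : 2 * (∫ x in Metric.ball c r, ballGroundState ((2 : ℝ) • c) x ^ 2 *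
        ‖gradient f x‖ ^ 2) + n * (∫ x in Metric.ball c r, f x ^ 2 *
        (-inner ℝ x (x - (2 : ℝ) • c) * ((‖x‖ ^ 2) ^ (-(n : ℝ) / 4)) ^ 2)) ≤ K / N := by
      have e : K / N = 2 * (4 * (4 * r ^ 2 * M ^ 2) * n * vb / N)
          + n * (4 * (4 * r) * n * vb / N) := by rw [hK]; ring
      rw [e]
      gcongr
    have hgi := integrableOn_logWeight_rpow_mul ha Metric.isOpen_ball.measurableSet hX0 hX1
      (integrable_abs_mul_ballGroundState_rpow hq0 ((2 : ℝ) • c) hf.continuous hfc hfz)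
      fun x => by positivity
    -- These N scales lie where f = 1: j ≥ 2N + 1 gives (5/4)e^(-j) ≤ e^(-2N), and j ≤ 3N gives
    -- e^(-4N) ≤ (3/4)e^(-j).
    have hlow := card_mul_le_setIntegral_ball (J := Finset.Ioc (2 * N) (3 * N))
      (κ := (5 * (N : ℝ)) ^ (-a) * κ) hn1 hc hr hgi
      (fun x hx => by have := hX0 x hx; positivity)
      (fun j hj => by
        rw [Finset.mem_Ioc] at hj
        have hj1 : (N : ℝ) ≤ j := by exact_mod_cast (by omega : N ≤ j)
        have h1 : (j : ℝ) ≤ Real.exp j := by linarith [Real.add_one_le_exp (j : ℝ)]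
        have h2 : 4 / r ≤ Real.exp j := by linarith
        rw [Real.exp_neg, ← div_eq_mul_inv, div_le_iff₀ (Real.exp_pos _)]
        rw [div_le_iff₀ hr] at h2
        linarith)
      (fun j hj x hx => by
        rw [Finset.mem_Ioc] at hj
        have hj1 : 2 * (N : ℝ) + 1 ≤ j := by exact_mod_cast hj.1
        have hj2 : (j : ℝ) ≤ 3 * N := by exact_mod_cast hj.2
        have h1 : (j : ℝ) ≤ Real.exp j := by linarith [Real.add_one_le_exp (j : ℝ)]
        have h4r : 4 * Real.exp (-(j : ℝ)) ≤ r := by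
          have h2 : 4 / r ≤ Real.exp j := by linarith
          rw [Real.exp_neg, ← div_eq_mul_inv, div_le_iff₀ (Real.exp_pos _)]
          rw [div_le_iff₀ hr] at h2
          linarith
        have hxB := normalBall_subset_ball hc hr (Real.exp_pos _) h4r hx
        obtain ⟨g1, g2, -⟩ := mem_normalBall hc hr (Real.exp_pos _) h4r hx
        have hxn : 0 < ‖x‖ := by have := Real.exp_pos (-(j : ℝ)); linarith
        have e1 : 2 * Real.exp (-(j : ℝ)) ≤ Real.exp (-(2 * N)) := by
          have : Real.exp (-(2 * N)) = Real.exp ((j : ℝ) - 2 * N) * Real.exp (-(j : ℝ)) := by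
            rw [← Real.exp_add]; congr 1; ring
          rw [this]
          gcongr
          linarith [Real.add_one_le_exp ((j : ℝ) - 2 * N)]
        have e2 : 2 * Real.exp (-(4 * N)) ≤ Real.exp (-(j : ℝ)) := by
          have : Real.exp (-(j : ℝ)) = Real.exp (4 * N - (j : ℝ)) * Real.exp (-(4 * N)) := by
            rw [← Real.exp_add]; congr 1; ring
          rw [this]
          gcongr
          linarith [Real.add_one_le_exp (4 * N - (j : ℝ))]
        have e3 := Real.exp_pos (-(j : ℝ))
        have hx4 : Real.exp (-(4 * N)) ≤ ‖x‖ := by linarith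
        have hfx : f x = 1 := hfe x hx4 (by linarith)
        rw [hfx, one_mul]
        have hXx : (5 * (N : ℝ))⁻¹ ≤ logWeight (‖x‖ / (3 * D)) := by
          rw [← Real.le_log_iff_exp_le hxn] at hx4
          have hl := Real.log_nonpos (hs0 x hxB).le (hs1 x hxB)
          rw [logWeight, ← one_div]
          refine one_div_le_one_div_of_le (by linarith) ?_
          rw [Real.log_div hxn.ne' (by positivity)]
          linarith
        rw [mul_assoc]
        refine mul_le_mul ?_ (ballGroundState_rpow_ge hn hc hr (Real.exp_pos _) h4r hx)
          (by positivity) (by have := hX0 x hxB; positivity)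
        rw [Real.rpow_neg (by positivity), ← Real.inv_rpow (by positivity)]
        gcongr)
    have hcard : ((Finset.Ioc (2 * N) (3 * N)).card : ℝ) = N := by
      rw [Nat.card_Ioc]
      congr 1
      omega
    rw [hcard] at hlow
    have elow : (N : ℝ) * ((5 * (N : ℝ)) ^ (-a) * κ * (4 ^ n)⁻¹ * vb) = L * (N : ℝ) ^ (1 - a) := by
      rw [hL, Real.mul_rpow (by norm_num) hN0.le, sub_eq_add_neg, Real.rpow_add hN0,
        Real.rpow_one]
      ring
    rw [elow] at hlow
    have h1 := mul_le_mul_of_nonneg_left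
      (Real.rpow_le_rpow (by positivity) hlow hθ0.le) hC.le
    have h2 := h1.trans (hineq.trans hup)
    rw [Real.mul_rpow hL0.le (by positivity), ← Real.rpow_mul hN0.le, le_div_iff₀ hN0] at h2
    rw [Real.rpow_add hN0, Real.rpow_one]
    linarith
  -- The critical exponent is 1 + 1/θ, so the power of N is positive below it.
  have hβ : 0 < (1 - a) * θ + 1 := by
    have h1 : (2 * (n : ℝ) - 2) / ((n : ℝ) - 2) = 1 + θ⁻¹ := by
      rw [hθ, inv_div]; field_simp; ring
    rw [h1] at haq
    have h2 : (a - 1) * θ < θ⁻¹ * θ := by gcongr; linarith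
    rw [inv_mul_cancel₀ hθ0.ne'] at h2
    linarith
  have hlim : Filter.Tendsto (fun N : ℕ => C * L ^ θ * (N : ℝ) ^ ((1 - a) * θ + 1))
      Filter.atTop Filter.atTop :=
    ((tendsto_rpow_atTop hβ).comp tendsto_natCast_atTop_atTop).const_mul_atTop (by positivity)
  have hev : ∀ t : ℝ, ∀ᶠ N : ℕ in Filter.atTop, t ≤ (N : ℝ) := fun t =>
    tendsto_natCast_atTop_atTop.eventually_ge_atTop t
  obtain ⟨N, h1, h2, h3, h4⟩ := ((hlim.eventually_gt_atTop K).and ((hev 1).and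
    ((hev (1 + Real.log (3 * D))).and (hev (4 / r))))).exists
  exact absurd (hmain N (by exact_mod_cast h2) h3 h4) (not_le.2 h1)

end Sharpness

/-! ### Conclusion -/

theorem theorem1p2 (n : ℕ) (hn : 3 ≤ n) :
    ∃ σ C : ℝ, 0 < σ ∧ 0 < C ∧
      ∀ (Ω : Set (EuclideanSpace ℝ (Fin n))) (ρ : ℝ),
        IsOpen Ω → IsConnected Ω → Bornology.IsBounded Ω → 0 ∈ frontier Ω →
        HasExteriorBallAtZero Ω ρ → supNorm Ω / σ ≤ ρ →
          HardySobolevInequality Ω ((2 * (n : ℝ) - 2) / ((n : ℝ) - 2)) C ∧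
          (HasInteriorBallAtZero Ω →
            ∀ p : ℝ, p < (2 * (n : ℝ) - 2) / ((n : ℝ) - 2) →
              ¬ ∃ C' : ℝ, 0 < C' ∧ HardySobolevInequality Ω p C') := by
  obtain ⟨C, hC, hmain⟩ := exists_hardySobolev_const hn
  have hn' : (3 : ℝ) ≤ n := by exact_mod_cast hn
  refine ⟨1 / (500 * (n : ℝ) ^ 2), C, by positivity, hC, ?_⟩
  intro Ω ρ ho _ hb h0 hext hρ
  obtain ⟨p, hp⟩ := outsideLargeBall_of_exteriorBall (by omega) ho hb h0 hext hρ
  refine ⟨hardySobolevInequality_of_setIntegral_tsupport hn fun u hu =>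
    hmain Ω p (supNorm Ω) u hp (hu.1.of_le (by exact_mod_cast le_top)) hu.2.1 hu.2.2, ?_⟩
  rintro hint a ha ⟨C', hC', h⟩
  -- A negative exponent is first raised to 0, which is still below the critical one.
  refine not_hardySobolevInequality_of_interiorBall hn ho hb h0 hint (le_max_right a 0)
    (max_lt ha (div_pos (by linarith) (by linarith))) hC'
    (h.mono_exponent hn hC'.le ho hb h0 (le_max_left a 0))
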